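/- **Setting.** A labelled transition system (LTS) $L=(S,\Sigma,\Delta,\hat s)$ consists of a set of states $S$, an alphabet $\Sigma$ (a possibly infinite set of visible actions), a set of transitions $\Delta\subseteq S\times(\Sigma\cup\{\tau\})\times S$ with $\tau\notin\Sigma$ the invisible action, and an initial state $\hat s\in S$. Visible actions are taken from a proper class, so that for every set of actions there is an action outside it. **Operators.** For a set $\Phi$ of pairs of visible actions, write $\Phi(a,b)$ if $(a,b)\in\Phi$, or $a=b$ and $a$ is not in the domain of $\Phi$. * Action prefix $a.L$ ($a\ne\tau$): a new initial state with a single transition, labelled $a$, to $\hat s$; alphabet $\Sigma\cup\{a\}$. * Hiding $L\setminus A$: labels in the set $A$ are replaced by $\tau$; alphabet $\Sigma\setminus A$. * Relational renaming $L\Phi$: each transition $(s,a,s')$ with $a\ne\tau$ is replaced by all $(s,b,s')$ with $\Phi(a,b)$, and $\tau$-transitions are kept; alphabet $\{b\mid\exists a\in\Sigma:\Phi(a,b)\}$. * Parallel composition $L_1\,\|\,L_2$: states $S_1\times S_2$, alphabet $\Sigma_1\cup\Sigma_2$; actions in $\Sigma_1\cap\Sigma_2$ are executed simultaneously by both components,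 all other actions and $\tau$ by one component while the other stays in its state. A *congruence* is an equivalence $\cong$ on LTSs such that $L\cong L'$ implies $a.L\cong a.L'$, $L\setminus A\cong L'\setminus A$, $L\Phi\cong L'\Phi$, $L\,\|\,M\cong L'\,\|\,M$ and $M\,\|\,L\cong M\,\|\,L'$ for all $a,A,\Phi,M$. **Semantic sets.** Write $\hat s\Rightarrow^{\sigma}s$ if some path from $\hat s$ to $s$ has visible label sequence $\sigma$. Below, $\sigma$ ranges over finite sequences of elements of $\Sigma$, $A$ over subsets of $\Sigma$, $\xi$ over infinite sequences of elements of $\Sigma$, and $\xi_i$ is the prefix of $\xi$ of length $i$. * $\mathit{Tr}(L)=\{\sigma\mid\exists s:\hat s\Rightarrow^{\sigma}s\}$. * $\mathit{Div}(L)$: the $\sigma$ such that $\hat s\Rightarrow^\sigma s$ for some $s$ that starts an infinite path of $\tau$-transitions. * $\mathit{Inf}(L)$: the $\xi$ that are the visible label sequence of an infinite path from $\hat s$. * $\mathit{Sf}(L)$: the $(\sigma,A)$ such that $\hat s\Rightarrow^\sigma s$ for some $s$ with no outgoing transition labelled in $A\cup\{\tau\}$. * $\mathit{minD}(L)$: the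 $\sigma\in\mathit{Div}(L)$ with no proper prefix in $\mathit{Div}(L)$. * $\mathit{extT}(L)$ and $\mathit{extI}(L)$: the $\sigma$, respectively the $\xi$, with a (not necessarily proper) finite prefix in $\mathit{minD}(L)$. * $\mathit{anI}(L)=\mathit{Inf}(L)\setminus\mathit{extI}(L)$. * $\mathit{eanI}(L)$: the $\xi\in\mathit{Inf}(L)$ such that $\exists n\,\forall i\ge n:\xi_i\notin\mathit{Div}(L)$. * $\mathit{aenI}(L)$: the $\xi\in\mathit{Inf}(L)$ such that $\forall n\,\exists i\ge n:\xi_i\notin\mathit{Div}(L)$. * $\mathit{snF}(L)$: the $(\sigma,A)\in\mathit{Sf}(L)$ with $\sigma\notin\mathit{Div}(L)$ and $\sigma a\notin\mathit{Div}(L)$ for all $a\in A$. * $\mathit{anF}(L)$: the $(\sigma,A)\in\mathit{Sf}(L)$ with $\sigma\notin\mathit{extT}(L)$. * $\mathit{sanF}(L)$: the $(\sigma,A)\in\mathit{anF}(L)$ with $\sigma a\notin\mathit{minD}(L)$ for all $a\in A$. Write $\Sigma(L)$ for the alphabet of $L$. The equivalence *induced by* $X_1,\dots,X_k$ relates $L$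 and $L'$ if and only if $X_i(L)=X_i(L')$ for all $i$; $\cong$ *preserves* $X$ if $L\cong L'$ implies $X(L)=X(L')$. CFFD-equivalence is the equivalence induced by $\Sigma,\mathit{Sf},\mathit{Div},\mathit{Inf}$. *Livelock* is the LTS with empty alphabet, one state and a $\tau$-loop. *Bothlock* is the LTS with empty alphabet whose initial state has a $\tau$-loop and a $\tau$-transition to a second state, which has no outgoing transitions. **Theorem.** Let $\cong$ be a congruence that is implied by CFFD-equivalence and satisfies livelock $\cong$ bothlock. For each row of the following table, if $\cong$ preserves every set in the first column and preserves none of the sets in the second column, then $\cong$ is the equivalence induced by the sets in the third column. | preserves | does not preserve any of | induced by | |---|---|---| | $\mathit{sanF},\mathit{minD}$ | $\mathit{Tr},\mathit{anF}$ | $\Sigma,\mathit{sanF},\mathit{minD},\mathit{anI}$ | | $\mathit{Tr},\mathit{sanF},\mathit{minD}$ | $\mathit{anF},\mathit{Div},\mathit{Inf}$ | $\Sigma,\mathit{Tr},\mathit{sanF},\mathit{minD},\mathit{anI}$ | | $\mathit{sanF},\mathit{minD},\mathit{Inf}$ | $\mathit{anF},\mathit{Div}$ | $\Sigma,\mathit{Tr},\mathit{sanF},\mathit{minD},\mathit{Inf}$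 | | $\mathit{sanF},\mathit{Div}$ | $\mathit{anF},\mathit{snF},\mathit{aenI}$ | $\Sigma,\mathit{Tr},\mathit{sanF},\mathit{Div},\mathit{eanI}$ | | $\mathit{sanF},\mathit{Div},\mathit{aenI}$ | $\mathit{anF},\mathit{snF},\mathit{Inf}$ | $\Sigma,\mathit{Tr},\mathit{sanF},\mathit{Div},\mathit{aenI}$ | | $\mathit{sanF},\mathit{Div},\mathit{Inf}$ | $\mathit{anF},\mathit{snF}$ | $\Sigma,\mathit{Tr},\mathit{sanF},\mathit{Div},\mathit{Inf}$ | -/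

import Mathlib

universe u v

/-- A labelled transition system. Visible actions are elements of `Act`, and a label is an element
of `Option Act`, where `none` is the invisible action `τ`. The states form a `u`-small type and the
alphabet is a `u`-small set of visible actions. -/
structure LTS (Act : Type v) where
  /-- the set of states -/
  State : Type u
  /-- the alphabet -/
  alphabet : Set Act
  small_alphabet : Small.{u} alphabet
  /-- the transition relation -/
  trans : State → Option Act → State → Prop
  mem_of_trans : ∀ s a s', trans s (some a) s' → a ∈ alphabet
  /-- the initial state -/
  init : State

namespace LTS

variable {Act : Type v}

/-! ### The operators -/

/-- Action prefix `a.L`; the new initial state is `none`. -/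
def actionPrefix (a : Act) (L : LTS.{u, v} Act) : LTS.{u, v} Act where
  State := Option L.State
  alphabet := insert a L.alphabet
  small_alphabet := by
    have := L.small_alphabet
    exact small_insert a L.alphabet
  trans s x s' :=
    (∃ t t', s = some t ∧ s' = some t' ∧ L.trans t x t') ∨
      (s = none ∧ x = some a ∧ s' = some L.init)
  mem_of_trans := by
    rintro s b s' (⟨t, t', -, -, h⟩ | ⟨-, h, -⟩)
    · exact Or.inr (L.mem_of_trans t b t' h)
    · exact Or.inl (Option.some.inj h)
  init := none

/-- Hiding `L \ A`. -/
def hide (L : LTS.{u, v} Act) (A : Set Act) : LTS.{u, v} Act where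
  State := L.State
  alphabet := L.alphabet \ A
  small_alphabet := by
    have := L.small_alphabet
    exact small_subset (Set.sdiff_subset (s := L.alphabet) (t := A))
  trans s x s' := ∃ y, L.trans s y s' ∧
    ((x = y ∧ y ∉ some '' A) ∨ (x = none ∧ y ∈ some '' A))
  mem_of_trans := by
    rintro s a s' ⟨y, h, ⟨rfl, hy⟩ | ⟨hx, -⟩⟩
    · exact ⟨L.mem_of_trans s a s' h, fun ha => hy ⟨a, ha, rfl⟩⟩
    · exact absurd hx (Option.some_ne_none a)
  init := L.init

/-- `Renames Φ a b` is the relation `Φ(a, b)`: either `(a, b) ∈ Φ`, or `a = b` is not in the domain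
of `Φ`. -/
def Renames (Φ : Set (Act × Act)) (a b : Act) : Prop :=
  (a, b) ∈ Φ ∨ (a = b ∧ ∀ c, (a, c) ∉ Φ)

/-- Relational renaming `LΦ`, where `Φ` is a (small) set of pairs of visible actions. -/
def rename (L : LTS.{u, v} Act) (Φ : Set (Act × Act)) (hΦ : Small.{u} Φ) : LTS.{u, v} Act where
  State := L.State
  alphabet := {b | ∃ a ∈ L.alphabet, Renames Φ a b}
  small_alphabet := by
    have := L.small_alphabet
    have := hΦ
    refine small_subset (s := L.alphabet ∪ Prod.snd '' Φ) ?_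
    rintro b ⟨a, ha, h | ⟨rfl, -⟩⟩
    · exact Or.inr ⟨(a, b), h, rfl⟩
    · exact Or.inl ha
  trans s x s' :=
    (x = none ∧ L.trans s none s') ∨
      ∃ a b, x = some b ∧ L.trans s (some a) s' ∧ Renames Φ a b
  mem_of_trans := by
    rintro s c s' (⟨h, -⟩ | ⟨a, b, hb, h, hab⟩)
    · exact absurd h (Option.some_ne_none c)
    · obtain rfl := Option.some.inj hb
      exact ⟨a, L.mem_of_trans s a s' h, hab⟩
  init := L.init

/-- Parallel composition `L₁ || L₂`, synchronizing on the common visible actions. -/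
def par (L₁ L₂ : LTS.{u, v} Act) : LTS.{u, v} Act where
  State := L₁.State × L₂.State
  alphabet := L₁.alphabet ∪ L₂.alphabet
  small_alphabet := by
    have := L₁.small_alphabet
    have := L₂.small_alphabet
    exact small_union L₁.alphabet L₂.alphabet
  trans s x s' :=
    (x ∉ some '' L₂.alphabet ∧ L₁.trans s.1 x s'.1 ∧ s'.2 = s.2) ∨
    (x ∉ some '' L₁.alphabet ∧ L₂.trans s.2 x s'.2 ∧ s'.1 = s.1) ∨
    (x ∈ some '' (L₁.alphabet ∩ L₂.alphabet) ∧ L₁.trans s.1 x s'.1 ∧ L₂.trans s.2 x s'.2)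
  mem_of_trans := by
    rintro s a s' (⟨-, h, -⟩ | ⟨-, h, -⟩ | ⟨-, h, -⟩)
    · exact Or.inl (L₁.mem_of_trans _ _ _ h)
    · exact Or.inr (L₂.mem_of_trans _ _ _ h)
    · exact Or.inl (L₁.mem_of_trans _ _ _ h)
  init := (L₁.init, L₂.init)

/-! ### Livelock and bothlock -/

/-- The LTS with the empty alphabet, one state, and a `τ`-loop. -/
def livelock : LTS.{u, v} Act where
  State := PUnit.{u + 1}
  alphabet := ∅
  small_alphabet := small_empty
  trans _ x _ := x = none
  mem_of_trans _ a _ h := absurd h (Option.some_ne_none a)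
  init := PUnit.unit

/-- The LTS with the empty alphabet and two states, whose initial state (`true`) has a `τ`-loop and
a `τ`-transition to a deadlocked state (`false`). -/
def bothlock : LTS.{u, v} Act where
  State := ULift.{u} Bool
  alphabet := ∅
  small_alphabet := small_empty
  trans s x _ := s = ULift.up true ∧ x = none
  mem_of_trans _ a _ h := absurd h.2 (Option.some_ne_none a)
  init := ULift.up true

/-! ### Paths -/

/-- `L.Reach s σ s'`: there is a finite path from `s` to `s'` whose sequence of visible labels
is `σ`. -/
inductive Reach (L : LTS.{u, v} Act) : L.State → List Act → L.State → Prop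
  | refl (s : L.State) : Reach L s [] s
  | tau {s t s' : L.State} {σ : List Act} :
      L.trans s none t → Reach L t σ s' → Reach L s σ s'
  | visible {s t s' : L.State} {a : Act} {σ : List Act} :
      L.trans s (some a) t → Reach L t σ s' → Reach L s (a :: σ) s'

/-- There is an infinite path of invisible transitions from `s`. -/
def Diverges (L : LTS.{u, v} Act) (s : L.State) : Prop :=
  ∃ p : ℕ → L.State, p 0 = s ∧ ∀ n, L.trans (p n) none (p (n + 1))

/-- The prefix of length `n` of an infinite sequence. -/
def pre (ξ : ℕ → Act) (n : ℕ) : List Act := (List.range n).map ξ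

/-! ### Semantic sets -/

/-- Traces. -/
def Tr (L : LTS.{u, v} Act) : Set (List Act) := {σ | ∃ s, L.Reach L.init σ s}

/-- Divergence traces. -/
def Div (L : LTS.{u, v} Act) : Set (List Act) := {σ | ∃ s, L.Reach L.init σ s ∧ L.Diverges s}

/-- Infinite traces. -/
def Inf (L : LTS.{u, v} Act) : Set (ℕ → Act) :=
  {ξ | ∃ p : ℕ → L.State, p 0 = L.init ∧ ∀ n, L.Reach (p n) [ξ n] (p (n + 1))}

/-- Stable failures. -/
def Sf (L : LTS.{u, v} Act) : Set (List Act × Set Act) :=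
  {f | f.2 ⊆ L.alphabet ∧ ∃ s, L.Reach L.init f.1 s ∧
    (∀ s', ¬ L.trans s none s') ∧ ∀ a ∈ f.2, ∀ s', ¬ L.trans s (some a) s'}

/-- Minimal divergence traces. -/
def minD (L : LTS.{u, v} Act) : Set (List Act) :=
  {σ | σ ∈ L.Div ∧ ∀ i < σ.length, σ.take i ∉ L.Div}

/-- Finite extensions of minimal divergence traces. -/
def extT (L : LTS.{u, v} Act) : Set (List Act) :=
  {σ | (∀ a ∈ σ, a ∈ L.alphabet) ∧ ∃ i ≤ σ.length, σ.take i ∈ L.minD}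

/-- Infinite extensions of minimal divergence traces. -/
def extI (L : LTS.{u, v} Act) : Set (ℕ → Act) :=
  {ξ | (∀ n, ξ n ∈ L.alphabet) ∧ ∃ i, pre ξ i ∈ L.minD}

/-- Always-nondivergent infinite traces. -/
def anI (L : LTS.{u, v} Act) : Set (ℕ → Act) := L.Inf \ L.extI

/-- Eventually-always-nondivergent infinite traces. -/
def eanI (L : LTS.{u, v} Act) : Set (ℕ → Act) :=
  {ξ | ξ ∈ L.Inf ∧ ∃ n, ∀ i ≥ n, pre ξ i ∉ L.Div}

/-- Always-eventually-nondivergent infinite traces. -/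
def aenI (L : LTS.{u, v} Act) : Set (ℕ → Act) :=
  {ξ | ξ ∈ L.Inf ∧ ∀ n, ∃ i ≥ n, pre ξ i ∉ L.Div}

/-- Nondivergent failures. -/
def nF (L : LTS.{u, v} Act) : Set (List Act × Set Act) :=
  {f | f ∈ L.Sf ∧ f.1 ∉ L.Div}

/-- Strongly nondivergent failures. -/
def snF (L : LTS.{u, v} Act) : Set (List Act × Set Act) :=
  {f | f ∈ L.nF ∧ ∀ a ∈ f.2, f.1 ++ [a] ∉ L.Div}

/-- Always nondivergent failures. -/
def anF (L : LTS.{u, v} Act) : Set (List Act × Set Act) :=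
  {f | f ∈ L.Sf ∧ f.1 ∉ L.extT}

/-- Strongly always nondivergent failures. -/
def sanF (L : LTS.{u, v} Act) : Set (List Act × Set Act) :=
  {f | f ∈ L.anF ∧ ∀ a ∈ f.2, f.1 ++ [a] ∉ L.minD}

/-! ### Equivalences -/

/-- CFFD-equivalence: the equivalence induced by the alphabet, the stable failures, the divergence
traces and the infinite traces. -/
def CFFDEquiv (L L' : LTS.{u, v} Act) : Prop :=
  L.alphabet = L'.alphabet ∧ L.Sf = L'.Sf ∧ L.Div = L'.Div ∧ L.Inf = L'.Inf

/-- `r` preserves the semantic set `X`. -/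
def Preserves {β : Type*} (r : LTS.{u, v} Act → LTS.{u, v} Act → Prop)
    (X : LTS.{u, v} Act → β) : Prop :=
  ∀ L L', r L L' → X L = X L'

/-- `r` is a congruence with respect to action prefix, hiding, relational renaming and parallel
composition. -/
structure IsCongruence (r : LTS.{u, v} Act → LTS.{u, v} Act → Prop) : Prop where
  equivalence : Equivalence r
  actionPrefix : ∀ (a : Act) (L L' : LTS.{u, v} Act), r L L' →
    r (L.actionPrefix a) (L'.actionPrefix a)
  hide : ∀ (A : Set Act), Small.{u} A → ∀ L L' : LTS.{u, v} Act, r L L' →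
    r (L.hide A) (L'.hide A)
  rename : ∀ (Φ : Set (Act × Act)) (hΦ : Small.{u} Φ) (L L' : LTS.{u, v} Act), r L L' →
    r (L.rename Φ hΦ) (L'.rename Φ hΦ)
  par_right : ∀ L L' M : LTS.{u, v} Act, r L L' → r (L.par M) (L'.par M)
  par_left : ∀ L L' M : LTS.{u, v} Act, r L L' → r (M.par L) (M.par L')

end LTS

/-!
# Congruences coarser than CFFD-equivalence that equate livelock and bothlock

A congruence `r` that is implied by CFFD-equivalence sees an LTS only through its alphabet and the
sets `Sf`, `Div` and `Inf`. The proof brings every LTS into a normal form: `L` is related by `r` to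
an LTS whose `Sf`, `Div` and `Inf` are functions of the sets by which `r` is claimed to be induced.
Two LTSs that agree on these sets have CFFD-equivalent normal forms, hence they are related
(`Admissible.of_normal_forms`).

**Contexts.** A `Controller` is an arbitrary labelled transition system that can start an unknown
LTS `M` and can watch or hide its actions. Up to a choice of names for its moves, which exists
because the actions form a proper class, this is parallel composition with a prefixed and renamed
copy of `M`, followed by hiding and renaming (`Controller.run_eq`). So `r M M'` implies
`r (C.run M) (C.run M')`, provided that `r` preserves the alphabet (`IsCongruence.run`). The
alphabet is preserved as soon as `sanF` is (`alphabet_eq_of_preserves_sanF`).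

**Using a set that is not preserved.** If `r` does not preserve a set `X`, there are `M` and `M'`
with `r M M'` and an element of `X M` outside of `X M'`. For any `L`, a `Detour` is a controller that
behaves like `L`, but can also follow a word of its own choice while it leads the subprocess towards
the distinguishing element. It is arranged so that with `M'` nothing is added: whenever a detour is
bound to fail, all that it has shown is possible in `L` too. Then `L` is CFFD-equivalent to the detour
running `M'`, which is related to the detour running `M` (`Admissible.detour`), and in the latter the
extra behaviour has been added to `L`. The subprocess is allowed to diverge where `L` does, and this
is harmless only if `L` has all refusals after its divergence traces. These are added first, with
livelock and bothlock as the related pair (`Admissible.exists_saturated`). For a saturated `L`,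

* if `Tr` is not preserved, everything can be added after a divergence trace
  (`Admissible.exists_chaotic`);
* if `Div` is not preserved, all traces that extend a divergence trace can be made divergence traces
  (`Admissible.exists_divExt_divergent`);
* if `Inf` or `aenI` is not preserved, infinite words of which eventually all, respectively
  infinitely many, prefixes are divergence traces can be added (`Admissible.exists_infinite`);
* if `anF` is not preserved, then letters that lead to a minimal divergence trace can be refused
  freely, and if `snF` is not preserved, everything can be refused after an extension of a
  divergence trace (`Admissible.exists_refusing`).

What remains of the original behaviour is exactly what the claimed sets describe.

**Preserved sets.** It must also be shown that `r` preserves the sets in the claim that are not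
assumed to be preserved, namely `Tr`, `anI` and `eanI`. This is done by observers, which are
controllers that drive an LTS invisibly along a given word and turn reading all of it into a
divergence or an infinite trace of their own (`Admissible.preserves_Tr_of_Div`, `Admissible.preserves_Tr_of_Inf`,
`Admissible.preserves_anI`, `Admissible.preserves_eanI`).
-/


namespace LTS

variable {Act : Type v}

/-! ### Words, paths and divergence -/

section Paths

variable {L : LTS.{u, v} Act}

theorem Reach.append {s t s' : L.State} {σ τ : List Act} (h : L.Reach s σ t) (h' : L.Reach t τ s') :
    L.Reach s (σ ++ τ) s' := by
  induction h with
  | refl => exact h'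
  | tau h _ ih => exact .tau h (ih h')
  | visible h _ ih => exact .visible h (ih h')

theorem Reach.snoc_tau {s t s' : L.State} {σ : List Act} (h : L.Reach s σ t)
    (h' : L.trans t none s') : L.Reach s σ s' := by
  simpa using h.append (.tau h' (.refl _))

theorem Reach.snoc {s t s' : L.State} {σ : List Act} {a : Act} (h : L.Reach s σ t)
    (h' : L.trans t (some a) s') : L.Reach s (σ ++ [a]) s' :=
  h.append (.visible h' (.refl _))

theorem reach_cons {s s' : L.State} {a : Act} {σ : List Act} (h : L.Reach s (a :: σ) s') :
    ∃ t, L.Reach s [a] t ∧ L.Reach t σ s' := by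
  generalize hw : a :: σ = w at h
  induction h with
  | refl => cases hw
  | tau h _ ih =>
    obtain ⟨t, h1, h2⟩ := ih hw
    exact ⟨t, .tau h h1, h2⟩
  | visible h h' _ =>
    cases hw
    exact ⟨_, .visible h (.refl _), h'⟩

theorem reach_append {s s' : L.State} {σ τ : List Act} (h : L.Reach s (σ ++ τ) s') :
    ∃ t, L.Reach s σ t ∧ L.Reach t τ s' := by
  induction σ generalizing s with
  | nil => exact ⟨s, .refl _, h⟩
  | cons a σ ih =>
    obtain ⟨t, h1, h2⟩ := reach_cons h
    obtain ⟨t', h3, h4⟩ := ih h2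
    exact ⟨t', by simpa using h1.append h3, h4⟩

theorem Reach.mem_alphabet {s s' : L.State} {σ : List Act} (h : L.Reach s σ s') :
    ∀ a ∈ σ, a ∈ L.alphabet := by
  induction h with
  | refl => simp
  | tau _ _ ih => exact ih
  | visible h _ ih =>
    intro b hb
    rcases List.mem_cons.1 hb with rfl | hb
    · exact L.mem_of_trans _ _ _ h
    · exact ih b hb

/-- A property of pairs (state, word read so far) that is kept by all transitions is kept by all
finite paths. -/
theorem Reach.invariant {I : L.State → List Act → Prop}
    (htau : ∀ q q' σ, I q σ → L.trans q none q' → I q' σ)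
    (hvis : ∀ q q' σ a, I q σ → L.trans q (some a) q' → I q' (σ ++ [a]))
    {q q' : L.State} {σ τ : List Act} (hq : I q σ) (h : L.Reach q τ q') : I q' (σ ++ τ) := by
  induction h generalizing σ with
  | refl => simpa using hq
  | tau h _ ih => exact ih (htau _ _ _ hq h)
  | visible h _ ih => simpa using ih (hvis _ _ _ _ hq h)

theorem mem_Tr_of_append {σ τ : List Act} (h : σ ++ τ ∈ L.Tr) : σ ∈ L.Tr := by
  obtain ⟨s, hs⟩ := h
  obtain ⟨t, ht, -⟩ := reach_append hs
  exact ⟨t, ht⟩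

theorem Div_subset_Tr : L.Div ⊆ L.Tr := fun _ ⟨s, hs, _⟩ => ⟨s, hs⟩

theorem nil_mem_Tr : [] ∈ L.Tr := ⟨L.init, .refl _⟩

theorem mem_alphabet_of_mem_Tr {σ : List Act} (h : σ ∈ L.Tr) : ∀ a ∈ σ, a ∈ L.alphabet :=
  h.elim fun _ hs => hs.mem_alphabet

/-- A state converges if it is accessible for the converse of the invisible transition relation. -/
def Converges (L : LTS.{u, v} Act) (s : L.State) : Prop :=
  Acc (fun x y => L.trans y none x) s

theorem Converges.step {s t : L.State} (h : L.Converges s) (h' : L.trans s none t) :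
    L.Converges t :=
  Acc.inv h h'

theorem not_diverges_iff {s : L.State} : ¬ L.Diverges s ↔ L.Converges s := by
  constructor
  · intro h
    by_contra hc
    have key : ∀ x : {x // ¬ L.Converges x}, ∃ y : {x // ¬ L.Converges x},
        L.trans x.1 none y.1 := by
      rintro ⟨x, hx⟩
      by_contra hn
      refine hx (Acc.intro x fun y hy => ?_)
      by_contra hy'
      exact hn ⟨⟨y, hy'⟩, hy⟩
    choose f hf using key
    refine h ⟨fun n => (f^[n] ⟨s, hc⟩).1, rfl, fun n => ?_⟩
    simp only [Function.iterate_succ_apply']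
    exact hf _
  · rintro h ⟨p, hp, hs⟩
    have : ∀ x, L.Converges x → ∀ n, p n ≠ x := by
      intro x hx
      induction hx with
      | intro x _ ih =>
        rintro n rfl
        exact ih _ (hs n) (n + 1) rfl
    exact this s h 0 hp

theorem converges_of_not_mem_Div {σ : List Act} {s : L.State} (h : L.Reach L.init σ s)
    (hσ : σ ∉ L.Div) : L.Converges s :=
  not_diverges_iff.1 fun hd => hσ ⟨s, h, hd⟩

theorem mem_Div_of_not_converges {σ : List Act} {s : L.State} (h : L.Reach L.init σ s)
    (hs : ¬ L.Converges s) : σ ∈ L.Div :=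
  ⟨s, h, by_contra fun hd => hs (not_diverges_iff.1 hd)⟩

/-- If every state in `I` has an invisible transition that stays in `I`, then the states in `I`
diverge. -/
theorem diverges_of_forall {I : L.State → Prop} (h : ∀ q, I q → ∃ q', L.trans q none q' ∧ I q')
    {q : L.State} (hq : I q) : L.Diverges q := by
  by_contra hd
  have hc := not_diverges_iff.1 hd
  clear hd
  induction hc with
  | intro x _ ih =>
    obtain ⟨y, hy, hI⟩ := h x hq
    exact ih y hy hI

/-- A converging state reaches a stable state by invisible transitions. -/
theorem Converges.exists_stable {s : L.State} (h : L.Converges s) :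
    ∃ t, L.Reach s [] t ∧ ∀ t', ¬ L.trans t none t' := by
  induction h with
  | intro x _ ih =>
    by_cases hx : ∃ y, L.trans x none y
    · obtain ⟨y, hy⟩ := hx
      obtain ⟨t, ht, hs⟩ := ih y hy
      exact ⟨t, .tau hy ht, hs⟩
    · exact ⟨x, .refl _, fun t' ht' => hx ⟨t', ht'⟩⟩

theorem exists_stable_of_not_mem_Div {σ : List Act} (h : σ ∈ L.Tr) (hσ : σ ∉ L.Div) :
    ∃ s, L.Reach L.init σ s ∧ ∀ s', ¬ L.trans s none s' := by
  obtain ⟨s, hs⟩ := h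
  obtain ⟨t, ht, hst⟩ := (converges_of_not_mem_Div hs hσ).exists_stable
  exact ⟨t, by simpa using hs.append ht, hst⟩

theorem mem_Tr_of_mem_Sf {f : List Act × Set Act} (h : f ∈ L.Sf) : f.1 ∈ L.Tr :=
  h.2.elim fun s hs => ⟨s, hs.1⟩

/-! ### Prefixes of infinite words -/

@[simp] theorem length_pre (ξ : ℕ → Act) (n : ℕ) : (pre ξ n).length = n := by simp [pre]

@[simp] theorem pre_zero (ξ : ℕ → Act) : pre ξ 0 = [] := rfl

theorem pre_succ (ξ : ℕ → Act) (n : ℕ) : pre ξ (n + 1) = pre ξ n ++ [ξ n] := by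
  simp [pre, List.range_succ]

theorem pre_add (ξ : ℕ → Act) (m n : ℕ) :
    pre ξ (m + n) = pre ξ m ++ pre (fun i => ξ (m + i)) n := by
  simp [pre, List.range_add, Function.comp_def]

theorem take_pre (ξ : ℕ → Act) (m n : ℕ) : (pre ξ n).take m = pre ξ (min m n) := by
  simp [pre, ← List.map_take, List.take_range]

theorem pre_succ' (ξ : ℕ → Act) (n : ℕ) : pre ξ (n + 1) = ξ 0 :: pre (fun i => ξ (i + 1)) n := by
  rw [Nat.add_comm, pre_add]
  simp [pre_succ, Nat.add_comm]

theorem pre_injective {ξ ζ : ℕ → Act} (h : ∀ n, pre ξ n = pre ζ n) : ξ = ζ := by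
  funext n
  have := h (n + 1)
  rw [pre_succ, pre_succ, h n] at this
  simpa using this

theorem pre_getD (σ : List Act) (d : Act) {i : ℕ} (hi : i ≤ σ.length) :
    pre (fun k => σ.getD k d) i = σ.take i := by
  apply List.ext_getElem
  · simp [hi]
  · intro k h1 h2
    simp only [length_pre] at h1
    have : k < σ.length := by omega
    simp [pre, this]

theorem pre_getD_length (σ : List Act) (d : Act) :
    pre (fun k => σ.getD k d) σ.length = σ := by
  rw [pre_getD σ d le_rfl, List.take_length]

theorem pre_mem_Tr_of_le {ξ : ℕ → Act} {m n : ℕ} (hmn : m ≤ n) (h : pre ξ n ∈ L.Tr) :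
    pre ξ m ∈ L.Tr := by
  obtain ⟨k, rfl⟩ := Nat.exists_eq_add_of_le hmn
  rw [pre_add] at h
  exact mem_Tr_of_append h

/-- A word is an infinite trace if a set of pairs (state, number of letters read) is reachable and
allows progress from each of its members. -/
theorem mem_Inf_of_progress {ξ : ℕ → Act} (Q : L.State → ℕ → Prop)
    (hQ : ∀ s k, Q s k → ∃ s' n, 0 < n ∧ L.Reach s (pre (fun i => ξ (k + i)) n) s' ∧ Q s' (k + n))
    {s₀ : L.State} {k₀ : ℕ} (h₀ : L.Reach L.init (pre ξ k₀) s₀) (hQ₀ : Q s₀ k₀) : ξ ∈ L.Inf := by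
  let R : L.State → ℕ → Prop := fun s k =>
    ∃ n s', L.Reach s (pre (fun i => ξ (k + i)) n) s' ∧ Q s' (k + n)
  have step : ∀ s k, R s k → ∃ t, L.Reach s [ξ k] t ∧ R t (k + 1) := by
    intro s k hR
    have : ∃ n s', L.Reach s (pre (fun i => ξ (k + i)) (n + 1)) s' ∧ Q s' (k + (n + 1)) := by
      obtain ⟨n, s', hs, hq⟩ := hR
      rcases n with _ | n
      · obtain ⟨s'', n, hn, hs', hq'⟩ := hQ _ _ hq
        obtain ⟨n, rfl⟩ := Nat.exists_eq_succ_of_ne_zero hn.ne'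
        exact ⟨n, s'', by simpa using hs.append hs', hq'⟩
      · exact ⟨n, s', hs, hq⟩
    obtain ⟨n, s', hs, hq⟩ := this
    rw [pre_succ'] at hs
    obtain ⟨t, ht, ht'⟩ := reach_cons hs
    refine ⟨t, ht, n, s', ?_, ?_⟩
    · convert ht' using 2
      funext i
      congr 1
      omega
    · convert hq using 1
      omega
  choose! f hf hf' using step
  have key : ∀ n, R (Nat.rec L.init (fun k s => f s k) n) n := by
    intro n
    induction n with
    | zero => exact ⟨k₀, s₀, by simpa using h₀, by simpa using hQ₀⟩
    | succ n ih => exact hf' _ _ ih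
  exact ⟨fun n => Nat.rec L.init (fun k s => f s k) n, rfl, fun n => hf _ _ (key n)⟩

theorem reach_pre_of_steps {ξ : ℕ → Act} {p : ℕ → L.State}
    (hp : ∀ n, L.Reach (p n) [ξ n] (p (n + 1))) (m n : ℕ) :
    L.Reach (p m) (pre (fun i => ξ (m + i)) n) (p (m + n)) := by
  induction n with
  | zero => exact .refl _
  | succ n ih =>
    rw [pre_succ]
    exact ih.append (hp (m + n))

theorem pre_mem_Tr_of_mem_Inf {ξ : ℕ → Act} (h : ξ ∈ L.Inf) (n : ℕ) : pre ξ n ∈ L.Tr := by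
  obtain ⟨p, h0, hp⟩ := h
  have := reach_pre_of_steps hp 0 n
  rw [h0] at this
  exact ⟨_, by simpa using this⟩

/-! ### Words with a divergent prefix -/

/-- The words that have a divergence trace as a prefix. -/
def divExt (L : LTS.{u, v} Act) : Set (List Act) := {σ | ∃ i ≤ σ.length, σ.take i ∈ L.Div}

theorem Div_subset_divExt : L.Div ⊆ L.divExt := fun σ h => ⟨σ.length, le_rfl, by simpa using h⟩

theorem exists_minD_of_mem_divExt {σ : List Act} (h : σ ∈ L.divExt) :
    ∃ i ≤ σ.length, σ.take i ∈ L.minD := by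
  classical
  have h' : ∃ i, i ≤ σ.length ∧ σ.take i ∈ L.Div := h
  refine ⟨Nat.find h', (Nat.find_spec h').1, (Nat.find_spec h').2, fun k hk hd => ?_⟩
  have hk' : k < Nat.find h' := lt_of_lt_of_le hk (by simp)
  rw [List.take_take, min_eq_left hk'.le] at hd
  exact Nat.find_min h' hk' ⟨hk'.le.trans (Nat.find_spec h').1, hd⟩

theorem mem_extT_iff {σ : List Act} :
    σ ∈ L.extT ↔ (∀ a ∈ σ, a ∈ L.alphabet) ∧ σ ∈ L.divExt :=
  ⟨fun h => ⟨h.1, h.2.elim fun i hi => ⟨i, hi.1, hi.2.1⟩⟩,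
    fun h => ⟨h.1, exists_minD_of_mem_divExt h.2⟩⟩

theorem mem_extT_iff_of_mem_Tr {σ : List Act} (h : σ ∈ L.Tr) : σ ∈ L.extT ↔ σ ∈ L.divExt := by
  rw [mem_extT_iff, and_iff_right (mem_alphabet_of_mem_Tr h)]

theorem mem_extI_iff {ξ : ℕ → Act} :
    ξ ∈ L.extI ↔ (∀ n, ξ n ∈ L.alphabet) ∧ ∃ i, pre ξ i ∈ L.Div := by
  refine ⟨fun h => ⟨h.1, h.2.elim fun i hi => ⟨i, hi.1⟩⟩, fun h => ⟨h.1, ?_⟩⟩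
  obtain ⟨i, hi⟩ := h.2
  obtain ⟨k, -, hk⟩ := exists_minD_of_mem_divExt (Div_subset_divExt hi)
  exact ⟨_, take_pre ξ k i ▸ hk⟩

theorem divExt_append {σ : List Act} (h : σ ∈ L.divExt) (τ : List Act) : σ ++ τ ∈ L.divExt := by
  obtain ⟨i, hi, h⟩ := h
  exact ⟨i, by simp; omega, by rwa [List.take_append_of_le_length hi]⟩

theorem pre_mem_divExt_of_le {ξ : ℕ → Act} {m n : ℕ} (hmn : m ≤ n) (h : pre ξ m ∈ L.Div) :
    pre ξ n ∈ L.divExt := by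
  obtain ⟨k, rfl⟩ := Nat.exists_eq_add_of_le hmn
  rw [pre_add]
  exact divExt_append (Div_subset_divExt h) _

theorem mem_minD_of_mem_Div {σ : List Act} {a : Act} (hσ : σ ∉ L.divExt) (h : σ ++ [a] ∈ L.Div) :
    σ ++ [a] ∈ L.minD := by
  refine ⟨h, fun i hi hd => hσ ?_⟩
  have hi' : i ≤ σ.length := by simp at hi; omega
  exact ⟨i, hi', by rwa [List.take_append_of_le_length hi'] at hd⟩

theorem nil_mem_minD_iff : [] ∈ L.minD ↔ [] ∈ L.Div := by simp [minD]

end Paths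

/-! ### Controllers -/

/-- A controller runs an unknown LTS `M` as a subprocess. It can move alone, with any label; it can
launch `M`, which is invisible; and it can take part in a visible action `b` of `M`, which is then
shown under any label, in particular `none`. -/
structure Controller (Act : Type v) where
  /-- the control states -/
  State : Type u
  /-- the visible actions of the combined system -/
  alphabet : Set Act
  small_alphabet : Small.{u} alphabet
  /-- moves without `M` -/
  alone : State → Option Act → State → Prop
  /-- moves that start `M` -/
  launch : State → State → Prop
  /-- `sync k b x k'`: the controller moves from `k` to `k'` while `M` executes `b`; the label that
  is shown is `x` -/
  sync : State → Act → Option Act → State → Prop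
  mem_of_alone : ∀ k a k', alone k (some a) k' → a ∈ alphabet
  mem_of_sync : ∀ k b a k', sync k b (some a) k' → a ∈ alphabet
  /-- the initial control state -/
  init : State

theorem small_option {α : Type*} [Small.{u} α] : Small.{u} (Option α) :=
  (small_congr (Equiv.optionEquivSumPUnit.{0} α)).2 inferInstance

namespace Controller

variable (C : Controller.{u, v} Act)

/-- The transitions of a controller together with the LTS that it runs. The second component of a
state is `none` until the LTS has been launched. -/
inductive Step (M : LTS.{u, v} Act) :
    C.State × Option M.State → Option Act → C.State × Option M.State → Prop
  | alone {k k' x} (d) : C.alone k x k' → Step M (k, d) x (k', d)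
  | launch {k k'} : C.launch k k' → Step M (k, none) none (k', some M.init)
  | sync {k k' b x m m'} : C.sync k b x k' → M.trans m (some b) m' →
      Step M (k, some m) x (k', some m')
  | internal {m m'} (k) : M.trans m none m' → Step M (k, some m) none (k, some m')

/-- The LTS formed by a controller and the LTS that it runs. -/
def run (M : LTS.{u, v} Act) : LTS.{u, v} Act where
  State := C.State × Option M.State
  alphabet := C.alphabet
  small_alphabet := C.small_alphabet
  trans := C.Step M
  mem_of_trans := by
    intro s a s' h
    generalize hx : some a = x at h
    cases h with
    | alone d h => exact C.mem_of_alone _ _ _ (hx ▸ h)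
    | launch h => cases hx
    | sync h _ => exact C.mem_of_sync _ _ _ _ (hx ▸ h)
    | internal k h => cases hx
  init := (C.init, none)

/-- The names of the moves of a controller: the pair consists of the label that is shown and the
action of the subprocess that is used. The pair `(none, none)` stands for the launch. -/
abbrev Move (Γ : Set Act) := Option C.alphabet × Option Γ

/-- The controller as an LTS of its own, whose actions are names of moves. -/
def body (Γ : Set Act) [Small.{u} Γ] (e : C.Move Γ → Act) : LTS.{u, v} Act where
  State := C.State
  alphabet := Set.range e
  small_alphabet := by
    have := C.small_alphabet
    have := small_option.{u} (α := C.alphabet)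
    have := small_option.{u} (α := Γ)
    infer_instance
  trans k y k' :=
    (y = none ∧ C.alone k none k') ∨
    (∃ a, y = some (e (some a, none)) ∧ C.alone k (some a) k') ∨
    (y = some (e (none, none)) ∧ C.launch k k') ∨
    ∃ x b, y = some (e (x, some b)) ∧ C.sync k b (x.map (↑)) k'
  mem_of_trans := by
    rintro s a s' (⟨h, -⟩ | ⟨b, h, -⟩ | ⟨h, -⟩ | ⟨x, b, h, -⟩)
    · cases h
    all_goals exact ⟨_, (Option.some.inj h).symm⟩
  init := C.init

end Controller

theorem mk_congr {S : Type u} {A A' : Set Act} {hA : Small.{u} A} {hA' : Small.{u} A'}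
    {tr tr' : S → Option Act → S → Prop} {h : ∀ s a s', tr s (some a) s' → a ∈ A}
    {h' : ∀ s a s', tr' s (some a) s' → a ∈ A'} {i : S} (hAA' : A = A')
    (htr : ∀ s x s', tr s x s' ↔ tr' s x s') :
    LTS.mk S A hA tr h i = LTS.mk S A' hA' tr' h' i := by
  subst hAA'
  have : tr = tr' := by
    funext s x s'
    exact propext (htr s x s')
  subst this
  rfl

namespace Controller

variable (C : Controller.{u, v} Act)

/-- The renaming that offers each action `b` of the subprocess under the names of all moves that
use `b`. -/
def useNames {Γ : Set Act} (e : C.Move Γ → Act) : Set (Act × Act) :=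
  {q | ∃ x b, q = (↑b, e (x, some b))}

/-- The renaming that maps the name of a move to the label that the move shows. -/
def showNames {Γ : Set Act} (e : C.Move Γ → Act) : Set (Act × Act) :=
  {q | ∃ a y, q = (e (some a, y), ↑a)}

/-- The names of the moves that are invisible. -/
def hiddenNames {Γ : Set Act} (e : C.Move Γ → Act) : Set Act :=
  {c | ∃ y, c = e (none, y)}

section

variable {C} {Γ : Set Act} {e : C.Move Γ → Act}

theorem small_useNames [Small.{u} Γ] : Small.{u} (C.useNames e) := by
  have := C.small_alphabet
  have := small_option.{u} (α := C.alphabet)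
  have hs : C.useNames e ⊆ Set.range fun q : Option C.alphabet × Γ =>
      ((q.2 : Act), e (q.1, some q.2)) := by
    rintro _ ⟨x, b, rfl⟩
    exact ⟨(x, b), rfl⟩
  exact small_subset hs

theorem small_showNames [Small.{u} Γ] : Small.{u} (C.showNames e) := by
  have := C.small_alphabet
  have := small_option.{u} (α := Γ)
  have hs : C.showNames e ⊆ Set.range fun q : C.alphabet × Option Γ =>
      (e (some q.1, q.2), (q.1 : Act)) := by
    rintro _ ⟨a, y, rfl⟩
    exact ⟨(a, y), rfl⟩
  exact small_subset hs

theorem small_hiddenNames [Small.{u} Γ] : Small.{u} (C.hiddenNames e) := by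
  have := small_option.{u} (α := Γ)
  have hs : C.hiddenNames e ⊆ Set.range fun y : Option Γ => e (none, y) := by
    rintro _ ⟨y, rfl⟩
    exact ⟨y, rfl⟩
  exact small_subset hs

theorem renames_useNames {b c : Act} (hb : b ∈ Γ) :
    Renames (C.useNames e) b c ↔ ∃ x, c = e (x, some ⟨b, hb⟩) := by
  constructor
  · rintro (⟨x, b', h⟩ | ⟨-, h⟩)
    · obtain ⟨rfl, rfl⟩ := Prod.mk.inj h
      exact ⟨x, rfl⟩
    · exact absurd ⟨none, ⟨b, hb⟩, rfl⟩ (h (e (none, some ⟨b, hb⟩)))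
  · rintro ⟨x, rfl⟩
    exact Or.inl ⟨x, ⟨b, hb⟩, rfl⟩

theorem renames_showNames (he : Function.Injective e) {a : C.alphabet} {y : Option Γ} {c : Act} :
    Renames (C.showNames e) (e (some a, y)) c ↔ c = a := by
  constructor
  · rintro (⟨a', y', h⟩ | ⟨-, h⟩)
    · obtain ⟨h1, rfl⟩ := Prod.mk.inj h
      have := he h1
      simp only [Prod.mk.injEq, Option.some.injEq] at this
      rw [this.1]
    · exact absurd ⟨a, y, rfl⟩ (h a)
  · rintro rfl
    exact Or.inl ⟨a, y, rfl⟩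

end

/-- A controller that runs `M` is, up to the names of the moves, a parallel composition with a
prefixed and renamed copy of `M`, followed by hiding and renaming. -/
theorem run_eq (M : LTS.{u, v} Act) {Γ : Set Act} [Small.{u} Γ] (hΓ : M.alphabet = Γ)
    {e : C.Move Γ → Act} (he : Function.Injective e) :
    (((C.body Γ e).par ((M.rename (C.useNames e) small_useNames).actionPrefix
      (e (none, none)))).hide (C.hiddenNames e)).rename (C.showNames e) small_showNames =
    C.run M := by
  have hX : ∀ c : Act, c ∈ ((M.rename (C.useNames e) small_useNames).actionPrefix
      (e (none, none))).alphabet ↔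
        c = e (none, none) ∨ ∃ x b, c = e (x, some b) := by
    intro c
    change c = e (none, none) ∨ (∃ b ∈ M.alphabet, Renames (C.useNames e) b c) ↔ _
    refine or_congr Iff.rfl ⟨?_, ?_⟩
    · rintro ⟨b, hb, h⟩
      rw [hΓ] at hb
      obtain ⟨x, rfl⟩ := (renames_useNames hb).1 h
      exact ⟨x, _, rfl⟩
    · rintro ⟨x, b, rfl⟩
      exact ⟨b, hΓ ▸ b.2, (renames_useNames b.2).2 ⟨x, rfl⟩⟩
  have hM : ∀ m c m', (M.rename (C.useNames e) small_useNames).trans m (some c) m' ↔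
      ∃ x b, c = e (x, some b) ∧ M.trans m (some ↑b) m' := by
    intro m c m'
    constructor
    · rintro (⟨h, -⟩ | ⟨b, c', hc, h, hb⟩)
      · cases h
      · cases hc
        have hb' : b ∈ Γ := hΓ ▸ M.mem_of_trans _ _ _ h
        obtain ⟨x, rfl⟩ := (renames_useNames hb').1 hb
        exact ⟨x, ⟨b, hb'⟩, rfl, h⟩
    · rintro ⟨x, b, rfl, h⟩
      exact Or.inr ⟨b, _, rfl, h, (renames_useNames b.2).2 ⟨x, rfl⟩⟩
  have hM' : ∀ m m', (M.rename (C.useNames e) small_useNames).trans m none m' ↔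
      M.trans m none m' := by
    intro m m'
    constructor
    · rintro (⟨-, h⟩ | ⟨_, _, h, -⟩)
      · exact h
      · cases h
    · exact fun h => Or.inl ⟨rfl, h⟩
  refine mk_congr (S := C.State × Option M.State) ?_ ?_
  · ext a
    constructor
    · rintro ⟨c, ⟨hc, hh⟩, hr⟩
      have : ∃ q, c = e q := by
        rcases hc with ⟨q, rfl⟩ | hc
        · exact ⟨q, rfl⟩
        · rcases (hX c).1 hc with rfl | ⟨x, b, rfl⟩ <;> exact ⟨_, rfl⟩
      obtain ⟨⟨x, y⟩, rfl⟩ := this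
      rcases x with _ | x
      · exact absurd ⟨y, rfl⟩ hh
      · rw [(renames_showNames he).1 hr]
        exact x.2
    · intro ha
      refine ⟨e (some ⟨a, ha⟩, none), ⟨Or.inl ⟨_, rfl⟩, ?_⟩, (renames_showNames he).2 rfl⟩
      rintro ⟨y, hy⟩
      simpa using he hy
  · rintro ⟨k, d⟩ x ⟨k', d'⟩
    have hP : ∀ y, ((C.body Γ e).par ((M.rename (C.useNames e) small_useNames).actionPrefix
        (e (none, none)))).trans (k, d) y (k', d') ↔
        (y = none ∧ (C.alone k none k' ∧ d' = d ∨
          k' = k ∧ ∃ m m', d = some m ∧ d' = some m' ∧ M.trans m none m')) ∨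
        (∃ a, y = some (e (some a, none)) ∧ C.alone k (some ↑a) k' ∧ d' = d) ∨
        (y = some (e (none, none)) ∧ C.launch k k' ∧ d = none ∧ d' = some M.init) ∨
        ∃ x b, y = some (e (x, some b)) ∧ C.sync k b (x.map (↑)) k' ∧
          ∃ m m', d = some m ∧ d' = some m' ∧ M.trans m (some ↑b) m' := by
      intro y
      constructor
      · rintro (⟨hy, h, hd⟩ | ⟨hy, h, hk⟩ | ⟨hy, h, h'⟩)
        · simp only at hd
          rcases h with ⟨rfl, h⟩ | ⟨a, rfl, h⟩ | ⟨rfl, h⟩ | ⟨x, b, rfl, h⟩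
          · exact Or.inl ⟨rfl, Or.inl ⟨h, hd⟩⟩
          · exact Or.inr (Or.inl ⟨a, rfl, h, hd⟩)
          · exact absurd ⟨_, (hX _).2 (Or.inl rfl), rfl⟩ hy
          · exact absurd ⟨_, (hX _).2 (Or.inr ⟨x, b, rfl⟩), rfl⟩ hy
        · simp only at hk
          rcases h with ⟨m, m', hm, hm', h⟩ | ⟨-, rfl, -⟩
          · rcases y with _ | c
            · exact Or.inl ⟨rfl, Or.inr ⟨hk, m, m', hm, hm', (hM' m m').1 h⟩⟩
            · obtain ⟨x, b, rfl, -⟩ := (hM m c m').1 h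
              exact absurd ⟨_, ⟨_, rfl⟩, rfl⟩ hy
          · exact absurd ⟨_, ⟨_, rfl⟩, rfl⟩ hy
        · have hsync : ∀ x b, y = some (e (x, some b)) →
              (∃ m m', d = some m ∧ d' = some m' ∧ M.trans m (some ↑b) m') := by
            rintro x b rfl
            rcases h' with ⟨m, m', hm, hm', h'⟩ | ⟨-, h', -⟩
            · obtain ⟨x', b', hc, h'⟩ := (hM _ _ _).1 h'
              have := he hc
              simp only [Prod.mk.injEq, Option.some.injEq] at this
              exact ⟨m, m', hm, hm', this.2 ▸ h'⟩
            · simpa using he (Option.some.inj h')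
          have hnone : ∀ x, y = some (e (x, none)) → x = none ∧ d = none ∧ d' = some M.init := by
            rintro x rfl
            rcases h' with ⟨m, m', hm, hm', h'⟩ | ⟨hd, h', hd'⟩
            · obtain ⟨x', b', hc, h'⟩ := (hM _ _ _).1 h'
              simpa using he hc
            · have := he (Option.some.inj h')
              simp only [Prod.mk.injEq, and_true] at this
              exact ⟨this, hd, hd'⟩
          rcases h with ⟨rfl, h⟩ | ⟨a, rfl, h⟩ | ⟨rfl, h⟩ | ⟨x, b, rfl, h⟩
          · simp at hy
          · simpa using (hnone _ rfl).1
          · exact Or.inr (Or.inr (Or.inl ⟨rfl, h, (hnone _ rfl).2⟩))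
          · exact Or.inr (Or.inr (Or.inr ⟨x, b, rfl, h, hsync _ _ rfl⟩))
      · rintro (⟨rfl, ⟨h, rfl⟩ | ⟨rfl, m, m', rfl, rfl, h⟩⟩ | ⟨a, rfl, h, rfl⟩ |
          ⟨rfl, h, rfl, rfl⟩ | ⟨x, b, rfl, h, m, m', rfl, rfl, h'⟩)
        · exact Or.inl ⟨by simp, Or.inl ⟨rfl, h⟩, rfl⟩
        · exact Or.inr (Or.inl ⟨by simp, Or.inl ⟨m, m', rfl, rfl, (hM' m m').2 h⟩, rfl⟩)
        · refine Or.inl ⟨?_, Or.inr (Or.inl ⟨a, rfl, h⟩), rfl⟩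
          rintro ⟨c, hc, hc'⟩
          rcases (hX c).1 hc with rfl | ⟨x, b, rfl⟩
          · simpa using he (Option.some.inj hc')
          · simpa using he (Option.some.inj hc')
        · exact Or.inr (Or.inr ⟨⟨_, ⟨⟨_, rfl⟩, (hX _).2 (Or.inl rfl)⟩, rfl⟩,
            Or.inr (Or.inr (Or.inl ⟨rfl, h⟩)), Or.inr ⟨rfl, rfl, rfl⟩⟩)
        · exact Or.inr (Or.inr ⟨⟨_, ⟨⟨_, rfl⟩, (hX _).2 (Or.inr ⟨x, b, rfl⟩)⟩, rfl⟩,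
            Or.inr (Or.inr (Or.inr ⟨x, b, rfl, h⟩)),
            Or.inl ⟨m, m', rfl, rfl, (hM _ _ _).2 ⟨x, b, rfl, h'⟩⟩⟩)
    have hH : ∀ x y, some (e (x, y)) ∈ some '' C.hiddenNames e ↔ x = none := by
      intro x y
      constructor
      · rintro ⟨_, ⟨y', rfl⟩, h⟩
        have := he (Option.some.inj h)
        simp only [Prod.mk.injEq] at this
        exact this.1.symm
      · rintro rfl
        exact ⟨_, ⟨y, rfl⟩, rfl⟩
    constructor
    · rintro (⟨rfl, y, ht, hy⟩ | ⟨c, b, rfl, ⟨y, ht, hy⟩, hr⟩)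
      · rcases (hP y).1 ht with ⟨rfl, ⟨h, rfl⟩ | ⟨rfl, m, m', rfl, rfl, h⟩⟩ | ⟨a, rfl, h, rfl⟩ |
          ⟨rfl, h, rfl, rfl⟩ | ⟨x, b, rfl, h, m, m', rfl, rfl, h'⟩
        · exact .alone _ h
        · exact .internal _ h
        · simp [hH] at hy
        · exact .launch h
        · obtain rfl : x = none := by simpa [hH] using hy
          exact .sync h h'
      · obtain ⟨rfl, hy⟩ : some c = y ∧ y ∉ some '' C.hiddenNames e := by simpa using hy
        rcases (hP _).1 ht with ⟨hc, -⟩ | ⟨a, hc, h, rfl⟩ |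
          ⟨hc, h, rfl, rfl⟩ | ⟨x, b', hc, h, m, m', rfl, rfl, h'⟩
        · cases hc
        · cases hc
          rw [(renames_showNames he).1 hr]
          exact .alone _ h
        · rw [hc, hH] at hy
          exact absurd rfl hy
        · cases hc
          rcases x with _ | x
          · exact absurd ((hH _ _).2 rfl) hy
          · rw [(renames_showNames he).1 hr]
            exact .sync h h'
    · have vis : ∀ x y, ((C.body Γ e).par ((M.rename (C.useNames e)
          small_useNames).actionPrefix (e (none, none)))).trans (k, d) (some (e (x, y))) (k', d') →
          ((((C.body Γ e).par ((M.rename (C.useNames e) small_useNames).actionPrefix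
            (e (none, none)))).hide (C.hiddenNames e)).rename (C.showNames e)
            small_showNames).trans (k, d) (x.map (↑)) (k', d') := by
        intro x y h
        rcases x with _ | x
        · exact Or.inl ⟨rfl, _, h, Or.inr ⟨rfl, (hH _ _).2 rfl⟩⟩
        · refine Or.inr ⟨_, _, rfl, ⟨_, h, Or.inl ⟨rfl, ?_⟩⟩, (renames_showNames he).2 rfl⟩
          rw [hH]
          simp
      intro h
      cases h with
      | alone d h =>
        rcases x with _ | x
        · exact Or.inl ⟨rfl, none, (hP _).2 (Or.inl ⟨rfl, Or.inl ⟨h, rfl⟩⟩), Or.inl ⟨rfl, by simp⟩⟩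
        · exact vis (some ⟨x, C.mem_of_alone _ _ _ h⟩) none
            ((hP _).2 (Or.inr (Or.inl ⟨_, rfl, h, rfl⟩)))
      | launch h => exact vis none none ((hP _).2 (Or.inr (Or.inr (Or.inl ⟨rfl, h, rfl, rfl⟩))))
      | @sync _ _ b _ m m' h hm =>
        have hb : b ∈ Γ := hΓ ▸ M.mem_of_trans _ _ _ hm
        rcases x with _ | x
        · exact vis none (some ⟨b, hb⟩) ((hP _).2 (Or.inr (Or.inr (Or.inr
            ⟨none, ⟨b, hb⟩, rfl, h, _, _, rfl, rfl, hm⟩))))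
        · exact vis (some ⟨x, C.mem_of_sync _ _ _ _ h⟩) (some ⟨b, hb⟩)
            ((hP _).2 (Or.inr (Or.inr (Or.inr ⟨_, ⟨b, hb⟩, rfl, h, _, _, rfl, rfl, hm⟩))))
      | internal k h =>
        exact Or.inl ⟨rfl, none, (hP _).2 (Or.inl ⟨rfl, Or.inr ⟨rfl, _, _, rfl, rfl, h⟩⟩),
          Or.inl ⟨rfl, by simp⟩⟩

end Controller

/-- Controllers respect congruences, provided that related LTSs have the same alphabet. Since the
visible actions do not form a small type, there are enough of them to name the moves of the
controller. -/
theorem IsCongruence.run (hAct : ¬ Small.{u} Act) {r : LTS.{u, v} Act → LTS.{u, v} Act → Prop}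
    (hr : IsCongruence r) (C : Controller.{u, v} Act) {M M' : LTS.{u, v} Act}
    (hM : M.alphabet = M'.alphabet) (h : r M M') : r (C.run M) (C.run M') := by
  have := M'.small_alphabet
  have := C.small_alphabet
  have := small_option.{u} (α := C.alphabet)
  have := small_option.{u} (α := M'.alphabet)
  have hT : Small.{u} (C.Move M'.alphabet) := inferInstance
  obtain ⟨⟨e, he⟩⟩ | ⟨⟨e, he⟩⟩ := Function.Embedding.total (C.Move M'.alphabet) Act
  · rw [← C.run_eq M hM he, ← C.run_eq M' rfl he]
    exact hr.rename _ _ _ _ (hr.hide _ Controller.small_hiddenNames _ _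
      (hr.par_left _ _ _ (hr.actionPrefix _ _ _ (hr.rename _ _ _ _ h))))
  · exact absurd (small_of_injective he) hAct

/-! ### Detours -/

/-- Data for a controller that behaves like `L` or follows one of the words `target p` while it
leads the subprocess along the word `drive`. A position `(i, j)` on the track `p` means that `i`
letters of the target have been shown, and that the subprocess has not been launched if `j = 0` and
has read `j - 1` letters if `j > 0`. -/
structure Detour (L : LTS.{u, v} Act) where
  /-- the names of the tracks -/
  Index : Type u
  /-- the word that is shown on a track -/
  target : Index → ℕ → Act
  /-- the word that the subprocess has to read -/
  drive : ℕ → Act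
  /-- the positions that may be visited -/
  allowed : Index → ℕ → ℕ → Prop
  /-- `active p i`: the subprocess may be launched and driven when `i` letters have been shown -/
  active : Index → ℕ → Prop
  /-- the positions where the subprocess may be probed -/
  probed : Index → ℕ → ℕ → Prop
  /-- the letters that can be shown in a probe only with the help of the subprocess -/
  tied : Index → ℕ → Set Act
  /-- the actions of the subprocess that help in a probe -/
  offer : Set Act

namespace Detour

variable {L : LTS.{u, v} Act} (D : Detour L)

/-- The control states: the start, where nothing has been decided; a state of `L`; a position on a
track; a stable state `s` of `L` after the first `i` letters of the track `p`, whose tied letters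
need the help of the subprocess; and a deadlock, in which a probe ends when it has shown a divergence
trace of `L`. -/
inductive Ctl (D : Detour L) : Type u
  | start
  | plain (s : L.State)
  | track (p : D.Index) (i j : ℕ)
  | probe (p : D.Index) (i : ℕ) (s : L.State)
  | dead

/-- The moves of the controller without the subprocess. On a track it is always possible to resume
`L` in a state that is reached by the word shown so far, unless that word is a divergence trace and
the subprocess has been launched. Hence tracks do not give rise to stable states elsewhere. -/
inductive Alone : D.Ctl → Option Act → D.Ctl → Prop
  | start : Alone .start none (.plain L.init)
  | enter (p) : D.allowed p 0 0 → Alone .start none (.track p 0 0)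
  | plain {s x t} : L.trans s x t → Alone (.plain s) x (.plain t)
  | resume {p i j s} : (j = 0 ∨ pre (D.target p) i ∉ L.Div) →
      L.Reach L.init (pre (D.target p) i) s → Alone (.track p i j) none (.plain s)
  | emit {p i j} : D.allowed p (i + 1) j → D.target p i ∈ L.alphabet →
      Alone (.track p i j) (some (D.target p i)) (.track p (i + 1) j)
  | probe {p i j s} : D.probed p i j → L.Reach L.init (pre (D.target p) i) s →
      (∀ s', ¬ L.trans s none s') → Alone (.track p i j) none (.probe p i s)
  | free {p i s a t} : a ∉ D.tied p i → L.trans s (some a) t →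
      Alone (.probe p i s) (some a) (.plain t)

/-- The moves of the controller together with the subprocess. -/
inductive Sync : D.Ctl → Act → Option Act → D.Ctl → Prop
  | drive {p i j} : D.allowed p i (j + 2) → D.active p i →
      Sync (.track p i (j + 1)) (D.drive j) none (.track p i (j + 2))
  | tied {p i s a b t} : b ∈ D.offer → a ∈ D.tied p i → L.trans s (some a) t →
      pre (D.target p) i ++ [a] ∉ L.Div → Sync (.probe p i s) b (some a) (.plain t)
  | dead {p i s a b t} : b ∈ D.offer → a ∈ D.tied p i → L.trans s (some a) t →
      pre (D.target p) i ++ [a] ∈ L.Div → Sync (.probe p i s) b (some a) .dead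

/-- The launch of the subprocess. -/
inductive Launch : D.Ctl → D.Ctl → Prop
  | launch {p i} : D.allowed p i 1 → D.active p i → Launch (.track p i 0) (.track p i 1)

/-- The controller of a detour. -/
abbrev controller : Controller.{u, v} Act where
  State := D.Ctl
  alphabet := L.alphabet
  small_alphabet := L.small_alphabet
  alone := D.Alone
  launch := D.Launch
  sync := D.Sync
  mem_of_alone := by
    intro k a k' h
    generalize hx : some a = x at h
    cases h with
    | plain h => exact L.mem_of_trans _ _ _ (hx ▸ h)
    | emit h h' => exact Option.some.inj hx ▸ h'
    | free h h' => exact Option.some.inj hx ▸ L.mem_of_trans _ _ _ h'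
    | _ => cases hx
  mem_of_sync := by
    intro k b a k' h
    generalize hx : some a = x at h
    cases h with
    | drive => cases hx
    | tied _ _ h => exact Option.some.inj hx ▸ L.mem_of_trans _ _ _ h
    | dead _ _ h => exact Option.some.inj hx ▸ L.mem_of_trans _ _ _ h
  init := .start

/-- The controller of a detour together with the subprocess `M`. -/
abbrev sys (M : LTS.{u, v} Act) : LTS.{u, v} Act := D.controller.run M

variable {D} {M : LTS.{u, v} Act}

/-! ### Detours contain the original behaviour -/

theorem step_plain {s t : L.State} {x : Option Act} (h : L.trans s x t) (d : Option M.State) :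
    (D.sys M).trans (.plain s, d) x (.plain t, d) :=
  .alone d (.plain h)

theorem reach_plain {s t : L.State} {σ : List Act} (h : L.Reach s σ t) (d : Option M.State) :
    (D.sys M).Reach (.plain s, d) σ (.plain t, d) := by
  induction h with
  | refl => exact .refl _
  | tau h _ ih => exact .tau (step_plain h d) ih
  | visible h _ ih => exact .visible (step_plain h d) ih

theorem reach_init_plain {t : L.State} {σ : List Act} (h : L.Reach L.init σ t) :
    (D.sys M).Reach (D.sys M).init σ (.plain t, none) :=
  .tau (.alone none .start) (reach_plain h none)

theorem trans_plain_none {s : L.State} {x : Option Act} {q : D.controller.State × Option M.State}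
    (h : (D.sys M).trans (.plain s, none) x q) : ∃ t, q = (.plain t, none) ∧ L.trans s x t := by
  cases h with
  | alone d h =>
    cases h with
    | plain h => exact ⟨_, rfl, h⟩
  | launch h => cases h

theorem Sf_subset : L.Sf ⊆ (D.sys M).Sf := by
  rintro ⟨σ, A⟩ ⟨hA, s, hs, hst, href⟩
  refine ⟨hA, _, reach_init_plain hs, fun q h => ?_, fun a ha q h => ?_⟩
  · obtain ⟨t, -, ht⟩ := trans_plain_none h
    exact hst t ht
  · obtain ⟨t, -, ht⟩ := trans_plain_none h
    exact href a ha t ht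

theorem Div_subset : L.Div ⊆ (D.sys M).Div := by
  rintro σ ⟨s, hs, p, hp, hst⟩
  exact ⟨_, reach_init_plain hs, fun n => (.plain (p n), none), hp ▸ rfl,
    fun n => step_plain (hst n) none⟩

theorem Inf_subset : L.Inf ⊆ (D.sys M).Inf := by
  rintro ξ ⟨p, hp, hst⟩
  refine mem_Inf_of_progress (fun q k => q = (.plain (p k), none)) ?_
    (k₀ := 0) (reach_init_plain (.refl _)) (by rw [hp])
  rintro q k rfl
  exact ⟨_, 1, one_pos, reach_plain (reach_pre_of_steps hst k 1) none, rfl⟩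

/-! ### Soundness of detours -/

/-- The progress of the subprocess at a position of a track. -/
inductive Progress (D : Detour L) (M : LTS.{u, v} Act) : ℕ → Option M.State → Prop
  | idle : Progress D M 0 none
  | driven {k m} : M.Reach M.init (pre D.drive k) m → Progress D M (k + 1) (some m)

/-- The states that can be reached by a given word. The set `E` consists of words for which the
combined system may have more divergences than `L`. -/
inductive Inv (D : Detour L) (M : LTS.{u, v} Act) (E : Set (List Act)) :
    D.controller.State × Option M.State → List Act → Prop
  | start : Inv D M E (.start, none) []
  | plain {s d σ} : L.Reach L.init σ s → (∀ m, d = some m → M.Converges m ∨ σ ∈ E) →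
      Inv D M E (.plain s, d) σ
  | track {p i j d} : D.allowed p i j → Progress D M j d →
      Inv D M E (.track p i j, d) (pre (D.target p) i)
  | probe {p i j s m} : D.probed p i (j + 1) → D.allowed p i (j + 1) →
      L.Reach L.init (pre (D.target p) i) s → (∀ s', ¬ L.trans s none s') →
      M.Reach M.init (pre D.drive j) m →
      Inv D M E (.probe p i s, some m) (pre (D.target p) i)
  | dead {σ d} : σ ∈ L.Div → (∃ p i j, D.probed p i j) → Inv D M E (.dead, d) σ

/-- The conditions under which a detour that runs `M` has no divergences outside of `L.Div ∪ E`. -/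
structure Sound (D : Detour L) (M : LTS.{u, v} Act) (E : Set (List Act)) : Prop where
  append_mem : ∀ σ a, σ ∈ E → σ ++ [a] ∈ E
  guard : ∀ p i j, D.allowed p i (j + 1) → pre D.drive j ∈ M.Div →
    pre (D.target p) i ∈ L.Div ∨ pre (D.target p) i ∈ E
  bounded : ∀ p i, pre (D.target p) i ∉ L.Div → ∃ N, ∀ j, D.allowed p i j → D.active p i → j ≤ N
  early : ∀ p i, D.allowed p i 0 → pre (D.target p) i ∈ L.Tr
  probed_pos : ∀ p i, ¬ D.probed p i 0
  probed_conv : ∀ p i j, D.probed p i (j + 1) → pre D.drive j ∉ M.Div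
  offer_conv : ∀ p i j a b, D.probed p i (j + 1) → a ∈ D.tied p i →
    pre (D.target p) i ++ [a] ∉ L.Div → b ∈ D.offer → pre D.drive j ++ [b] ∉ M.Div

variable {E : Set (List Act)}

theorem Inv.tau (hD : D.Sound M E) {q q' : D.controller.State × Option M.State} {σ : List Act}
    (hq : D.Inv M E q σ) (h : (D.sys M).trans q none q') : D.Inv M E q' σ := by
  change D.controller.Step M q none q' at h
  generalize hx : none = x at h
  cases h with
  | alone d h =>
    change D.Alone _ _ _ at h
    cases h with
    | start =>
      cases hq
      exact .plain (.refl _) (fun _ h => by cases h)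
    | enter p hp =>
      cases hq
      exact .track hp .idle
    | plain h =>
      subst hx
      cases hq with
      | plain hs hd => exact .plain (hs.snoc_tau h) hd
    | resume hj hs =>
      cases hq with
      | track ha hp =>
        refine .plain hs ?_
        rintro m rfl
        cases hp with
        | @driven k _ hk =>
          refine or_iff_not_imp_left.2 fun hm => ?_
          rcases hD.guard _ _ _ ha (mem_Div_of_not_converges hk hm) with h | h
          · exact absurd h (hj.resolve_left (by simp))
          · exact h
    | emit => cases hx
    | @probe p i j s hf hs hst =>
      cases hq with
      | track ha hp =>
        cases hp with
        | idle => exact absurd hf (hD.probed_pos _ _)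
        | driven hk => exact .probe hf ha hs hst hk
    | free => cases hx
  | launch h =>
    change D.Launch _ _ at h
    cases h with
    | launch ha _ =>
      cases hq with
      | track => exact .track ha (.driven (k := 0) (.refl _))
  | @sync k k' b x m m' h hm =>
    change D.Sync _ _ _ _ at h
    cases h with
    | drive ha _ =>
      cases hq with
      | track _ hp =>
        cases hp with
        | driven hk =>
          refine .track ha (.driven ?_)
          rw [pre_succ]
          exact hk.snoc hm
    | tied => cases hx
    | dead => cases hx
  | internal k hm =>
    cases hq with
    | plain hs hd =>
      refine .plain hs ?_
      rintro _ ⟨⟩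
      exact (hd _ rfl).imp_left fun h => h.step hm
    | track ha hp =>
      cases hp with
      | driven hk => exact .track ha (.driven (hk.snoc_tau hm))
    | probe hf ha hs hst hk => exact .probe hf ha hs hst (hk.snoc_tau hm)
    | dead h h' => exact .dead h h'

theorem Inv.visible (hD : D.Sound M E) {q q' : D.controller.State × Option M.State} {σ : List Act} {a : Act}
    (hq : D.Inv M E q σ) (h : (D.sys M).trans q (some a) q') : D.Inv M E q' (σ ++ [a]) := by
  change D.controller.Step M q (some a) q' at h
  generalize hx : some a = x at h
  cases h with
  | alone d h =>
    change D.Alone _ _ _ at h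
    cases h with
    | plain h =>
      subst hx
      cases hq with
      | plain hs hd =>
        exact .plain (hs.snoc h) fun m hm => (hd m hm).imp_right (hD.append_mem _ _)
    | emit ha _ =>
      cases hx
      cases hq with
      | track _ hp =>
        rw [← pre_succ]
        exact .track ha hp
    | free ha h =>
      cases hx
      cases hq with
      | probe hf _ hs _ hk =>
        refine .plain (hs.snoc h) ?_
        rintro m ⟨⟩
        exact Or.inl (converges_of_not_mem_Div hk (hD.probed_conv _ _ _ hf))
    | _ => cases hx
  | launch h => cases hx
  | sync h hm =>
    change D.Sync _ _ _ _ at h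
    cases h with
    | drive => cases hx
    | tied hb ha h hdiv =>
      cases hx
      cases hq with
      | probe hf _ hs _ hk =>
        refine .plain (hs.snoc h) ?_
        rintro m ⟨⟩
        exact Or.inl (converges_of_not_mem_Div (hk.snoc hm) (hD.offer_conv _ _ _ _ _ hf ha hdiv hb))
    | dead hb ha h hdiv =>
      cases hx
      cases hq with
      | probe hf => exact .dead hdiv ⟨_, _, _, hf⟩
  | internal k hm => cases hx

theorem inv_of_reach (hD : D.Sound M E) {q : D.controller.State × Option M.State} {σ : List Act}
    (h : (D.sys M).Reach (D.sys M).init σ q) : D.Inv M E q σ := by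
  have := Reach.invariant (L := D.sys M) (I := D.Inv M E) (fun _ _ _ h h' => h.tau hD h')
    (fun _ _ _ _ h h' => h.visible hD h') .start h
  simpa using this

theorem mem_Tr_of_mem_Tr_sys (hD : D.Sound M E) {σ : List Act} (h : σ ∈ (D.sys M).Tr) :
    σ ∈ L.Tr ∨ ∃ p i j, σ = pre (D.target p) i ∧ D.allowed p i (j + 1) ∧ pre D.drive j ∈ M.Tr := by
  obtain ⟨q, hq⟩ := h
  cases inv_of_reach hD hq with
  | start => exact Or.inl nil_mem_Tr
  | plain h => exact Or.inl ⟨_, h⟩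
  | track ha hp =>
    cases hp with
    | idle => exact Or.inl (hD.early _ _ ha)
    | driven hk => exact Or.inr ⟨_, _, _, rfl, ha, _, hk⟩
  | probe _ _ h => exact Or.inl ⟨_, h⟩
  | dead h => exact Or.inl (Div_subset_Tr h)

/-- A stable failure of the combined system is a stable failure of `L`, or it belongs to a
divergence trace or to a word outside of `L.Tr` and arises on a track or from the dead state, or it
results from a probe that finds the subprocess in a stable state where it refuses the offer. -/
theorem mem_Sf_of_mem_Sf_sys (hD : D.Sound M E) {σ : List Act} {A : Set Act}
    (h : (σ, A) ∈ (D.sys M).Sf) :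
    (σ, A) ∈ L.Sf ∨
    (∃ p i j m, σ = pre (D.target p) i ∧ D.allowed p i (j + 1) ∧ (σ ∈ L.Div ∨ σ ∉ L.Tr) ∧
      M.Reach M.init (pre D.drive j) m ∧ ∀ m', ¬ M.trans m none m') ∨
    (σ ∈ L.Div ∧ ∃ p i j, D.probed p i j) ∨
    ∃ p i j m, σ = pre (D.target p) i ∧ D.probed p i (j + 1) ∧ D.allowed p i (j + 1) ∧
      (σ, A \ D.tied p i) ∈ L.Sf ∧ M.Reach M.init (pre D.drive j) m ∧
      (∀ m', ¬ M.trans m none m') ∧ ∀ b ∈ D.offer, ∀ m', ¬ M.trans m (some b) m' := by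
  obtain ⟨hA, q, hq, hst, href⟩ := h
  change A ⊆ L.alphabet at hA
  simp only at hq href
  cases inv_of_reach hD hq with
  | start => exact absurd (.alone none .start) (hst _)
  | plain hs _ =>
    exact Or.inl ⟨hA, _, hs, fun t ht => hst _ (step_plain ht _),
      fun a ha t ht => href a ha _ (step_plain ht _)⟩
  | @track p i j d ha hp =>
    cases hp with
    | idle =>
      obtain ⟨s, hs⟩ := hD.early _ _ ha
      exact absurd (.alone none (.resume (Or.inl rfl) hs)) (hst (.plain s, none))
    | @driven k m hk =>
      refine Or.inr (Or.inl ⟨p, i, k, m, rfl, ha, ?_, hk, fun m' hm' => hst _ (.internal _ hm')⟩)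
      by_contra! hc
      obtain ⟨s, hs⟩ := hc.2
      exact hst (.plain s, some m) (.alone _ (.resume (Or.inr hc.1) hs))
  | @probe p i j s m hf ha hs hss hk =>
    have hm : ∀ m', ¬ M.trans m none m' := fun m' hm' => hst _ (.internal _ hm')
    by_cases hb : ∀ b ∈ D.offer, ∀ m', ¬ M.trans m (some b) m'
    · exact Or.inr (Or.inr (Or.inr ⟨p, i, j, m, rfl, hf, ha,
        ⟨Set.sdiff_subset.trans hA, s, hs, hss, fun a ha t ht =>
          href a ha.1 _ (.alone _ (.free ha.2 ht))⟩, hk, hm, hb⟩))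
    · push Not at hb
      obtain ⟨b, hb, m', hm'⟩ := hb
      refine Or.inl ⟨hA, s, hs, hss, fun a ha t ht => ?_⟩
      by_cases hta : a ∈ D.tied p i
      · by_cases hdiv : pre (D.target p) i ++ [a] ∈ L.Div
        · exact href a ha _ (.sync (.dead hb hta ht hdiv) hm')
        · exact href a ha _ (.sync (.tied hb hta ht hdiv) hm')
      · exact href a ha _ (.alone _ (.free hta ht))
  | dead h h' => exact Or.inr (Or.inr (Or.inl ⟨h, h'⟩))

/-! ### Divergences of detours -/

theorem converges_plain {s : L.State} (hs : L.Converges s) {d : Option M.State}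
    (hd : ∀ m, d = some m → M.Converges m) : (D.sys M).Converges (.plain s, d) := by
  induction hs generalizing d with
  | intro s _ ih =>
    have base : ∀ d : Option M.State, (∀ m, d = some m → M.Converges m) →
        (∀ m m', d = some m → M.trans m none m' → (D.sys M).Converges (.plain s, some m')) →
        (D.sys M).Converges (.plain s, d) := by
      intro d hd hin
      refine Acc.intro _ fun q h => ?_
      change D.controller.Step M _ none q at h
      generalize hx : none = x at h
      cases h with
      | alone d h =>
        cases h with
        | plain h =>
          subst hx
          exact ih _ h hd
      | launch h => cases h
      | sync h => cases h
      | internal k hm => exact hin _ _ rfl hm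
    rcases d with _ | m
    · exact base none hd fun _ _ h => by cases h
    · have hm := hd m rfl
      clear hd
      induction hm with
      | intro m hm ihm =>
        refine base _ ?_ ?_
        · rintro _ ⟨⟩
          exact Acc.intro _ hm
        · rintro _ m' ⟨⟩ h
          exact ihm m' h

theorem converges_probe {p : D.Index} {i : ℕ} {s : L.State} {m : M.State} (hm : M.Converges m) :
    (D.sys M).Converges (.probe p i s, some m) := by
  induction hm with
  | intro m _ ih =>
    refine Acc.intro _ fun q h => ?_
    change D.controller.Step M _ none q at h
    generalize hx : none = x at h
    cases h with
    | alone d h => cases h; cases hx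
    | sync h => cases h <;> cases hx
    | internal k hm => exact ih _ hm

theorem Inv.converges (hD : D.Sound M E) {q : D.controller.State × Option M.State} {σ : List Act}
    (hq : D.Inv M E q σ) (hσ : σ ∉ L.Div) (hE : σ ∉ E) : (D.sys M).Converges q := by
  have plain : ∀ s d, D.Inv M E (.plain s, d) σ → (D.sys M).Converges (.plain s, d) := by
    intro s d h
    cases h with
    | plain hs hd =>
      exact converges_plain (converges_of_not_mem_Div hs hσ)
        fun m hm => (hd m hm).resolve_right hE
  have probe : ∀ p i s m, D.Inv M E (.probe p i s, some m) σ →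
      (D.sys M).Converges (.probe p i s, some m) := by
    intro p i s m h
    cases h with
    | probe hf _ _ _ hk =>
      exact converges_probe (converges_of_not_mem_Div hk (hD.probed_conv _ _ _ hf))
  have track : ∀ p i j d, D.Inv M E (.track p i j, d) σ →
      (D.sys M).Converges (.track p i j, d) := by
    intro p i
    by_cases hi : σ = pre (D.target p) i
    swap
    · intro j d h
      cases h
      exact absurd rfl hi
    obtain ⟨N, hN⟩ := hD.bounded p i (hi ▸ hσ)
    have step : ∀ j, (j < N → ∀ d, D.Inv M E (.track p i (j + 1), d) σ →
        (D.sys M).Converges (.track p i (j + 1), d)) → ∀ d, D.Inv M E (.track p i j, d) σ →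
        (D.sys M).Converges (.track p i j, d) := by
      intro j hj d hq
      have base : ∀ d : Option M.State, D.Inv M E (.track p i j, d) σ →
          (∀ m m', d = some m → M.trans m none m' →
            (D.sys M).Converges (.track p i j, some m')) →
          (D.sys M).Converges (.track p i j, d) := by
        intro d hq hin
        refine Acc.intro _ fun q h => ?_
        have hq' := hq.tau hD h
        change D.controller.Step M _ none q at h
        generalize hx : none = x at h
        cases h with
        | alone d h =>
          cases h with
          | resume => exact plain _ _ hq'
          | emit => cases hx
          | probe =>
            cases hq' with
            | probe h1 h2 h3 h4 h5 => exact probe _ _ _ _ (hi ▸ .probe h1 h2 h3 h4 h5)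
        | launch h =>
          cases h with
          | launch ha hact => exact hj (hN _ ha hact) _ hq'
        | sync h =>
          cases h with
          | drive ha hact => exact hj (hN _ ha hact) _ hq'
        | internal k hm => exact hin _ _ rfl hm
      rcases d with _ | m
      · exact base none hq fun _ _ h => by cases h
      · have hm : M.Converges m := by
          subst hi
          cases hq with
          | track ha hp =>
            cases hp with
            | driven hk =>
              by_contra hc
              exact (hD.guard _ _ _ ha (mem_Div_of_not_converges hk hc)).elim hσ hE
        induction hm with
        | intro m _ ih =>
          refine base _ hq ?_
          rintro _ m' ⟨⟩ h
          exact ih m' h (hq.tau hD (.internal _ h))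
    have key : ∀ n j d, N - j ≤ n → D.Inv M E (.track p i j, d) σ →
        (D.sys M).Converges (.track p i j, d) := by
      intro n
      induction n with
      | zero => exact fun j d hn => step j (fun hj => by omega) d
      | succ n ih => exact fun j d hn => step j (fun hj d => ih (j + 1) d (by omega)) d
    exact fun j d => key _ j d le_rfl
  cases hq with
  | start =>
    refine Acc.intro _ fun q h => ?_
    have hq := Inv.start.tau hD h
    change D.controller.Step M _ none q at h
    generalize hx : none = x at h
    cases h with
    | alone d h =>
      cases h with
      | start => exact plain _ _ hq
      | enter p hp => exact track _ _ _ _ hq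
    | launch h => cases h
    | sync => cases hx
    | internal => cases hx
  | plain h h' => exact plain _ _ (.plain h h')
  | track h h' => exact track _ _ _ _ (.track h h')
  | probe h1 h2 h3 h4 h5 => exact probe _ _ _ _ (.probe h1 h2 h3 h4 h5)
  | dead h => exact absurd h hσ

theorem Div_sys_subset (hD : D.Sound M E) {σ : List Act} (h : σ ∈ (D.sys M).Div) :
    σ ∈ L.Div ∨ σ ∈ E := by
  obtain ⟨q, hq, hd⟩ := h
  by_contra! hc
  exact not_diverges_iff.2 ((inv_of_reach hD hq).converges hD hc.1 hc.2) hd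

/-! ### Infinite words of detours -/

/-- From a state of `L`, a detour behaves like `L`. -/
theorem of_reach_plain {s : L.State} {d : Option M.State} {σ : List Act}
    {q : D.controller.State × Option M.State} (h : (D.sys M).Reach (.plain s, d) σ q) :
    ∃ t d', q = (.plain t, d') ∧ L.Reach s σ t := by
  have := Reach.invariant (L := D.sys M)
    (I := fun q σ => ∃ t d', q = (.plain t, d') ∧ L.Reach s σ t) ?_ ?_
    ⟨s, d, rfl, .refl s⟩ h
  · exact this
  · rintro _ q' σ ⟨t, d', rfl, ht⟩ h
    change D.controller.Step M _ none q' at h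
    generalize hx : none = x at h
    cases h with
    | alone d h =>
      cases h with
      | plain h => exact ⟨_, _, rfl, ht.snoc_tau (hx ▸ h)⟩
    | launch h => cases h
    | sync h => cases h
    | internal k hm => exact ⟨_, _, rfl, ht⟩
  · rintro _ q' σ a ⟨t, d', rfl, ht⟩ h
    change D.controller.Step M _ (some a) q' at h
    generalize hx : some a = x at h
    cases h with
    | alone d h =>
      cases h with
      | plain h => exact ⟨_, _, rfl, ht.snoc (hx ▸ h)⟩
    | launch h => cases hx
    | sync h => cases h
    | internal k hm => cases hx

theorem of_reach_dead {d : Option M.State} {σ : List Act}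
    {q : D.controller.State × Option M.State} (h : (D.sys M).Reach (.dead, d) σ q) : σ = [] := by
  have := Reach.invariant (L := D.sys M) (I := fun q σ => (∃ d', q = (.dead, d')) ∧ σ = []) ?_ ?_
    ⟨⟨d, rfl⟩, rfl⟩ h
  · simpa using this.2
  · rintro _ q' σ ⟨⟨d', rfl⟩, ht⟩ h
    change D.controller.Step M _ none q' at h
    generalize hx : none = x at h
    cases h with
    | alone d h => cases h
    | launch h => cases h
    | sync h => cases h
    | internal k hm => exact ⟨⟨_, rfl⟩, ht⟩
  · rintro _ q' σ a ⟨⟨d', rfl⟩, ht⟩ h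
    change D.controller.Step M _ (some a) q' at h
    generalize hx : some a = x at h
    cases h with
    | alone d h => cases h
    | launch h => cases hx
    | sync h => cases h
    | internal k hm => cases hx

theorem of_trans_track {p : D.Index} {i j : ℕ} {d : Option M.State} {a : Act}
    {q : D.controller.State × Option M.State} (h : (D.sys M).trans (.track p i j, d) (some a) q) :
    q = (.track p (i + 1) j, d) := by
  change D.controller.Step M _ (some a) q at h
  generalize hx : some a = x at h
  cases h with
  | alone d h =>
    cases h with
    | emit => rfl
    | resume => cases hx
    | probe => cases hx
  | launch h => cases hx
  | sync h => cases h; cases hx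
  | internal k hm => cases hx

end Detour

namespace Detour
variable {L : LTS.{u, v} Act} {D : Detour L} {M : LTS.{u, v} Act} {E : Set (List Act)}

/-- The phases through which the control states pass. -/
def Ctl.phase : D.Ctl → ℕ
  | .start => 0
  | .track _ _ _ => 1
  | .probe _ _ _ => 2
  | .plain _ => 3
  | .dead => 3

theorem phase_le {q q' : D.controller.State × Option M.State} {x : Option Act}
    (h : (D.sys M).trans q x q') : Ctl.phase q.1 ≤ Ctl.phase q'.1 := by
  change D.controller.Step M q x q' at h
  cases h with
  | alone d h => cases h <;> simp [Ctl.phase]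
  | launch h => cases h; simp [Ctl.phase]
  | sync h => cases h <;> simp [Ctl.phase]
  | internal k hm => exact le_rfl

theorem of_trans_probe {q q' : D.controller.State × Option M.State} {a : Act}
    (h : (D.sys M).trans q (some a) q') (hq : 2 ≤ Ctl.phase q.1) : 3 ≤ Ctl.phase q'.1 := by
  change D.controller.Step M q (some a) q' at h
  generalize hx : some a = x at h
  cases h with
  | alone d h => cases h <;> simp_all [Ctl.phase]
  | launch h => cases hx
  | sync h => cases h <;> simp_all [Ctl.phase]
  | internal k hm => cases hx

theorem of_reach_probe {p : D.Index} {i : ℕ} {s : L.State} {d : Option M.State} {σ : List Act}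
    {q : D.controller.State × Option M.State} (h : (D.sys M).Reach (.probe p i s, d) σ q) :
    σ = [] ∨ (∃ t d', q = (.plain t, d')) ∨ ∃ d', q = (.dead, d') := by
  have := Reach.invariant (L := D.sys M)
    (I := fun q σ => 2 ≤ Ctl.phase q.1 ∧ (σ = [] ∨ 3 ≤ Ctl.phase q.1))
    (fun q q' σ hq h => ⟨hq.1.trans (phase_le h), hq.2.imp_right fun h' => h'.trans (phase_le h)⟩)
    (fun q q' σ a hq h => ⟨hq.1.trans (phase_le h), Or.inr (of_trans_probe h hq.1)⟩)
    ⟨le_rfl, Or.inl rfl⟩ h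
  rcases this with ⟨-, h | h⟩
  · exact Or.inl (by simpa using h)
  · obtain ⟨k, d'⟩ := q
    cases k with
    | plain t => exact Or.inr (Or.inl ⟨t, d', rfl⟩)
    | dead => exact Or.inr (Or.inr ⟨d', rfl⟩)
    | _ => simp [Ctl.phase] at h

/-- The part of the driving word that the subprocess reads between two positions of a track. -/
def Advance (D : Detour L) (M : LTS.{u, v} Act) (j : ℕ) (d : Option M.State) (j' : ℕ)
    (d' : Option M.State) : Prop :=
  j ≤ j' ∧ ∀ k m, j = k + 1 → d = some m → ∃ n m', j' = k + n + 1 ∧ d' = some m' ∧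
    M.Reach m (pre (fun i => D.drive (k + i)) n) m'

theorem of_reach_track {p p' : D.Index} {i j i' j' : ℕ} {d d' : Option M.State} {σ : List Act}
    (h : (D.sys M).Reach (.track p i j, d) σ (.track p' i' j', d')) :
    p' = p ∧ D.Advance M j d j' d' := by
  have := Reach.invariant (L := D.sys M) (σ := [])
    (I := fun q _ => (∃ i' j' d', q = (.track p i' j', d') ∧ D.Advance M j d j' d') ∨
      2 ≤ Ctl.phase q.1) ?_ ?_
    (Or.inl ⟨i, j, d, rfl, le_rfl, fun k m hj hd => ⟨0, m, hj, hd, .refl _⟩⟩) h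
  · rcases this with ⟨i', j', d', h, h'⟩ | h
    · cases h
      exact ⟨rfl, h'⟩
    · simp [Ctl.phase] at h
  · rintro q q' σ (⟨i', j', d', rfl, hj, hadv⟩ | hq) h
    swap
    · exact Or.inr (hq.trans (phase_le h))
    change D.controller.Step M _ none q' at h
    generalize hx : none = x at h
    cases h with
    | alone d h =>
      cases h with
      | emit => cases hx
      | _ => exact Or.inr (by simp [Ctl.phase])
    | launch h =>
      cases h with
      | launch => exact Or.inl ⟨_, _, _, rfl, by omega, fun k m hk => by omega⟩
    | @sync _ _ b x m m' h hm =>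
      cases h with
      | @drive _ _ j' =>
        refine Or.inl ⟨_, _, _, rfl, by omega, fun k m₀ hk hm₀ => ?_⟩
        obtain ⟨n, m₁, h1, h2, h3⟩ := hadv k m₀ hk hm₀
        cases h2
        refine ⟨n + 1, m', by omega, rfl, ?_⟩
        rw [pre_succ]
        obtain rfl : j' = k + n := by omega
        exact h3.snoc hm
    | internal k hm =>
      refine Or.inl ⟨_, _, _, rfl, hj, fun k m₀ hk hm₀ => ?_⟩
      obtain ⟨n, m₁, h1, h2, h3⟩ := hadv k m₀ hk hm₀
      cases h2
      exact ⟨n, _, h1, rfl, h3.snoc_tau hm⟩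
  · rintro q q' σ a (⟨i', j', d', rfl, hadv⟩ | hq) h
    · obtain rfl := of_trans_track h
      exact Or.inl ⟨_, _, _, rfl, hadv⟩
    · exact Or.inr (hq.trans (phase_le h))

/-- An infinite word of a detour is an infinite trace of `L` or a target whose track is followed
forever. In the latter case, if the subprocess is driven without bound then the whole driving word
is one of its infinite traces. -/
theorem mem_Inf_of_mem_Inf_sys (hD : D.Sound M E) {ζ : ℕ → Act} (h : ζ ∈ (D.sys M).Inf) :
    ζ ∈ L.Inf ∨ ∃ p, ζ = D.target p ∧ ∃ j : ℕ → ℕ, (∀ n, D.allowed p (n + 1) (j n)) ∧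
      (∀ n k, j n = k + 1 → pre D.drive k ∈ M.Tr) ∧
      ((∀ J, ∃ n, J ≤ j n) → D.drive ∈ M.Inf) := by
  obtain ⟨q, hq0, hq⟩ := h
  have hreach : ∀ n, (D.sys M).Reach (D.sys M).init (pre ζ n) (q n) := by
    intro n
    have := reach_pre_of_steps hq 0 n
    rw [hq0] at this
    simpa using this
  have hinv : ∀ n, D.Inv M E (q n) (pre ζ n) := fun n => inv_of_reach hD (hreach n)
  by_cases hpl : ∃ n s d, q n = (.plain s, d)
  · left
    obtain ⟨n, s, d, hn⟩ := hpl
    have h0 := hinv n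
    rw [hn] at h0
    cases h0 with
    | plain hs _ =>
      refine mem_Inf_of_progress (fun t k => ∃ d', q k = (.plain t, d')) ?_ hs ⟨d, hn⟩
      rintro t k ⟨d', hk⟩
      have := hq k
      rw [hk] at this
      obtain ⟨t', d'', h1, h2⟩ := of_reach_plain this
      exact ⟨t', 1, one_pos, by simpa [pre_succ] using h2, d'', h1⟩
  right
  have hdead : ∀ n d, q n ≠ (.dead, d) := by
    intro n d hn
    have := hq n
    rw [hn] at this
    simpa using of_reach_dead this
  have htrack : ∀ n, ∃ p j d, q (n + 1) = (.track p (n + 1) j, d) ∧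
      D.allowed p (n + 1) j ∧ Progress D M j d ∧ pre ζ (n + 1) = pre (D.target p) (n + 1) := by
    intro n
    have h1 := hinv (n + 1)
    generalize hw : pre ζ (n + 1) = w at h1
    generalize hq1 : q (n + 1) = q1 at h1
    cases h1 with
    | start => simpa using congrArg List.length hw
    | plain => exact absurd ⟨_, _, _, hq1⟩ hpl
    | @track p i j d ha hp =>
      have : n + 1 = i := by simpa using congrArg List.length hw
      subst this
      exact ⟨p, j, d, rfl, ha, hp, rfl⟩
    | probe =>
      have := hq (n + 1)
      rw [hq1] at this
      rcases of_reach_probe this with h | ⟨t, d', h⟩ | ⟨d', h⟩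
      · simp at h
      · exact absurd ⟨_, _, _, h⟩ hpl
      · exact absurd h (hdead _ _)
    | dead => exact absurd hq1 (hdead _ _)
  choose p j d hqt hall hprog hpre using htrack
  have hmove : ∀ n k, p (n + k) = p n ∧ D.Advance M (j n) (d n) (j (n + k)) (d (n + k)) := by
    intro n k
    have := reach_pre_of_steps hq (n + 1) k
    rw [hqt n, Nat.add_right_comm n 1 k, hqt (n + k)] at this
    exact of_reach_track this
  have hp : ∀ n, p n = p 0 := by
    intro n
    have := (hmove 0 n).1
    rwa [Nat.zero_add] at this
  refine ⟨p 0, pre_injective fun n => ?_, j, fun n => hp n ▸ hall n, fun n k hn => ?_, fun hJ => ?_⟩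
  · rcases n with _ | n
    · rfl
    · rw [hpre n, hp n]
  · have := hprog n
    rw [hn] at this
    generalize d n = dn at this
    cases this with
    | driven hk => exact ⟨_, hk⟩
  · have hsome : ∀ n k, j n = k + 1 → ∃ m, d n = some m ∧ M.Reach M.init (pre D.drive k) m := by
      intro n k hn
      have := hprog n
      rw [hn] at this
      generalize hdn : d n = dn at this
      cases this with
      | driven hk => exact ⟨_, rfl, hk⟩
    obtain ⟨n₀, hn₀⟩ := hJ 1
    obtain ⟨k₀, hk₀⟩ := Nat.exists_eq_add_of_le' hn₀
    obtain ⟨m₀, hm₀, hr₀⟩ := hsome n₀ k₀ hk₀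
    refine mem_Inf_of_progress (fun m k => ∃ n, j n = k + 1 ∧ d n = some m) ?_ hr₀
      ⟨n₀, hk₀, hm₀⟩
    rintro m k ⟨n, hn, hm⟩
    obtain ⟨n', hn'⟩ := hJ (j n + 1)
    have hle : n ≤ n' := by
      by_contra hlt
      obtain ⟨l, rfl⟩ := Nat.exists_eq_add_of_le (not_le.1 hlt).le
      have := (hmove n' l).2.1
      omega
    obtain ⟨l, rfl⟩ := Nat.exists_eq_add_of_le hle
    obtain ⟨a, m', h1, h2, h3⟩ := (hmove n l).2.2 k m hn hm
    exact ⟨m', a, by omega, h3, n + l, h1, h2⟩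

/-! ### Following a track -/

theorem reach_internal {m m' : M.State} (k : D.controller.State) (h : M.Reach m [] m') :
    (D.sys M).Reach (k, some m) [] (k, some m') := by
  generalize hw : [] = w at h
  induction h with
  | refl => exact .refl _
  | tau h _ ih => exact .tau (Controller.Step.internal (C := D.controller) k h) (ih hw)
  | visible => cases hw

theorem reach_drive_one {p : D.Index} {i j : ℕ} {m m' : M.State} (h : M.Reach m [D.drive j] m')
    (ha : D.allowed p i (j + 2)) (hact : D.active p i) :
    (D.sys M).Reach (.track p i (j + 1), some m) [] (.track p i (j + 2), some m') := by
  generalize hw : [D.drive j] = w at h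
  induction h with
  | refl => cases hw
  | tau h _ ih => exact .tau (.internal _ h) (ih hw)
  | visible h h' _ =>
    cases hw
    exact .tau (.sync (.drive ha hact) h) (reach_internal _ h')

theorem reach_drive {p : D.Index} {i j n : ℕ} {m m' : M.State}
    (h : M.Reach m (pre (fun l => D.drive (j + l)) n) m')
    (ha : ∀ l < n, D.allowed p i (j + l + 2)) (hact : D.active p i) :
    (D.sys M).Reach (.track p i (j + 1), some m) [] (.track p i (j + n + 1), some m') := by
  induction n generalizing m' with
  | zero => exact reach_internal _ h
  | succ n ih =>
    rw [pre_succ] at h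
    obtain ⟨t, h1, h2⟩ := reach_append h
    exact (ih h1 fun l hl => ha l (by omega)).append
      (reach_drive_one h2 (ha n (by omega)) hact)

theorem reach_emit {p : D.Index} {i j n : ℕ} (d : Option M.State)
    (h : ∀ l < n, D.allowed p (i + l + 1) j ∧ D.target p (i + l) ∈ L.alphabet) :
    (D.sys M).Reach (.track p i j, d) (pre (fun l => D.target p (i + l)) n)
      (.track p (i + n) j, d) := by
  induction n with
  | zero => exact .refl _
  | succ n ih =>
    rw [pre_succ]
    exact (ih fun l hl => h l (by omega)).snoc
      (.alone _ (.emit (h n (by omega)).1 (h n (by omega)).2))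

theorem reach_track_zero {p : D.Index} {n : ℕ} (h : ∀ i ≤ n, D.allowed p i 0)
    (hmem : ∀ i < n, D.target p i ∈ L.alphabet) :
    (D.sys M).Reach (D.sys M).init (pre (D.target p) n) (.track p n 0, none) := by
  refine .tau (.alone _ (.enter p (h 0 (by omega)))) ?_
  have := reach_emit (D := D) (M := M) (p := p) (i := 0) (j := 0) (n := n) none
    fun l hl => ⟨by simpa using h (l + 1) hl, by simpa using hmem l hl⟩
  simpa using this

/-- The run along a track that shows `n` letters, drives the subprocess through the first `k`
letters of the driving word, and shows the remaining letters. -/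
theorem reach_track {p : D.Index} {n k l : ℕ} {m : M.State}
    (hm : M.Reach M.init (pre D.drive k) m) (h₁ : ∀ i ≤ n, D.allowed p i 0)
    (h₂ : ∀ j ≤ k, D.allowed p n (j + 1)) (h₃ : ∀ i, n ≤ i → i ≤ l → D.allowed p i (k + 1))
    (hact : D.active p n) (hmem : ∀ i < l, D.target p i ∈ L.alphabet) (hnl : n ≤ l) :
    (D.sys M).Reach (D.sys M).init (pre (D.target p) l) (.track p l (k + 1), some m) := by
  obtain ⟨c, rfl⟩ := Nat.exists_eq_add_of_le hnl
  rw [pre_add]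
  refine (reach_track_zero h₁ fun i hi => hmem i (by omega)).append
    (.tau (.launch (.launch (h₂ 0 (by omega)) hact)) ?_)
  have := reach_drive (D := D) (M := M) (p := p) (i := n) (j := 0) (n := k) (m' := m)
    (by simpa using hm) (fun j hj => by simpa using h₂ (j + 1) hj) hact
  simp only [Nat.zero_add] at this
  exact this.append (reach_emit (i := n) (n := c) _ fun i hi =>
    ⟨h₃ (n + i + 1) (by omega) (by omega), hmem (n + i) (by omega)⟩)

end Detour

/-! ### Codes for words -/

section Codes

/-- Codes for infinite words over the alphabet of `L` and one default letter. They form a type in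
the universe of the states. -/
abbrev Code (L : LTS.{u, v} Act) : Type u :=
  ℕ → Option (@Shrink.{u} L.alphabet L.small_alphabet)

/-- The word with a given code. -/
noncomputable def Code.word {L : LTS.{u, v} Act} (d : Act) (c : L.Code) (n : ℕ) : Act :=
  (c n).elim d fun x => ((@equivShrink.{u} L.alphabet L.small_alphabet).symm x : L.alphabet)

theorem exists_code {L : LTS.{u, v} Act} (d : Act) {ξ : ℕ → Act}
    (h : ∀ n, ξ n ∈ L.alphabet ∨ ξ n = d) : ∃ c : L.Code, c.word d = ξ := by
  classical
  refine ⟨fun n => if hn : ξ n ∈ L.alphabet then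
    some (@equivShrink.{u} L.alphabet L.small_alphabet ⟨ξ n, hn⟩) else none, ?_⟩
  funext n
  by_cases hn : ξ n ∈ L.alphabet
  · simp [Code.word, hn]
  · have hd := (h n).resolve_left hn
    simp only [Code.word, dif_neg hn, Option.elim]
    exact hd.symm

/-- Every finite word over the alphabet is a prefix of an infinite word that has a code. -/
theorem exists_code_list {L : LTS.{u, v} Act} (d : Act) {σ : List Act}
    (h : ∀ a ∈ σ, a ∈ L.alphabet) : ∃ c : L.Code,
      (∀ i ≤ σ.length, pre (c.word d) i = σ.take i) ∧ ∀ i < σ.length, c.word d i ∈ L.alphabet := by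
  have hmem : ∀ i < σ.length, σ.getD i d ∈ L.alphabet := by
    intro i hi
    simp only [List.getD_eq_getElem?_getD, List.getElem?_eq_getElem hi, Option.getD_some]
    exact h _ (List.getElem_mem hi)
  obtain ⟨c, hc⟩ := exists_code (L := L) d (ξ := fun n => σ.getD n d) (by
    intro n
    rcases lt_or_ge n σ.length with hn | hn
    · exact Or.inl (hmem n hn)
    · simp [hn])
  exact ⟨c, fun i hi => hc ▸ pre_getD σ d hi, fun i hi => hc ▸ hmem i hi⟩

end Codes

theorem nonempty_act (hAct : ¬ Small.{u} Act) : Nonempty Act := by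
  by_contra h
  rw [not_nonempty_iff] at h
  exact hAct inferInstance

/-! ### Saturation -/

section Saturation

variable {r : LTS.{u, v} Act → LTS.{u, v} Act → Prop}

/-- The setting of the classification: a congruence that is implied by CFFD-equivalence and
preserves the alphabet. -/
structure Admissible (r : LTS.{u, v} Act → LTS.{u, v} Act → Prop) : Prop where
  not_small : ¬ Small.{u} Act
  congruence : IsCongruence r
  of_cffd : ∀ L L' : LTS.{u, v} Act, CFFDEquiv L L' → r L L'
  alphabet : ∀ L L' : LTS.{u, v} Act, r L L' → L.alphabet = L'.alphabet

/-- A detour that is sound for `M'` and adds nothing to `L` when it runs `M'` yields an LTS that is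
related to `L` by running `M` instead. -/
theorem Admissible.detour (hr : Admissible r) {L M M' : LTS.{u, v} Act} (h : r M M') (D : Detour L)
    (hD : D.Sound M' ∅) (hSf : (D.sys M').Sf ⊆ L.Sf) (hInf : (D.sys M').Inf ⊆ L.Inf) :
    r L (D.sys M) := by
  have h1 : r L (D.sys M') := hr.of_cffd _ _ ⟨rfl, Detour.Sf_subset.antisymm hSf,
    Detour.Div_subset.antisymm fun σ h => (Detour.Div_sys_subset hD h).elim id fun h => h.elim,
    Detour.Inf_subset.antisymm hInf⟩
  have h2 : r (D.sys M) (D.sys M') :=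
    hr.congruence.run hr.not_small D.controller (hr.alphabet _ _ h) h
  exact hr.congruence.equivalence.trans h1 (hr.congruence.equivalence.symm h2)

/-- All subsets of the alphabet are refused after all divergence traces. -/
def Saturated (L : LTS.{u, v} Act) : Prop :=
  ∀ f : List Act × Set Act, f.1 ∈ L.Div → f.2 ⊆ L.alphabet → f ∈ L.Sf

/-- Adding all refusals after divergence traces: at a divergence trace, a subprocess is launched
that either only diverges or may also deadlock. -/
theorem Admissible.exists_saturated (hr : Admissible r) (hlock : r livelock bothlock)
    (L : LTS.{u, v} Act) : ∃ L' : LTS.{u, v} Act, r L L' ∧ L'.alphabet = L.alphabet ∧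
      L'.Div = L.Div ∧ L'.Inf = L.Inf ∧
      ∀ f, f ∈ L'.Sf ↔ f ∈ L.Sf ∨ (f.1 ∈ L.Div ∧ f.2 ⊆ L.alphabet) := by
  obtain ⟨d⟩ := nonempty_act hr.not_small
  let D : Detour L :=
    { Index := L.Code × ℕ
      target := fun p => p.1.word d
      drive := fun _ => d
      allowed := fun p i j => pre (p.1.word d) p.2 ∈ L.Div ∧ i ≤ p.2 ∧ j ≤ 1 ∧ (j = 1 → i = p.2)
      active := fun _ _ => True
      probed := fun _ _ _ => False
      tied := fun _ _ => ∅
      offer := ∅ }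
  have hS : ∀ M : LTS.{u, v} Act, D.Sound M ∅ := fun M =>
    { append_mem := fun _ _ h => h.elim
      guard := fun p i j ⟨h1, _, h3, h4⟩ _ => by
        obtain rfl : i = p.2 := h4 (by omega)
        exact Or.inl h1
      bounded := fun p i _ => ⟨1, fun j ⟨_, _, h, _⟩ _ => h⟩
      early := fun p i ⟨h1, h2, _⟩ => pre_mem_Tr_of_le h2 (Div_subset_Tr h1)
      probed_pos := fun _ _ h => h
      probed_conv := fun _ _ _ h => h.elim
      offer_conv := fun _ _ _ _ _ h => h.elim }
  have hInf : ∀ M : LTS.{u, v} Act, (D.sys M).Inf ⊆ L.Inf := by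
    intro M ζ hζ
    rcases Detour.mem_Inf_of_mem_Inf_sys (hS M) hζ with h | ⟨p, -, j, hj, -⟩
    · exact h
    · have := (hj p.2).2.1
      omega
  have hDiv : ∀ M : LTS.{u, v} Act, (D.sys M).Div = L.Div := fun M =>
    Set.Subset.antisymm (fun σ h => (Detour.Div_sys_subset (hS M) h).elim id fun h => h.elim)
      Detour.Div_subset
  refine ⟨D.sys bothlock, hr.detour (hr.congruence.equivalence.symm hlock) D (hS _) ?_ (hInf _),
    rfl, hDiv _, (hInf _).antisymm Detour.Inf_subset, ?_⟩
  · rintro ⟨σ, A⟩ hf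
    rcases Detour.mem_Sf_of_mem_Sf_sys (hS _) hf with h | ⟨_, _, _, m, _, _, _, _, h⟩ |
      ⟨_, _, _, _, h⟩ | ⟨_, _, _, _, _, h, _⟩
    · exact h
    · exact absurd rfl (h m)
    · exact h.elim
    · exact h.elim
  · rintro ⟨σ, A⟩
    constructor
    · intro hf
      rcases Detour.mem_Sf_of_mem_Sf_sys (hS _) hf with h | ⟨p, i, j, m, rfl, ⟨h1, -, h3, h4⟩, -⟩ |
        ⟨_, _, _, _, h⟩ | ⟨_, _, _, _, _, h, _⟩
      · exact Or.inl h
      · obtain rfl : i = p.2 := h4 (by omega)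
        exact Or.inr ⟨h1, hf.1⟩
      · exact h.elim
      · exact h.elim
    · rintro (h | ⟨h, hA⟩)
      · exact Detour.Sf_subset h
      · refine ⟨hA, ?_⟩
        obtain ⟨c, hc, hc'⟩ := exists_code_list (L := L) d
          (mem_alphabet_of_mem_Tr (Div_subset_Tr h))
        have hσ : pre (c.word d) σ.length = σ := by simpa using hc _ le_rfl
        have hreach := Detour.reach_track (D := D) (M := bothlock) (p := (c, σ.length))
          (n := σ.length) (k := 0) (l := σ.length) (m := ULift.up false)
          (.tau ⟨rfl, rfl⟩ (.refl _)) (fun i hi => ⟨hσ.symm ▸ h, hi, by omega, by omega⟩)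
          (fun j hj => ⟨hσ.symm ▸ h, le_rfl, by omega, fun _ => rfl⟩)
          (fun i hi hi' => ⟨hσ.symm ▸ h, hi', by omega, fun _ => le_antisymm hi' hi⟩)
          trivial hc' le_rfl
        change (D.sys bothlock).Reach _ (pre (c.word d) σ.length) _ at hreach
        rw [hσ] at hreach
        have stuck : ∀ x q, ¬ (D.sys bothlock).trans (.track (c, σ.length) σ.length 1,
            some (ULift.up false)) x q := by
          intro x q hq
          change D.controller.Step bothlock _ x q at hq
          cases hq with
          | alone d hq =>
            cases hq with
            | resume hj _ =>
              rcases hj with hj | hj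
              · cases hj
              · exact hj (hσ.symm ▸ h)
            | emit ha => exact absurd ha.2.1 (by simp)
            | probe hf => exact hf
          | sync hq _ =>
            cases hq with
            | drive ha => exact absurd ha.2.2.1 (by omega)
          | internal k hm => exact absurd hm.1 (by simp)
        exact ⟨_, hreach, fun q => stuck none q, fun a _ q => stuck (some a) q⟩

end Saturation

section Saturation

variable {r : LTS.{u, v} Act → LTS.{u, v} Act → Prop}

theorem not_mem_divExt_of_pre {L : LTS.{u, v} Act} {ξ : ℕ → Act} {n i : ℕ} (hn : n ≤ i)
    (h : pre ξ i ∉ L.divExt) : pre ξ n ∉ L.Div :=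
  fun hd => h (pre_mem_divExt_of_le hn hd)

/-- If traces are not preserved then everything can be added after divergence traces: a subprocess
is launched at a divergence trace, and the remaining letters are shown only after it has executed a
trace that the related subprocess does not have. -/
theorem Admissible.exists_chaotic (hr : Admissible r) {M M' : LTS.{u, v} Act} (h : r M M')
    {σ : List Act} (hσ : σ ∈ M.Div) (hσ' : σ ∉ M'.Tr) {L : LTS.{u, v} Act} (hL : L.Saturated) :
    ∃ L' : LTS.{u, v} Act, r L L' ∧ L'.alphabet = L.alphabet ∧ L'.Div = L.extT ∧
      (∀ ξ, ξ ∈ L'.Inf ↔ ξ ∈ L.Inf ∨ ξ ∈ L.extI) ∧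
      ∀ f, f.1 ∉ L.extT → (f ∈ L'.Sf ↔ f ∈ L.Sf) := by
  obtain ⟨d⟩ := nonempty_act hr.not_small
  let D : Detour L :=
    { Index := L.Code × ℕ
      target := fun p => p.1.word d
      drive := fun n => σ.getD n d
      allowed := fun p i j => pre (p.1.word d) p.2 ∈ L.Div ∧ j ≤ σ.length + 1 ∧
        (0 < j → p.2 ≤ i) ∧ (p.2 < i → j = σ.length + 1)
      active := fun _ _ => True
      probed := fun _ _ _ => False
      tied := fun _ _ => ∅
      offer := ∅ }
  have hdrive : pre D.drive σ.length = σ := pre_getD_length σ d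
  have hlate : ∀ p i j, D.allowed p i (j + 1) → pre (D.target p) i ∈ L.Div ∨ j = σ.length := by
    rintro p i j ⟨h1, h2, h3, h4⟩
    rcases (h3 (by omega)).eq_or_lt with rfl | hlt
    · exact Or.inl h1
    · exact Or.inr (by have := h4 hlt; omega)
  have hbounded : ∀ p i, pre (D.target p) i ∉ L.Div →
      ∃ N, ∀ j, D.allowed p i j → D.active p i → j ≤ N :=
    fun p i _ => ⟨σ.length + 1, fun j hj _ => hj.2.1⟩
  have hearly : ∀ p i, D.allowed p i 0 → pre (D.target p) i ∈ L.Tr := by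
    rintro p i ⟨h1, h2, h3, h4⟩
    exact pre_mem_Tr_of_le (by by_contra hlt; have := h4 (by omega); omega) (Div_subset_Tr h1)
  have hext : ∀ p i j, D.allowed p i (j + 1) → pre (D.target p) i ∈ L.divExt :=
    fun p i j hj => pre_mem_divExt_of_le (hj.2.2.1 (by omega)) hj.1
  have hS' : D.Sound M' ∅ :=
    { append_mem := fun _ _ h => h.elim
      guard := fun p i j hj hd => by
        rcases hlate p i j hj with h | rfl
        · exact Or.inl h
        · exact absurd (Div_subset_Tr (hdrive ▸ hd)) hσ'
      bounded := hbounded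
      early := hearly
      probed_pos := fun _ _ h => h
      probed_conv := fun _ _ _ h => h.elim
      offer_conv := fun _ _ _ _ _ h => h.elim }
  have hS : D.Sound M L.divExt :=
    { append_mem := fun _ _ h => divExt_append h _
      guard := fun p i j hj _ => Or.inr (hext p i j hj)
      bounded := hbounded
      early := hearly
      probed_pos := fun _ _ h => h
      probed_conv := fun _ _ _ h => h.elim
      offer_conv := fun _ _ _ _ _ h => h.elim }
  have hrun : ∀ (c : L.Code) (n l : ℕ), pre (c.word d) n ∈ L.Div → n ≤ l →
      (∀ i < l, c.word d i ∈ L.alphabet) → ∀ m, M.Reach M.init σ m →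
      (D.sys M).Reach (D.sys M).init (pre (c.word d) l)
        (.track (c, n) l (σ.length + 1), some m) := by
    intro c n l hn hnl hc m hm
    rw [← hdrive] at hm
    exact Detour.reach_track (D := D) (p := (c, n)) hm
      (fun i hi => ⟨hn, by omega, by omega, fun hlt => absurd hi (not_le.2 hlt)⟩)
      (fun j hj => ⟨hn, by omega, fun _ => le_rfl, fun hlt => absurd hlt (lt_irrefl _)⟩)
      (fun i hi hi' => ⟨hn, by omega, fun _ => hi, fun _ => rfl⟩) trivial hc hnl
  have hmemI : ∀ ζ ∈ (D.sys M).Inf, ζ ∈ L.Inf ∨ ζ ∈ L.extI := by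
    intro ζ hζ
    have hal : ∀ n, ζ n ∈ L.alphabet := fun n =>
      mem_alphabet_of_mem_Tr (pre_mem_Tr_of_mem_Inf hζ (n + 1)) _ (by simp [pre_succ])
    rcases Detour.mem_Inf_of_mem_Inf_sys hS hζ with h | ⟨p, rfl, j, hj, -⟩
    · exact Or.inl h
    · exact Or.inr (mem_extI_iff.2 ⟨hal, p.2, (hj 0).1⟩)
  refine ⟨D.sys M, hr.detour h D hS' ?_ ?_, rfl, ?_, fun ξ => ⟨hmemI ξ, ?_⟩, ?_⟩
  · rintro ⟨τ, A⟩ hf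
    rcases Detour.mem_Sf_of_mem_Sf_sys hS' hf with h | ⟨p, i, j, m, rfl, hj, -, hm, -⟩ |
      ⟨_, _, _, _, h⟩ | ⟨_, _, _, _, _, h, _⟩
    · exact h
    · rcases hlate p i j hj with h | rfl
      · exact hL _ h hf.1
      · exact absurd ⟨m, hdrive ▸ hm⟩ hσ'
    · exact h.elim
    · exact h.elim
  · intro ζ hζ
    rcases Detour.mem_Inf_of_mem_Inf_sys hS' hζ with h | ⟨p, -, j, hj, hj', -⟩
    · exact h
    · have h1 := (hj p.2).2.2.2 (by omega)
      exact absurd (hdrive ▸ hj' p.2 _ h1) hσ'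
  · ext τ
    constructor
    · intro hτ
      refine mem_extT_iff.2 ⟨mem_alphabet_of_mem_Tr (L := D.sys M) (Div_subset_Tr hτ), ?_⟩
      exact (Detour.Div_sys_subset hS hτ).elim (fun h => Div_subset_divExt h) id
    · intro hτ
      obtain ⟨hal, n, hn, hd⟩ := mem_extT_iff.1 hτ
      obtain ⟨c, hc, hc'⟩ := exists_code_list (L := L) d hal
      obtain ⟨m, hm, q, hq, hq'⟩ := hσ
      have := hrun c n τ.length (by rwa [hc n hn]) hn hc' m hm
      rw [hc _ le_rfl, List.take_length] at this
      exact ⟨_, this, fun i => (.track (c, n) τ.length (σ.length + 1), some (q i)), hq ▸ rfl,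
        fun i => .internal _ (hq' i)⟩
  · rintro (hξ | hξ)
    · exact Detour.Inf_subset hξ
    · obtain ⟨hal, n, hn⟩ := mem_extI_iff.1 hξ
      obtain ⟨c, rfl⟩ := exists_code d (fun n => Or.inl (hal n))
      obtain ⟨m, hm, -⟩ := hσ
      refine mem_Inf_of_progress (fun q k => n ≤ k ∧
        q = (.track (c, n) k (σ.length + 1), some m)) ?_ (hrun c n n hn le_rfl
          (fun i _ => hal i) m hm) ⟨le_rfl, rfl⟩
      rintro q k ⟨hk, rfl⟩
      refine ⟨_, 1, one_pos, ?_, by omega, rfl⟩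
      refine Detour.reach_emit (D := D) (p := (c, n)) (n := 1) _ fun l hl => ⟨⟨hn, ?_⟩, hal _⟩
      exact ⟨le_rfl, fun _ => by simp only; omega, fun _ => rfl⟩
  · rintro ⟨τ, A⟩ hτ
    refine ⟨fun hf => ?_, fun hf => Detour.Sf_subset hf⟩
    have hτ' : τ ∉ L.divExt := fun h =>
      hτ (mem_extT_iff.2 ⟨mem_alphabet_of_mem_Tr (L := D.sys M) (mem_Tr_of_mem_Sf hf), h⟩)
    rcases Detour.mem_Sf_of_mem_Sf_sys hS hf with h | ⟨p, i, j, m, rfl, hj, -⟩ |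
      ⟨_, _, _, _, h⟩ | ⟨_, _, _, _, _, h, _⟩
    · exact h
    · exact absurd (hext p i j hj) hτ'
    · exact h.elim
    · exact h.elim

/-- If divergence traces are not preserved then all traces with a divergent prefix can be made
divergence traces: a subprocess is launched at the divergent prefix, and it diverges, or does not,
after the trace through which it is driven. -/
theorem Admissible.exists_divExt_divergent (hr : Admissible r) {M M' : LTS.{u, v} Act}
    (h : r M M') {σ : List Act} (hσ : σ ∈ M.Div) (hσ' : σ ∉ M'.Div) {L : LTS.{u, v} Act}
    (hL : L.Saturated) :
    ∃ L' : LTS.{u, v} Act, r L L' ∧ L'.alphabet = L.alphabet ∧ L'.Div = L.Tr ∩ L.divExt ∧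
      L'.Inf = L.Inf ∧ ∀ f, f.1 ∉ L.divExt → (f ∈ L'.Sf ↔ f ∈ L.Sf) := by
  obtain ⟨d⟩ := nonempty_act hr.not_small
  let D : Detour L :=
    { Index := L.Code × ℕ × ℕ
      target := fun p => p.1.word d
      drive := fun n => σ.getD n d
      allowed := fun p i j => pre (p.1.word d) p.2.1 ∈ L.Div ∧ pre (p.1.word d) p.2.2 ∈ L.Tr ∧
        i ≤ p.2.2 ∧ j ≤ σ.length + 1 ∧ (0 < j → p.2.1 ≤ i) ∧ (p.2.1 < i → j = σ.length + 1)
      active := fun _ _ => True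
      probed := fun _ _ _ => False
      tied := fun _ _ => ∅
      offer := ∅ }
  have hdrive : pre D.drive σ.length = σ := pre_getD_length σ d
  have hbounded : ∀ p i, pre (D.target p) i ∉ L.Div →
      ∃ N, ∀ j, D.allowed p i j → D.active p i → j ≤ N :=
    fun p i _ => ⟨σ.length + 1, fun j hj _ => hj.2.2.2.1⟩
  have htr : ∀ p i j, D.allowed p i j → pre (D.target p) i ∈ L.Tr :=
    fun p i j hj => pre_mem_Tr_of_le hj.2.2.1 hj.2.1
  have hext : ∀ p i j, D.allowed p i (j + 1) → pre (D.target p) i ∈ L.divExt :=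
    fun p i j hj => pre_mem_divExt_of_le (hj.2.2.2.2.1 (by omega)) hj.1
  have hS' : D.Sound M' ∅ :=
    { append_mem := fun _ _ h => h.elim
      guard := fun p i j ⟨h1, h2, h3, h4, h5, h6⟩ hd => by
        rcases (h5 (by omega)).eq_or_lt with rfl | hlt
        · exact Or.inl h1
        · obtain rfl : j = σ.length := by have := h6 hlt; omega
          exact absurd (hdrive ▸ hd) hσ'
      bounded := hbounded
      early := fun p i => htr p i 0
      probed_pos := fun _ _ h => h
      probed_conv := fun _ _ _ h => h.elim
      offer_conv := fun _ _ _ _ _ h => h.elim }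
  have hS : D.Sound M L.divExt :=
    { append_mem := fun _ _ h => divExt_append h _
      guard := fun p i j hj _ => Or.inr (hext p i j hj)
      bounded := hbounded
      early := fun p i => htr p i 0
      probed_pos := fun _ _ h => h
      probed_conv := fun _ _ _ h => h.elim
      offer_conv := fun _ _ _ _ _ h => h.elim }
  have hInf : ∀ (N : LTS.{u, v} Act) (E : Set (List Act)), D.Sound N E →
      (D.sys N).Inf ⊆ L.Inf := by
    intro N E hN ζ hζ
    rcases Detour.mem_Inf_of_mem_Inf_sys hN hζ with h | ⟨p, -, j, hj, -⟩
    · exact h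
    · have := (hj p.2.2).2.2.1
      omega
  refine ⟨D.sys M, hr.detour h D hS' ?_ (hInf _ _ hS'), rfl, ?_,
    (hInf _ _ hS).antisymm Detour.Inf_subset, ?_⟩
  · rintro ⟨τ, A⟩ hf
    rcases Detour.mem_Sf_of_mem_Sf_sys hS' hf with h | ⟨p, i, j, m, rfl, hj, hτ, -⟩ |
      ⟨_, _, _, _, h⟩ | ⟨_, _, _, _, _, h, _⟩
    · exact h
    · exact hL _ (hτ.resolve_right (not_not_intro (htr p i _ hj))) hf.1
    · exact h.elim
    · exact h.elim
  · ext τ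
    constructor
    · intro hτ
      refine ⟨?_, (Detour.Div_sys_subset hS hτ).elim (fun h => Div_subset_divExt h) id⟩
      rcases Detour.mem_Tr_of_mem_Tr_sys hS (Div_subset_Tr hτ) with h | ⟨p, i, j, rfl, hj, -⟩
      · exact h
      · exact htr p i _ hj
    · rintro ⟨hτ, n, hn, hd⟩
      obtain ⟨c, hc, hc'⟩ := exists_code_list (L := L) d (mem_alphabet_of_mem_Tr hτ)
      have hτc : pre (c.word d) τ.length = τ := by simpa using hc _ le_rfl
      have hd' : pre (c.word d) n ∈ L.Div := by rwa [hc n hn]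
      rw [← hτc] at hτ
      obtain ⟨m, hm, q, hq, hq'⟩ := hσ
      rw [← hdrive] at hm
      have := Detour.reach_track (D := D) (p := (c, n, τ.length)) (l := τ.length) hm
        (fun i hi => ⟨hd', hτ, hi.trans hn, by omega, by omega,
          fun hlt => absurd hi (not_le.2 hlt)⟩)
        (fun j hj => ⟨hd', hτ, hn, by omega, fun _ => le_rfl, fun hlt => absurd hlt (lt_irrefl _)⟩)
        (fun i hi hi' => ⟨hd', hτ, hi', by omega, fun _ => hi, fun _ => rfl⟩) trivial hc' hn
      change (D.sys M).Reach _ (pre (c.word d) τ.length) _ at this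
      rw [hτc] at this
      exact ⟨_, this, fun i => (.track (c, n, τ.length) τ.length (σ.length + 1), some (q i)),
        hq ▸ rfl, fun i => .internal _ (hq' i)⟩
  · rintro ⟨τ, A⟩ hτ
    refine ⟨fun hf => ?_, fun hf => Detour.Sf_subset hf⟩
    rcases Detour.mem_Sf_of_mem_Sf_sys hS hf with h | ⟨p, i, j, m, rfl, hj, -⟩ |
      ⟨_, _, _, _, h⟩ | ⟨_, _, _, _, _, h, _⟩
    · exact h
    · exact absurd (hext p i j hj) hτ
    · exact h.elim
    · exact h.elim

/-- If a stable failure `(σ, B)` of `M` is not one of `M'` and `σ` is not a divergence trace of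
either, then failures can be added after nondivergent words, by probing the subprocess after `σ`.

If no prefix of `σ` is a divergence trace, then the subprocess can be launched anywhere. The letters
that lead to divergence are tied to the probe, because what happens after them is unobservable.
Otherwise the subprocess is launched where `L` may diverge. All letters are tied to the probe, and
`L` is resumed after them, because the subprocess does not diverge then. -/
theorem Admissible.exists_refusing (hr : Admissible r) {M M' : LTS.{u, v} Act} (h : r M M')
    {σ : List Act} {B : Set Act} (hB : (σ, B) ∈ M.Sf) (hB' : (σ, B) ∉ M'.Sf) (hσ : σ ∉ M.Div)
    (hσ' : σ ∉ M'.Div) (safe : Prop) (hsafe : safe → σ ∉ M.divExt ∧ σ ∉ M'.divExt)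
    (hsafe' : ¬ safe → ∀ b ∈ B, σ ++ [b] ∉ M.Div ∧ σ ++ [b] ∉ M'.Div) {L : LTS.{u, v} Act}
    (hL : L.Saturated) :
    ∃ L' : LTS.{u, v} Act, r L L' ∧ L'.alphabet = L.alphabet ∧ L'.Div = L.Div ∧ L'.Inf = L.Inf ∧
      ∀ f, f ∈ L'.Sf ↔ f ∈ L.Sf ∨ (f.2 ⊆ L.alphabet ∧ f.1 ∉ L.Div ∧ (¬ safe → f.1 ∈ L.divExt) ∧
        (f.1, {a ∈ f.2 | safe ∧ f.1 ++ [a] ∉ L.Div}) ∈ L.Sf) := by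
  obtain ⟨d⟩ := nonempty_act hr.not_small
  let D : Detour L :=
    { Index := L.Code × ℕ × ℕ
      target := fun p => p.1.word d
      drive := fun n => σ.getD n d
      allowed := fun p i j => (pre (p.1.word d) p.2.1 ∈ L.Div ∨ safe) ∧
        pre (p.1.word d) p.2.2 ∈ L.Tr ∧ pre (p.1.word d) p.2.2 ∉ L.Div ∧ p.2.1 ≤ p.2.2 ∧
        i ≤ p.2.2 ∧ j ≤ σ.length + 1 ∧ (0 < j → p.2.1 ≤ i) ∧ (p.2.1 < i → j = σ.length + 1)
      active := fun _ _ => True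
      probed := fun p i j => i = p.2.2 ∧ j = σ.length + 1
      tied := fun p i => {a | safe → pre (p.1.word d) i ++ [a] ∈ L.Div}
      offer := B }
  have hdrive : pre D.drive σ.length = σ := pre_getD_length σ d
  have htr : ∀ p i j, D.allowed p i j → pre (D.target p) i ∈ L.Tr :=
    fun p i j ⟨_, h2, _, _, h5, _⟩ => pre_mem_Tr_of_le h5 h2
  have hS : ∀ N : LTS.{u, v} Act, σ ∉ N.Div → (safe → σ ∉ N.divExt) →
      (¬ safe → ∀ b ∈ B, σ ++ [b] ∉ N.Div) → D.Sound N ∅ := fun N hN hN' hN'' =>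
    { append_mem := fun _ _ h => h.elim
      guard := by
        rintro p i j ⟨h1, h2, h3, h4, h5, h6, h7, h8⟩ hd
        left
        rcases h1 with h1 | hs
        · rcases (h7 (by omega)).eq_or_lt with rfl | hlt
          · exact h1
          · obtain rfl : j = σ.length := by have := h8 hlt; omega
            exact absurd (hdrive ▸ hd) hN
        · refine absurd hd (not_mem_divExt_of_pre (i := σ.length) (by omega) ?_)
          rw [hdrive]
          exact hN' hs
      bounded := fun p i _ => ⟨σ.length + 1, fun j ⟨_, _, _, _, _, h, _⟩ _ => h⟩
      early := fun p i => htr p i 0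
      probed_pos := fun p i h => by have := h.2; omega
      probed_conv := by
        rintro p i j ⟨-, hj⟩
        obtain rfl : j = σ.length := by omega
        rwa [hdrive]
      offer_conv := by
        rintro p i j a b ⟨-, hj⟩ ha hdiv hb
        obtain rfl : j = σ.length := by omega
        rw [hdrive]
        exact hN'' (fun hs => hdiv (ha hs)) b hb }
  have hS₁ := hS M hσ (fun h => (hsafe h).1) fun h b hb => (hsafe' h b hb).1
  have hS₂ := hS M' hσ' (fun h => (hsafe h).2) fun h b hb => (hsafe' h b hb).2
  have hInf : ∀ (N : LTS.{u, v} Act), D.Sound N ∅ → (D.sys N).Inf ⊆ L.Inf := by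
    intro N hN ζ hζ
    rcases Detour.mem_Inf_of_mem_Inf_sys hN hζ with h | ⟨p, -, j, hj, -⟩
    · exact h
    · obtain ⟨-, -, -, -, h5, -⟩ := hj p.2.2
      omega
  refine ⟨D.sys M, hr.detour h D hS₂ ?_ (hInf _ hS₂), rfl,
    Set.Subset.antisymm (fun σ h => (Detour.Div_sys_subset hS₁ h).elim id fun h => h.elim)
      Detour.Div_subset, (hInf _ hS₁).antisymm Detour.Inf_subset, ?_⟩
  · rintro ⟨τ, A⟩ hf
    rcases Detour.mem_Sf_of_mem_Sf_sys hS₂ hf with h' | ⟨p, i, j, m, rfl, hj, hτ, -⟩ |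
      ⟨h', -⟩ | ⟨p, i, j, m, rfl, ⟨-, hj⟩, -, -, hm, hst, href⟩
    · exact h'
    · exact hL _ (hτ.resolve_right (not_not_intro (htr p i _ hj))) hf.1
    · exact hL _ h' hf.1
    · obtain rfl : j = σ.length := by omega
      rw [hdrive] at hm
      exact absurd ⟨hr.alphabet _ _ h ▸ hB.1, m, hm, hst, href⟩ hB'
  · rintro ⟨τ, A⟩
    constructor
    · intro hf
      rcases Detour.mem_Sf_of_mem_Sf_sys hS₁ hf with h' | ⟨p, i, j, m, rfl, hj, hτ, -⟩ |
        ⟨h', -⟩ | ⟨p, i, j, m, rfl, ⟨hi, hj⟩, hal, hA, -⟩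
      · exact Or.inl h'
      · exact Or.inl (hL _ (hτ.resolve_right (not_not_intro (htr p i _ hj))) hf.1)
      · exact Or.inl (hL _ h' hf.1)
      · obtain ⟨h1, h2, h3, h4, h5, -⟩ := hal
        subst hi
        refine Or.inr ⟨hf.1, h3, fun hs => ?_, ?_⟩
        · exact pre_mem_divExt_of_le h4 (h1.resolve_right hs)
        · convert hA using 2
          ext a
          simp [D]
          tauto
    · rintro (h' | ⟨hA, hτ, hdiv, hf⟩)
      · exact Detour.Sf_subset h'
      · have hτTr : τ ∈ L.Tr := mem_Tr_of_mem_Sf hf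
        obtain ⟨-, s, hs, hst, href⟩ := hf
        obtain ⟨n, hn, hn'⟩ : ∃ n ≤ τ.length, τ.take n ∈ L.Div ∨ safe := by
          by_cases hsf : safe
          · exact ⟨0, by omega, Or.inr hsf⟩
          · obtain ⟨n, hn, hn'⟩ := hdiv hsf
            exact ⟨n, hn, Or.inl hn'⟩
        obtain ⟨c, hc, hc'⟩ := exists_code_list (L := L) d (mem_alphabet_of_mem_Tr hτTr)
        have hτc : pre (c.word d) τ.length = τ := by simpa using hc _ le_rfl
        rw [← hc n hn] at hn'
        rw [← hτc] at hτTr hτ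
        obtain ⟨-, m, hm, hmst, hmref⟩ := hB
        simp only at hm
        rw [← hdrive] at hm
        have := Detour.reach_track (D := D) (p := (c, n, τ.length)) (l := τ.length) hm
          (fun i hi => ⟨hn', hτTr, hτ, hn, hi.trans hn, by omega, by omega,
            fun hlt => absurd hi (not_le.2 hlt)⟩)
          (fun j hj => ⟨hn', hτTr, hτ, hn, hn, by omega, fun _ => le_rfl,
            fun hlt => absurd hlt (lt_irrefl _)⟩)
          (fun i hi hi' => ⟨hn', hτTr, hτ, hn, hi', by omega, fun _ => hi, fun _ => rfl⟩)
          trivial hc' hn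
        change (D.sys M).Reach _ (pre (c.word d) τ.length) _ at this
        have hprobe := this.snoc_tau (.alone _ (.probe (s := s) ⟨rfl, rfl⟩
          (by change L.Reach L.init (pre (c.word d) τ.length) s; rwa [hτc]) hst))
        rw [hτc] at hprobe
        refine ⟨hA, _, hprobe, fun q hq => ?_, fun a ha q hq => ?_⟩
        · change D.controller.Step M _ none q at hq
          generalize hx : none = x at hq
          cases hq with
          | alone d hq => cases hq; cases hx
          | sync hq _ => cases hq <;> cases hx
          | internal k hm => exact hmst _ (hx ▸ hm)
        · change D.controller.Step M _ (some a) q at hq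
          generalize hx : some a = x at hq
          cases hq with
          | alone d hq =>
            cases hq with
            | free hfree hq =>
              cases hx
              have hfree' : safe ∧ pre (c.word d) τ.length ++ [a] ∉ L.Div := by
                simpa [D] using hfree
              rw [hτc] at hfree'
              exact href a ⟨ha, hfree'⟩ _ hq
          | sync hq hm =>
            cases hq with
            | tied hb => exact hmref _ hb _ hm
            | dead hb => exact hmref _ hb _ hm
          | internal k hm => cases hx

end Saturation

section Saturation

variable {r : LTS.{u, v} Act → LTS.{u, v} Act → Prop}

/-- If infinite traces are not preserved then infinite words with infinitely many divergent prefixes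
can be added: the subprocess is driven along an infinite word `ν` in such a way that it makes
progress at divergent prefixes of the target only. Between these prefixes, it must rest after
prefixes of `ν` that are not divergence traces; `N` is a set of lengths of such prefixes. -/
theorem Admissible.exists_infinite (hr : Admissible r) {M M' : LTS.{u, v} Act} (h : r M M')
    {ν : ℕ → Act} (hν : ν ∈ M.Inf) (hν' : ν ∉ M'.Inf) (N : ℕ → Prop)
    (hN : ∀ j, N j → pre ν j ∉ M.Div ∧ pre ν j ∉ M'.Div) {L : LTS.{u, v} Act}
    (hL : L.Saturated) :
    ∃ L' : LTS.{u, v} Act, r L L' ∧ L'.alphabet = L.alphabet ∧ L'.Div = L.Div ∧ L'.Sf = L.Sf ∧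
      ∀ ξ, ξ ∈ L'.Inf ↔ ξ ∈ L.Inf ∨ ((∀ n, ∃ i ≥ n, pre ξ i ∈ L.Div) ∧
        ∃ n, (∀ j, ∃ j' ≥ j, N j') ∨ ∀ i ≥ n, pre ξ i ∈ L.Div) := by
  obtain ⟨d⟩ := nonempty_act hr.not_small
  -- The second component of an index bounds the number of letters that may be shown in terms of
  -- the progress of the subprocess. Hence an infinite run along a track drives it forever.
  let D : Detour L :=
    { Index := L.Code × (ℕ → ℕ)
      target := fun p => p.1.word d
      drive := ν
      allowed := fun p i j => ((∀ n, ∃ i ≥ n, pre (p.1.word d) i ∈ L.Div) ∧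
        ∃ n, (∀ j, ∃ j' ≥ j, N j') ∨ ∀ i ≥ n, pre (p.1.word d) i ∈ L.Div) ∧
        (j = 0 ∨ pre (p.1.word d) i ∈ L.Div ∨ N (j - 1)) ∧ i ≤ p.2 j
      active := fun p i => pre (p.1.word d) i ∈ L.Div
      probed := fun _ _ _ => False
      tied := fun _ _ => ∅
      offer := ∅ }
  have htr : ∀ p i j, D.allowed p i j → pre (D.target p) i ∈ L.Tr := by
    rintro p i j ⟨⟨h, -⟩, -⟩
    obtain ⟨n, hn, hd⟩ := h i
    exact pre_mem_Tr_of_le hn (Div_subset_Tr hd)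
  have hS : ∀ K : LTS.{u, v} Act, (∀ j, N j → pre ν j ∉ K.Div) → D.Sound K ∅ := fun K hK =>
    { append_mem := fun _ _ h => h.elim
      guard := fun p i j ⟨_, h, _⟩ hd => by
        rcases h with h | h | h
        · omega
        · exact Or.inl h
        · exact absurd hd (hK _ h)
      bounded := fun p i hi => ⟨0, fun j _ hact => absurd hact hi⟩
      early := fun p i => htr p i 0
      probed_pos := fun _ _ h => h
      probed_conv := fun _ _ _ h => h.elim
      offer_conv := fun _ _ _ _ _ h => h.elim }
  have hS₁ := hS M fun j hj => (hN j hj).1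
  have hS₂ := hS M' fun j hj => (hN j hj).2
  have hSf : ∀ K : LTS.{u, v} Act, D.Sound K ∅ → (D.sys K).Sf ⊆ L.Sf := by
    rintro K hK ⟨τ, A⟩ hf
    rcases Detour.mem_Sf_of_mem_Sf_sys hK hf with h | ⟨p, i, j, m, rfl, hj, hτ, -⟩ |
      ⟨_, _, _, _, h⟩ | ⟨_, _, _, _, _, h, _⟩
    · exact h
    · exact hL _ (hτ.resolve_right (not_not_intro (htr p i _ hj))) hf.1
    · exact h.elim
    · exact h.elim
  refine ⟨D.sys M, hr.detour h D hS₂ (hSf _ hS₂) ?_, rfl,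
    Set.Subset.antisymm (fun σ h => (Detour.Div_sys_subset hS₁ h).elim id fun h => h.elim)
      Detour.Div_subset, (hSf _ hS₁).antisymm Detour.Sf_subset, fun ξ => ⟨fun hξ => ?_, ?_⟩⟩
  · intro ζ hζ
    rcases Detour.mem_Inf_of_mem_Inf_sys hS₂ hζ with h | ⟨p, -, j, hj, -, hinf⟩
    · exact h
    · refine absurd (hinf fun J => ?_) hν'
      by_contra! hc
      have h1 := (hj ((Finset.range J).sup p.2)).2.2
      have h2 : p.2 (j ((Finset.range J).sup p.2)) ≤ (Finset.range J).sup p.2 :=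
        Finset.le_sup (Finset.mem_range.2 (hc _))
      omega
  · rcases Detour.mem_Inf_of_mem_Inf_sys hS₁ hξ with h | ⟨p, rfl, j, hj, -⟩
    · exact Or.inl h
    · exact Or.inr (hj 0).1
  · rintro (hξ | hξ)
    · exact Detour.Inf_subset hξ
    have hal : ∀ n, ξ n ∈ L.alphabet := by
      intro n
      obtain ⟨i, hi, hd⟩ := hξ.1 (n + 1)
      exact mem_alphabet_of_mem_Tr (pre_mem_Tr_of_le hi (Div_subset_Tr hd)) _ (by simp [pre_succ])
    obtain ⟨n₀, hn₀⟩ := hξ.2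
    obtain ⟨c, rfl⟩ := exists_code d (fun n => Or.inl (hal n))
    let R : ℕ → Prop := fun i => n₀ ≤ i ∧ pre (c.word d) i ∈ L.Div
    have hR : (Set.ofPred R).Infinite := by
      refine Set.infinite_of_forall_exists_gt fun n => ?_
      obtain ⟨i, hi, hd⟩ := hξ.1 (n + 1 + n₀)
      exact ⟨i, ⟨by omega, hd⟩, by omega⟩
    set f := Nat.nth R with hf
    have hfmono : StrictMono f := Nat.nth_strictMono hR
    have hfR : ∀ t, n₀ ≤ f t ∧ pre (c.word d) (f t) ∈ L.Div := Nat.nth_mem_of_infinite hR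
    obtain ⟨q, hq0, hq⟩ := hν
    have hal0 : ∀ i ≤ f 0, D.allowed (c, f) i 0 := fun i hi => ⟨hξ, Or.inl rfl, hi⟩
    have h0 := Detour.reach_track_zero (D := D) (M := M) hal0 fun i _ => hal i
    have h1 : (D.sys M).Reach (D.sys M).init (pre (c.word d) (f 0))
        (.track (c, f) (f 0) 1, some M.init) :=
      h0.snoc_tau (.launch (.launch ⟨hξ, Or.inr (Or.inl (hfR 0).2), hfmono.monotone zero_le_one⟩
        (hfR 0).2))
    refine mem_Inf_of_progress (fun x i => ∃ t j, t ≤ j ∧ i = f t ∧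
      x = (.track (c, f) i (j + 1), some (q j))) ?_ h1 ⟨0, 0, le_rfl, rfl, by rw [hq0]⟩
    rintro x _ ⟨t, j, htj, rfl, rfl⟩
    -- The subprocess is driven on to a place where it may rest until the next divergent prefix.
    obtain ⟨k, hk, hrest⟩ : ∃ k > 0, ∀ i ≥ f t, pre (c.word d) i ∈ L.Div ∨ N (j + k) := by
      rcases hn₀ with hn₀ | hn₀
      · obtain ⟨j', hj', hNj'⟩ := hn₀ (j + 1)
        refine ⟨j' - j, by omega, fun i _ => Or.inr ?_⟩
        rwa [Nat.add_sub_cancel' (by omega)]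
      · exact ⟨1, one_pos, fun i hi => Or.inl (hn₀ i ((hfR t).1.trans hi))⟩
    obtain ⟨n, hn⟩ := Nat.exists_eq_add_of_lt (hfmono (Nat.lt_add_one t))
    have h2 := Detour.reach_drive (D := D) (p := (c, f)) (i := f t) (reach_pre_of_steps hq j k)
      (fun l _ => ⟨hξ, Or.inr (Or.inl (hfR t).2), hfmono.monotone (by omega)⟩) (hfR t).2
    have h3 := Detour.reach_emit (D := D) (M := M) (p := (c, f)) (i := f t) (j := j + k + 1)
      (n := n + 1) (some (q (j + k))) fun l hl => ⟨⟨hξ, Or.inr (hrest _ (by omega)),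
        (by omega : f t + l + 1 ≤ f (t + 1)).trans (hfmono.monotone (by omega))⟩, hal _⟩
    exact ⟨_, n + 1, by omega, h2.append h3, t + 1, j + k, by omega, hn.symm, rfl⟩

end Saturation

/-! ### Observers -/

namespace Observer

/-- The control states of an observer: not launched, driving the subprocess before the signal, and
after the signal. The number counts the letters that the subprocess has read. -/
inductive Ctl : Type u
  | idle
  | before (j : ℕ)
  | after (j : ℕ)

variable (ν : ℕ → Act) (b : Act) (cut : Option ℕ) (halt : Prop)

/-- The signal `b` is given when the subprocess has read `n` letters, where `cut = some n`. If
`halt` holds then the observer diverges and repeats the signal afterwards. -/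
inductive Alone : Ctl.{u} → Option Act → Ctl.{u} → Prop
  | signal {n} : cut = some n → Alone (.before n) (some b) (.after n)
  | loop {j} : halt → Alone (.after j) none (.after j)
  | again {j} : halt → Alone (.after j) (some b) (.after j)

/-- The launch of the subprocess. If `cut = none` then there is no signal, and the observer starts
in the second phase. -/
inductive Launch : Ctl.{u} → Ctl.{u} → Prop
  | before {n} : cut = some n → Launch .idle (.before 0)
  | after : cut = none → Launch .idle (.after 0)

/-- The hidden moves that drive the subprocess along the word `ν`. -/
inductive Sync : Ctl.{u} → Act → Option Act → Ctl.{u} → Prop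
  | before {j} : Sync (.before j) (ν j) none (.before (j + 1))
  | after {j} : ¬ halt → Sync (.after j) (ν j) none (.after (j + 1))

end Observer

/-- A controller that drives an LTS invisibly along the word `ν` and signals when `cut` letters have
been read. -/
abbrev observer (ν : ℕ → Act) (b : Act) (cut : Option ℕ) (halt : Prop) :
    Controller.{u, v} Act where
  State := Observer.Ctl
  alphabet := {b}
  small_alphabet := small_single b
  alone := Observer.Alone b cut halt
  launch := Observer.Launch cut
  sync := Observer.Sync ν halt
  mem_of_alone := by
    intro k a k' h
    cases h <;> rfl
  mem_of_sync := by
    intro k c a k' h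
    cases h
  init := .idle

namespace Observer

variable {ν : ℕ → Act} {b : Act} {cut : Option ℕ} {halt : Prop} {M : LTS.{u, v} Act}

/-- The states of an observed LTS that can be reached by a given word. -/
inductive Inv (ν : ℕ → Act) (cut : Option ℕ) (M : LTS.{u, v} Act) :
    Ctl.{u} × Option M.State → List Act → Prop
  | idle : Inv ν cut M (.idle, none) []
  | before {j m} : cut ≠ none → M.Reach M.init (pre ν j) m → Inv ν cut M (.before j, some m) []
  | after {j m σ} : (∀ n, cut = some n → n ≤ j) → M.Reach M.init (pre ν j) m →
      Inv ν cut M (.after j, some m) σ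

theorem inv_of_reach {q : (observer.{u, v} ν b cut halt).State × Option M.State} {σ : List Act}
    (h : ((observer ν b cut halt).run M).Reach ((observer ν b cut halt).run M).init σ q) :
    Inv ν cut M q σ := by
  have := Reach.invariant (L := (observer ν b cut halt).run M) (I := Inv ν cut M) ?_ ?_ .idle h
  · simpa using this
  · intro q q' σ hq h
    change (observer ν b cut halt).Step M q none q' at h
    generalize hx : none = x at h
    cases h with
    | alone d h =>
      cases h with
      | signal => cases hx
      | loop => exact hq
      | again => cases hx
    | launch h =>
      cases hq
      cases h with
      | before hc => exact .before (by simp [hc]) (.refl _)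
      | after hc => exact .after (by simp [hc]) (.refl _)
    | sync h hm =>
      cases h with
      | before =>
        cases hq with
        | before hc hr => exact .before hc (by rw [pre_succ]; exact hr.snoc hm)
      | after =>
        cases hq with
        | after hc hr =>
          exact .after (fun n hn => (hc n hn).trans (by omega)) (by rw [pre_succ]; exact hr.snoc hm)
    | internal k hm =>
      cases hq with
      | before hc hr => exact .before hc (hr.snoc_tau hm)
      | after hc hr => exact .after hc (hr.snoc_tau hm)
  · intro q q' σ a hq h
    change (observer ν b cut halt).Step M q (some a) q' at h
    generalize hx : some a = x at h
    cases h with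
    | alone d h =>
      cases h with
      | signal hc =>
        cases hq with
        | before _ hr => exact .after (fun n hn => by simp_all) hr
      | loop => cases hx
      | again =>
        cases hq with
        | after hc hr => exact .after hc hr
    | launch h => cases hx
    | sync h hm => cases h <;> cases hx
    | internal k hm => cases hx

theorem reach_internal {m m' : M.State} (k : (observer.{u, v} ν b cut halt).State)
    (h : M.Reach m [] m') :
    ((observer ν b cut halt).run M).Reach (k, some m) [] (k, some m') := by
  generalize hw : [] = w at h
  induction h with
  | refl => exact .refl _
  | tau h _ ih =>
    exact .tau (Controller.Step.internal (C := observer ν b cut halt) k h) (ih hw)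
  | visible => cases hw

theorem reach_sync {m m' : M.State} {a : Act} {k k' : (observer.{u, v} ν b cut halt).State}
    (hk : Sync ν halt k a none k') (h : M.Reach m [a] m') :
    ((observer ν b cut halt).run M).Reach (k, some m) [] (k', some m') := by
  generalize hw : [a] = w at h
  induction h with
  | refl => cases hw
  | tau h _ ih =>
    exact .tau (Controller.Step.internal (C := observer ν b cut halt) k h) (ih hw)
  | visible h h' _ =>
    cases hw
    exact .tau (.sync hk h) (reach_internal _ h')

theorem reach_before {j : ℕ} {m : M.State} (hcut : cut ≠ none)
    (h : M.Reach M.init (pre ν j) m) :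
    ((observer.{u, v} ν b cut halt).run M).Reach ((observer ν b cut halt).run M).init []
      (.before j, some m) := by
  induction j generalizing m with
  | zero =>
    obtain ⟨n, hn⟩ := Option.ne_none_iff_exists'.1 hcut
    exact .tau (.launch (.before hn)) (reach_internal _ h)
  | succ j ih =>
    rw [pre_succ] at h
    obtain ⟨t, h1, h2⟩ := reach_append h
    exact (ih h1).append (reach_sync .before h2)

theorem pre_mem_Tr {n : ℕ} (h : [b] ∈ ((observer.{u, v} ν b (some n) halt).run M).Tr) :
    pre ν n ∈ M.Tr := by
  obtain ⟨q, hq⟩ := h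
  cases inv_of_reach hq with
  | after hc hr => exact pre_mem_Tr_of_le (hc n rfl) ⟨_, hr⟩

theorem reach_signal {n : ℕ} {m : M.State} (h : M.Reach M.init (pre ν n) m) :
    ((observer.{u, v} ν b (some n) halt).run M).Reach ((observer ν b (some n) halt).run M).init [b]
      (.after n, some m) :=
  (reach_before (by simp) h).append (.visible (.alone _ (.signal rfl)) (.refl _))

theorem signal_mem_Div {n : ℕ} (hh : halt) (h : pre ν n ∈ M.Tr) :
    [b] ∈ ((observer.{u, v} ν b (some n) halt).run M).Div := by
  obtain ⟨m, hm⟩ := h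
  exact ⟨_, reach_signal hm, fun _ => (.after n, some m), rfl, fun _ => .alone _ (.loop hh)⟩

theorem signals_mem_Inf {n : ℕ} (hh : halt) (h : pre ν n ∈ M.Tr) :
    (fun _ => b) ∈ ((observer.{u, v} ν b (some n) halt).run M).Inf := by
  obtain ⟨m, hm⟩ := h
  refine mem_Inf_of_progress (fun q _ => q = (.after n, some m)) ?_ (k₀ := 1) (reach_signal hm) rfl
  rintro _ k rfl
  exact ⟨_, 1, one_pos, .visible (.alone _ (.again hh)) (.refl _), rfl⟩

/-- If the observed LTS can read all of `ν` then the observer diverges in its second phase. -/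
theorem diverges_after {p : ℕ → M.State} (hp : ∀ n, M.Reach (p n) [ν n] (p (n + 1))) (hh : ¬ halt)
    (j : ℕ) : ((observer.{u, v} ν b cut halt).run M).Diverges (.after j, some (p j)) := by
  refine diverges_of_forall (I := fun q => ∃ j m, q = (.after j, some m) ∧
    M.Reach m [ν j] (p (j + 1))) ?_ ⟨j, p j, rfl, hp j⟩
  rintro _ ⟨j, m, rfl, hm⟩
  generalize hw : [ν j] = w at hm
  cases hm with
  | refl => cases hw
  | tau h h' =>
    subst hw
    exact ⟨_, .internal _ h, j, _, rfl, h'⟩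
  | visible h h' =>
    cases hw
    exact ⟨_, .sync (.after hh) h, j + 1, _, rfl, by simpa using h'.append (hp (j + 1))⟩

theorem nil_mem_Div (hh : ¬ halt) (h : ν ∈ M.Inf) :
    [] ∈ ((observer.{u, v} ν b none halt).run M).Div := by
  obtain ⟨p, hp0, hp⟩ := h
  exact ⟨_, .tau (.launch (.after rfl)) (.refl _), hp0 ▸ diverges_after hp hh 0⟩

theorem signal_mem_Div_of_mem_Inf (n : ℕ) (hh : ¬ halt) (h : ν ∈ M.Inf) :
    [b] ∈ ((observer.{u, v} ν b (some n) halt).run M).Div := by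
  obtain ⟨p, hp0, hp⟩ := h
  have := reach_pre_of_steps hp 0 n
  simp only [hp0, Nat.zero_add] at this
  exact ⟨_, reach_signal this, diverges_after hp hh n⟩

/-- A divergence in the second phase is a divergence of the observed LTS after a prefix of `ν`, or
it is due to reading all of `ν`. -/
theorem of_diverges_after {j : ℕ} {m : M.State} (hm : M.Reach M.init (pre ν j) m) (hh : ¬ halt)
    (h : ((observer.{u, v} ν b cut halt).run M).Diverges (.after j, some m)) :
    (∃ i ≥ j, pre ν i ∈ M.Div) ∨ ν ∈ M.Inf := by
  refine or_iff_not_imp_left.2 fun hdiv => ?_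
  push Not at hdiv
  refine mem_Inf_of_progress (fun m i => j ≤ i ∧ M.Reach M.init (pre ν i) m ∧
    ((observer.{u, v} ν b cut halt).run M).Diverges (.after i, some m)) ?_ hm ⟨le_rfl, hm, h⟩
  rintro m i ⟨hji, hm, hd⟩
  have hc : M.Converges m := converges_of_not_mem_Div hm (hdiv i hji)
  have key : ∃ m', M.Reach m [ν i] m' ∧
      ((observer.{u, v} ν b cut halt).run M).Diverges (.after (i + 1), some m') := by
    clear hm
    induction hc with
    | intro m _ ih =>
      obtain ⟨p, hp0, hp⟩ := hd
      have h1 := hp 0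
      rw [hp0] at h1
      have hd' : ((observer.{u, v} ν b cut halt).run M).Diverges (p 1) :=
        ⟨fun n => p (n + 1), rfl, fun n => hp (n + 1)⟩
      rw [Nat.zero_add] at h1
      generalize p 1 = q at h1 hd'
      change (observer ν b cut halt).Step M _ none q at h1
      generalize hx : none = x at h1
      cases h1 with
      | alone d h =>
        cases h with
        | loop h => exact absurd h hh
        | again h => exact absurd h hh
      | sync h hm =>
        cases h with
        | after => exact ⟨_, .visible hm (.refl _), hd'⟩
      | internal k hm =>
        obtain ⟨m', h1, h2⟩ := ih _ hm hd'
        exact ⟨m', .tau hm h1, h2⟩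
  obtain ⟨m', h1, h2⟩ := key
  refine ⟨m', 1, one_pos, by simpa [pre_succ] using h1, by omega, ?_, h2⟩
  rw [pre_succ]
  exact hm.append h1

theorem of_nil_mem_Div (hh : ¬ halt) (h : [] ∈ ((observer.{u, v} ν b none halt).run M).Div) :
    (∃ i, pre ν i ∈ M.Div) ∨ ν ∈ M.Inf := by
  obtain ⟨cut, hcut⟩ : ∃ cut : Option ℕ, cut = none := ⟨none, rfl⟩
  rw [← hcut] at h
  have key : ∀ j m, M.Reach M.init (pre ν j) m →
      ((observer.{u, v} ν b cut halt).run M).Diverges (.after j, some m) →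
      (∃ i, pre ν i ∈ M.Div) ∨ ν ∈ M.Inf :=
    fun j m hm hd => (of_diverges_after hm hh hd).imp_left fun ⟨i, _, hi⟩ => ⟨i, hi⟩
  obtain ⟨q, hq, hd⟩ := h
  cases inv_of_reach hq with
  | idle =>
    obtain ⟨p, hp0, hp⟩ := hd
    have h1 := hp 0
    rw [hp0, Nat.zero_add] at h1
    have hd' : ((observer.{u, v} ν b cut halt).run M).Diverges (p 1) :=
      ⟨fun n => p (n + 1), rfl, fun n => hp (n + 1)⟩
    have hlaunch : ∀ q, ((observer.{u, v} ν b cut halt).run M).trans (.idle, none) none q →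
        q = (.after 0, some M.init) := by
      intro q h1
      change (observer ν b cut halt).Step M _ none q at h1
      generalize hx : none = x at h1
      cases h1 with
      | alone d h => cases h
      | launch h =>
        cases h with
        | after => rfl
        | before h => simp [hcut] at h
      | sync => cases hx
      | internal => cases hx
    rw [hlaunch _ h1] at hd'
    exact key _ _ (.refl _) hd'
  | before hc => exact absurd hcut hc
  | after _ hr => exact key _ _ hr hd

theorem of_signal_mem_Div {n : ℕ} (hh : ¬ halt)
    (h : [b] ∈ ((observer.{u, v} ν b (some n) halt).run M).Div) :
    (∃ i ≥ n, pre ν i ∈ M.Div) ∨ ν ∈ M.Inf := by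
  obtain ⟨q, hq, hd⟩ := h
  cases inv_of_reach hq with
  | after hc hr =>
    exact (of_diverges_after hr hh hd).imp_left fun ⟨i, hi, hi'⟩ => ⟨i, (hc n rfl).trans hi, hi'⟩

end Observer

/-! ### Preservation -/

section Preservation

variable {r : LTS.{u, v} Act → LTS.{u, v} Act → Prop}

/-- A visible action `a` belongs to the alphabet of `L` if and only if the initial state of `b.L`
has a stable failure that refuses `a`, for `b` outside of the alphabet. -/
theorem alphabet_eq_of_preserves_sanF (hAct : ¬ Small.{u} Act) (hr : IsCongruence r)
    (h : Preserves r sanF) (L L' : LTS.{u, v} Act) (hL : r L L') : L.alphabet = L'.alphabet := by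
  have key : ∀ L L' : LTS.{u, v} Act, r L L' → L.alphabet ⊆ L'.alphabet := by
    intro L L' hL a ha
    obtain ⟨b, hb⟩ : ∃ b, b ∉ L.alphabet := by
      by_contra! hc
      rw [← Set.eq_univ_iff_forall] at hc
      exact hAct (small_univ_iff.1 (hc ▸ L.small_alphabet))
    have hab : a ≠ b := fun h => hb (h ▸ ha)
    have hnone : ∀ x q, (L.actionPrefix b).trans none x q → x = some b := by
      rintro x q (⟨t, _, ht, -⟩ | ⟨-, hx, -⟩)
      · cases ht
      · exact hx
    have hfirst : ∀ q σ, (L.actionPrefix b).Reach (L.actionPrefix b).init σ q →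
        (σ = [] ∧ q = none) ∨ ∃ τ, σ = b :: τ := by
      intro q σ hq
      generalize hs : (L.actionPrefix b).init = s at hq
      cases hq with
      | refl => exact Or.inl ⟨rfl, hs.symm⟩
      | tau h =>
        subst hs
        cases hnone _ _ h
      | visible h =>
        subst hs
        cases hnone _ _ h
        exact Or.inr ⟨_, rfl⟩
    have hnil : [] ∉ (L.actionPrefix b).Div := by
      rintro ⟨q, hq, p, hp0, hp⟩
      have h1 := hp 0
      rw [hp0] at h1
      rcases hfirst _ _ hq with ⟨-, rfl⟩ | ⟨τ, hτ⟩
      · cases hnone _ _ h1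
      · cases hτ
    have hmem : ([], {a}) ∈ (L.actionPrefix b).sanF := by
      refine ⟨⟨⟨?_, none, .refl _, fun q hq => ?_, fun c hc q hq => ?_⟩, ?_⟩, ?_⟩
      · rintro c rfl
        exact Or.inr ha
      · cases hnone _ _ hq
      · cases hnone _ _ hq
        exact hab hc.symm
      · rintro ⟨-, i, hi, hm⟩
        simp only [List.take_nil] at hm
        exact hnil hm.1
      · rintro c hc ⟨⟨q, hq, -⟩, -⟩
        obtain rfl : c = a := hc
        rcases hfirst _ _ hq with ⟨h, -⟩ | ⟨τ, hτ⟩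
        · cases h
        · cases hτ
          exact hab rfl
    rw [h _ _ (hr.actionPrefix b _ _ hL)] at hmem
    exact (hmem.1.1.1 rfl).resolve_left hab
  exact (key L L' hL).antisymm (key L' L (hr.equivalence.symm hL))

theorem Admissible.preserves_of_subset (hr : Admissible r) {β : Type*}
    {X : LTS.{u, v} Act → Set β} (h : ∀ L L', r L L' → X L ⊆ X L') : Preserves r X :=
  fun L L' hL => (h L L' hL).antisymm (h L' L (hr.congruence.equivalence.symm hL))

theorem Admissible.exists_of_not_preserves (hr : Admissible r) {β : Type*}
    {X : LTS.{u, v} Act → Set β} (h : ¬ Preserves r X) :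
    ∃ M M' x, r M M' ∧ x ∈ X M ∧ x ∉ X M' := by
  by_contra! hc
  exact h (hr.preserves_of_subset fun L L' hL x hx => hc L L' x hL hx)

theorem Admissible.preserves_run (hr : Admissible r) {β : Type*} {X : LTS.{u, v} Act → β}
    (h : Preserves r X) (C : Controller.{u, v} Act) {L L' : LTS.{u, v} Act} (hL : r L L') :
    X (C.run L) = X (C.run L') :=
  h _ _ (hr.congruence.run hr.not_small C (hr.alphabet _ _ hL) hL)

theorem Admissible.preserves_Tr_of_Div (hr : Admissible r) (h : Preserves r Div) :
    Preserves r Tr := by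
  obtain ⟨b⟩ := nonempty_act hr.not_small
  refine hr.preserves_of_subset fun L L' hL σ hσ => ?_
  rw [← pre_getD_length σ b] at hσ ⊢
  have h1 := Observer.signal_mem_Div (b := b) trivial hσ
  rw [hr.preserves_run h _ hL] at h1
  exact Observer.pre_mem_Tr (Div_subset_Tr h1)

theorem Admissible.preserves_Tr_of_Inf (hr : Admissible r) (h : Preserves r Inf) :
    Preserves r Tr := by
  obtain ⟨b⟩ := nonempty_act hr.not_small
  refine hr.preserves_of_subset fun L L' hL σ hσ => ?_
  rw [← pre_getD_length σ b] at hσ ⊢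
  have h1 := Observer.signals_mem_Inf (b := b) trivial hσ
  rw [hr.preserves_run h _ hL] at h1
  exact Observer.pre_mem_Tr (b := b) (by simpa [pre_succ] using pre_mem_Tr_of_mem_Inf h1 1)

/-- If traces are not preserved then there are related LTSs such that a divergence trace of one is
not even a trace of the other: an observer diverges as soon as it sees the trace. -/
theorem Admissible.exists_Div_of_not_preserves_Tr (hr : Admissible r) (h : ¬ Preserves r Tr) :
    ∃ M M' σ, r M M' ∧ σ ∈ M.Div ∧ σ ∉ M'.Tr := by
  obtain ⟨b⟩ := nonempty_act hr.not_small
  obtain ⟨M, M', σ, hM, hσ, hσ'⟩ := hr.exists_of_not_preserves h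
  rw [← pre_getD_length σ b] at hσ hσ'
  exact ⟨_, _, [b], hr.congruence.run hr.not_small (observer _ b (some σ.length) True)
    (hr.alphabet _ _ hM) hM, Observer.signal_mem_Div trivial hσ,
    fun h => hσ' (Observer.pre_mem_Tr h)⟩

theorem preserves_minD_of_Div (h : Preserves r Div) : Preserves r minD :=
  fun L L' hL => by simp only [minD, h L L' hL]

theorem extT_congr {L L' : LTS.{u, v} Act} (hal : L.alphabet = L'.alphabet)
    (h : L.minD = L'.minD) : L.extT = L'.extT := by
  simp only [extT, hal, h]

theorem extI_congr {L L' : LTS.{u, v} Act} (hal : L.alphabet = L'.alphabet)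
    (h : L.minD = L'.minD) : L.extI = L'.extI := by
  simp only [extI, hal, h]

/-- An observer that drives an LTS along an always nondivergent infinite word diverges initially, by
reading the whole word, if and only if the word is an infinite trace of that LTS. -/
theorem Admissible.preserves_anI (hr : Admissible r) (h : Preserves r minD) :
    Preserves r anI := by
  obtain ⟨b⟩ := nonempty_act hr.not_small
  refine hr.preserves_of_subset fun L L' hL ξ hξ => ?_
  have hext := extI_congr (hr.alphabet _ _ hL) (h _ _ hL)
  have hξ' : ξ ∉ L'.extI := hext ▸ hξ.2
  refine ⟨?_, hξ'⟩
  have h1 := nil_mem_minD_iff.2 (Observer.nil_mem_Div (b := b) not_false hξ.1)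
  rw [hr.preserves_run h _ hL] at h1
  refine (Observer.of_nil_mem_Div not_false (nil_mem_minD_iff.1 h1)).resolve_left fun hd => ?_
  refine hξ' (mem_extI_iff.2 ⟨fun n => ?_, hd⟩)
  rw [← hr.alphabet _ _ hL]
  exact mem_alphabet_of_mem_Tr (pre_mem_Tr_of_mem_Inf hξ.1 (n + 1)) _ (by simp [pre_succ])

/-- If no prefix of the infinite word `ξ` of length at least `n` is a divergence trace, an observer
that gives a signal after `n` letters of `ξ` diverges after the signal only by reading all of `ξ`. -/
theorem Admissible.preserves_eanI (hr : Admissible r) (h : Preserves r Div) :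
    Preserves r eanI := by
  obtain ⟨b⟩ := nonempty_act hr.not_small
  refine hr.preserves_of_subset fun L L' hL ξ hξ => ?_
  obtain ⟨hξ, n, hn⟩ := hξ
  rw [h _ _ hL] at hn
  refine ⟨?_, n, hn⟩
  have h1 := Observer.signal_mem_Div_of_mem_Inf (b := b) n not_false hξ
  rw [hr.preserves_run h _ hL] at h1
  exact (Observer.of_signal_mem_Div not_false h1).resolve_left fun ⟨i, hi, hd⟩ => hn i hi hd

end Preservation

/-! ### Normal forms -/

section NormalForms

variable {r : LTS.{u, v} Act → LTS.{u, v} Act → Prop} {L : LTS.{u, v} Act}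

theorem Sf_mono {σ : List Act} {A B : Set Act} (h : (σ, A) ∈ L.Sf) (hBA : B ⊆ A) :
    (σ, B) ∈ L.Sf :=
  ⟨hBA.trans h.1, h.2.imp fun _ hs => ⟨hs.1, hs.2.1, fun a ha => hs.2.2 a (hBA ha)⟩⟩

theorem divExt_congr {L L' : LTS.{u, v} Act} (h : L.Div = L'.Div) : L.divExt = L'.divExt := by
  simp only [divExt, h]

theorem minD_congr {L L' : LTS.{u, v} Act} (h : L.Div = L'.Div) : L.minD = L'.minD := by
  simp only [minD, h]

theorem mem_Div_of_snoc_mem_divExt {σ : List Act} {a : Act} (hσ : σ ∉ L.divExt)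
    (h : σ ++ [a] ∈ L.divExt) : σ ++ [a] ∈ L.Div := by
  obtain ⟨i, hi, hd⟩ := h
  rcases (by simpa using hi : i ≤ σ.length + 1).eq_or_lt with rfl | hlt
  · rwa [List.take_of_length_le (by simp)] at hd
  · rw [List.take_append_of_le_length (by omega)] at hd
    exact absurd ⟨i, by omega, hd⟩ hσ

theorem Tr_inter_divExt : L.Tr ∩ L.divExt = L.Tr ∩ L.extT :=
  Set.ext fun _ => and_congr_right fun h => (mem_extT_iff_of_mem_Tr h).symm

/-- The failures that are determined by the strongly always nondivergent failures, if everything is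
refused after the words in `W` and letters leading to a minimal divergence trace are refused
freely. -/
def failureForm (L : LTS.{u, v} Act) (W : Set (List Act)) : Set (List Act × Set Act) :=
  {f | f.2 ⊆ L.alphabet ∧ (f.1 ∈ W ∨ (f.1, {a ∈ f.2 | f.1 ++ [a] ∉ L.minD}) ∈ L.sanF)}

theorem failureForm_congr {L L' : LTS.{u, v} Act} {W W' : Set (List Act)}
    (hal : L.alphabet = L'.alphabet) (hmin : L.minD = L'.minD) (hsan : L.sanF = L'.sanF)
    (hW : W = W') : L.failureForm W = L'.failureForm W' := by
  simp only [failureForm, hal, hmin, hsan, hW]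

theorem Admissible.trans (hr : Admissible r) {L L' L'' : LTS.{u, v} Act} (h : r L L')
    (h' : r L' L'') : r L L'' :=
  hr.congruence.equivalence.trans h h'

/-- Two LTSs are related if they are related to LTSs with the same normal form. -/
theorem Admissible.of_normal_forms (hr : Admissible r) {L L' K K' : LTS.{u, v} Act} (h : r L K)
    (h' : r L' K') (hal : K.alphabet = K'.alphabet) (hSf : K.Sf = K'.Sf) (hDiv : K.Div = K'.Div)
    (hInf : K.Inf = K'.Inf) : r L L' :=
  hr.trans h (hr.trans (hr.of_cffd _ _ ⟨hal, hSf, hDiv, hInf⟩)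
    (hr.congruence.equivalence.symm h'))

/-- If always nondivergent failures are not preserved, then an LTS `K` related to `L` can be changed
so that its failures are in the form determined by the strongly always nondivergent failures of
`L`. -/
theorem Admissible.exists_failureForm (hr : Admissible r) (hmin : Preserves r minD)
    (hanF : ¬ Preserves r anF) {L K : LTS.{u, v} Act} (hLK : r L K) {W : Set (List Act)}
    (hsat : K.Saturated) (hDiv : L.Div ⊆ K.Div) (hDiv' : K.Div ⊆ L.divExt)
    (hW : ∀ f : List Act × Set Act, f.1 ∈ W → f.2 ⊆ L.alphabet → f ∈ K.Sf)
    (hW' : ∀ f ∈ K.Sf, f.1 ∈ L.divExt → f.1 ∈ W)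
    (hout : ∀ f : List Act × Set Act, f.1 ∉ L.divExt → (f ∈ K.Sf ↔ f ∈ L.Sf)) :
    ∃ K' : LTS.{u, v} Act, r L K' ∧ K'.alphabet = L.alphabet ∧ K'.Div = K.Div ∧ K'.Inf = K.Inf ∧
      K'.Sf = L.failureForm W := by
  obtain ⟨M, M', ⟨σ, B⟩, hM, hB, hB'⟩ := hr.exists_of_not_preserves hanF
  have hσ : σ ∉ M.divExt := fun h => hB.2 ((mem_extT_iff_of_mem_Tr (mem_Tr_of_mem_Sf hB.1)).2 h)
  have hext := extT_congr (hr.alphabet _ _ hM) (hmin _ _ hM)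
  have hσ' : σ ∉ M'.divExt := by
    intro h
    refine hB.2 (hext ▸ mem_extT_iff.2 ⟨?_, h⟩)
    rw [← hr.alphabet _ _ hM]
    exact mem_alphabet_of_mem_Tr (mem_Tr_of_mem_Sf hB.1)
  have hB'' : (σ, B) ∉ M'.Sf := fun h => hB' ⟨h, hext ▸ hB.2⟩
  obtain ⟨K', h1, h2, h3, h4, h5⟩ := hr.exists_refusing hM hB.1 hB''
    (fun h => hσ (Div_subset_divExt h)) (fun h => hσ' (Div_subset_divExt h)) True
    (fun _ => ⟨hσ, hσ'⟩) (fun h => absurd trivial h) hsat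
  have hal := hr.alphabet _ _ hLK
  refine ⟨K', hr.trans hLK h1, h2.trans hal.symm, h3, h4, ?_⟩
  ext ⟨τ, A⟩
  rw [h5, ← hal]
  by_cases hτW : τ ∈ W
  · refine ⟨fun h => ⟨?_, Or.inl hτW⟩, fun h => Or.inl (hW _ hτW h.1)⟩
    rcases h with h | h
    · exact hal ▸ h.1
    · exact h.1
  by_cases hτ : τ ∈ L.divExt
  · refine ⟨fun h => absurd ?_ hτW, fun h => ?_⟩
    · rcases h with h | h
      · exact hW' _ h hτ
      · exact hW' _ h.2.2.2 hτ
    · have h' := (h.2.resolve_left hτW).1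
      exact absurd ((mem_extT_iff_of_mem_Tr (mem_Tr_of_mem_Sf h'.1)).2 hτ) h'.2
  · have hτK : τ ∉ K.Div := fun h => hτ (hDiv' h)
    have hset : {a ∈ A | True ∧ τ ++ [a] ∉ K.Div} = {a ∈ A | τ ++ [a] ∉ L.minD} := by
      ext a
      simp only [true_and, Set.mem_sep_iff, and_congr_right_iff, not_iff_not]
      exact fun _ => ⟨fun h => mem_minD_of_mem_Div hτ (mem_Div_of_snoc_mem_divExt hτ (hDiv' h)),
        fun h => hDiv h.1⟩
    simp only [hset]
    rw [hout _ hτ, hout _ hτ]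
    have hsan : (τ, {a ∈ A | τ ++ [a] ∉ L.minD}) ∈ L.sanF ↔
        (τ, {a ∈ A | τ ++ [a] ∉ L.minD}) ∈ L.Sf :=
      ⟨fun h => h.1.1, fun h => ⟨⟨h, fun h' => hτ (mem_extT_iff.1 h').2⟩, fun a ha => ha.2⟩⟩
    constructor
    · rintro (h | h)
      · exact ⟨h.1, Or.inr (hsan.2 (Sf_mono h (Set.sep_subset _ _)))⟩
      · exact ⟨h.1, Or.inr (hsan.2 h.2.2.2)⟩
    · exact fun h => Or.inr ⟨h.1, hτK, fun h' => absurd trivial h',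
        hsan.1 (h.2.resolve_left hτW)⟩

/-- The normal form if traces are not preserved: everything is possible after a minimal divergence
trace. -/
theorem Admissible.exists_normal_form_chaotic (hr : Admissible r) (hlock : r livelock bothlock)
    (hmin : Preserves r minD) (hTr : ¬ Preserves r Tr) (hanF : ¬ Preserves r anF)
    (L : LTS.{u, v} Act) :
    ∃ K : LTS.{u, v} Act, r L K ∧ K.alphabet = L.alphabet ∧ K.Div = L.extT ∧
      K.Inf = L.anI ∪ L.extI ∧ K.Sf = L.failureForm L.extT := by
  obtain ⟨M, M', σ, hM, hσ, hσ'⟩ := hr.exists_Div_of_not_preserves_Tr hTr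
  obtain ⟨L₁, r₁, al₁, Div₁, Inf₁, Sf₁⟩ := hr.exists_saturated hlock L
  have sat₁ : L₁.Saturated := fun f h h' => (Sf₁ f).2 (Or.inr ⟨Div₁ ▸ h, al₁ ▸ h'⟩)
  obtain ⟨L₂, r₂, al₂, Div₂, Inf₂, Sf₂⟩ := hr.exists_chaotic hM hσ hσ' sat₁
  rw [extT_congr al₁ (minD_congr Div₁)] at Div₂ Sf₂
  rw [Inf₁, extI_congr al₁ (minD_congr Div₁)] at Inf₂
  obtain ⟨L₃, r₃, al₃, Div₃, Inf₃, Sf₃⟩ := hr.exists_saturated hlock L₂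
  have sat₃ : L₃.Saturated := fun f h h' => (Sf₃ f).2 (Or.inr ⟨Div₃ ▸ h, al₃ ▸ h'⟩)
  have al : L₃.alphabet = L.alphabet := al₃.trans (al₂.trans al₁)
  rw [Div₂] at Div₃ Sf₃
  obtain ⟨K, h1, h2, h3, h4, h5⟩ := hr.exists_failureForm hmin hanF
    (hr.trans r₁ (hr.trans r₂ r₃)) (W := L.extT) sat₃
    (fun τ h => Div₃ ▸ (mem_extT_iff_of_mem_Tr (Div_subset_Tr h)).2 (Div_subset_divExt h))
    (fun τ h => (mem_extT_iff.1 (Div₃ ▸ h)).2)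
    (fun f h h' => sat₃ f (Div₃ ▸ h) (al ▸ h'))
    (fun f h h' => mem_extT_iff.2 ⟨al ▸ mem_alphabet_of_mem_Tr (mem_Tr_of_mem_Sf h), h'⟩)
    (fun f h => by
      have hext : f.1 ∉ L.extT := fun h' => h (mem_extT_iff.1 h').2
      rw [Sf₃, or_iff_left fun h' => hext h'.1, Sf₂ f hext, Sf₁,
        or_iff_left fun h' => h (Div_subset_divExt h'.1)])
  refine ⟨K, h1, h2, h3.trans Div₃, ?_, h5⟩
  ext ξ
  rw [h4, Inf₃, Inf₂]
  constructor
  · rintro (h | h)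
    · by_cases h' : ξ ∈ L.extI
      · exact Or.inr h'
      · exact Or.inl ⟨h, h'⟩
    · exact Or.inr h
  · exact Or.imp_left fun h => h.1

/-- If divergence traces are not preserved, an LTS is related to one that diverges and refuses
everything after all its traces that have a divergent prefix. -/
theorem Admissible.exists_divExt_saturated (hr : Admissible r) (hlock : r livelock bothlock)
    (hTr : Preserves r Tr) (hDiv : ¬ Preserves r Div) (L : LTS.{u, v} Act) :
    ∃ K : LTS.{u, v} Act, r L K ∧ K.Div = L.Tr ∩ L.divExt ∧ K.Inf = L.Inf ∧ K.Saturated ∧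
      ∀ f : List Act × Set Act, f.1 ∉ L.divExt → (f ∈ K.Sf ↔ f ∈ L.Sf) := by
  obtain ⟨M, M', σ, hM, hσ, hσ'⟩ := hr.exists_of_not_preserves hDiv
  obtain ⟨L₁, r₁, al₁, Div₁, Inf₁, Sf₁⟩ := hr.exists_saturated hlock L
  have sat₁ : L₁.Saturated := fun f h h' => (Sf₁ f).2 (Or.inr ⟨Div₁ ▸ h, al₁ ▸ h'⟩)
  obtain ⟨L₂, r₂, al₂, Div₂, Inf₂, Sf₂⟩ := hr.exists_divExt_divergent hM hσ hσ' sat₁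
  rw [divExt_congr Div₁] at Div₂ Sf₂
  rw [← hTr _ _ r₁] at Div₂
  obtain ⟨L₃, r₃, al₃, Div₃, Inf₃, Sf₃⟩ := hr.exists_saturated hlock L₂
  refine ⟨L₃, hr.trans r₁ (hr.trans r₂ r₃), Div₃.trans Div₂, Inf₃.trans (Inf₂.trans Inf₁),
    fun f h h' => (Sf₃ f).2 (Or.inr ⟨Div₃ ▸ h, al₃ ▸ h'⟩), fun f h => ?_⟩
  rw [Sf₃, Div₂, or_iff_left fun h' => h h'.1.2, Sf₂ f h, Sf₁,
    or_iff_left fun h' => h (Div_subset_divExt h'.1)]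

/-- The normal form of failures for an LTS that diverges and refuses everything after all its traces
that have a divergent prefix. -/
theorem Admissible.exists_normal_form_divExt (hr : Admissible r) (hmin : Preserves r minD)
    (hTr : Preserves r Tr) (hanF : ¬ Preserves r anF) {L L₁ : LTS.{u, v} Act} (r₁ : r L L₁)
    (Div₁ : L₁.Div = L.Tr ∩ L.divExt) (sat₁ : L₁.Saturated)
    (Sf₁ : ∀ f : List Act × Set Act, f.1 ∉ L.divExt → (f ∈ L₁.Sf ↔ f ∈ L.Sf)) :
    ∃ K : LTS.{u, v} Act, r L K ∧ K.alphabet = L.alphabet ∧ K.Div = L.Tr ∩ L.extT ∧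
      K.Inf = L₁.Inf ∧ K.Sf = L.failureForm (L.Tr ∩ L.extT) := by
  have al₁ := hr.alphabet _ _ r₁
  obtain ⟨K, h1, h2, h3, h4, h5⟩ := hr.exists_failureForm hmin hanF r₁ (W := L.Tr ∩ L.divExt) sat₁
    (fun τ h => Div₁ ▸ ⟨Div_subset_Tr h, Div_subset_divExt h⟩)
    (fun τ h => (Div₁ ▸ h : τ ∈ L.Tr ∩ L.divExt).2)
    (fun f h h' => sat₁ f (Div₁ ▸ h) (al₁ ▸ h'))
    (fun f h h' => ⟨hTr _ _ r₁ ▸ mem_Tr_of_mem_Sf h, h'⟩) Sf₁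
  rw [Div₁, Tr_inter_divExt] at h3
  rw [Tr_inter_divExt] at h5
  exact ⟨K, h1, h2, h3, h4, h5⟩

/-- The normal form of failures if divergence traces are preserved and strongly nondivergent
failures are not. -/
theorem Admissible.exists_normal_form_Div (hr : Admissible r) (hDiv : Preserves r Div)
    (hanF : ¬ Preserves r anF) (hsnF : ¬ Preserves r snF) {L L₁ : LTS.{u, v} Act} (r₁ : r L L₁)
    (sat₁ : L₁.Saturated)
    (Sf₁ : ∀ f : List Act × Set Act, f.1 ∉ L.divExt → (f ∈ L₁.Sf ↔ f ∈ L.Sf)) :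
    ∃ K : LTS.{u, v} Act, r L K ∧ K.alphabet = L.alphabet ∧ K.Div = L.Div ∧
      K.Inf = L₁.Inf ∧ K.Sf = L.failureForm (L.Tr ∩ L.extT) := by
  have hTr := hr.preserves_Tr_of_Div hDiv
  have al₁ := hr.alphabet _ _ r₁
  have Div₁ := hDiv _ _ r₁
  obtain ⟨M, M', ⟨σ, B⟩, hM, ⟨⟨hB, hσ⟩, hBσ⟩, hB'⟩ := hr.exists_of_not_preserves hsnF
  have hDM := hDiv _ _ hM
  have hBσ' : ∀ b ∈ B, σ ++ [b] ∉ M.Div ∧ σ ++ [b] ∉ M'.Div :=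
    fun b hb => ⟨hBσ b hb, hDM ▸ hBσ b hb⟩
  obtain ⟨L₂, r₂, al₂, Div₂, Inf₂, Sf₂⟩ := hr.exists_refusing hM hB
    (fun h => hB' ⟨⟨h, hDM ▸ hσ⟩, fun b hb => hDM ▸ hBσ b hb⟩) hσ (hDM ▸ hσ) False
    (fun h => h.elim) (fun _ => hBσ') sat₁
  have sat₂ : L₂.Saturated := fun f h h' =>
    (Sf₂ f).2 (Or.inl (sat₁ f (Div₂ ▸ h) (al₂ ▸ h')))
  have r₁₂ := hr.trans r₁ r₂
  have al : L₂.alphabet = L.alphabet := al₂.trans al₁.symm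
  obtain ⟨K, h1, h2, h3, h4, h5⟩ := hr.exists_failureForm (preserves_minD_of_Div hDiv) hanF r₁₂
    (W := L.Tr ∩ L.divExt) sat₂ (hDiv _ _ r₁₂).subset
    ((hDiv _ _ r₁₂).symm.subset.trans Div_subset_divExt)
    (fun f h h' => by
      by_cases hd : f.1 ∈ L₂.Div
      · exact sat₂ f hd (al ▸ h')
      · refine (Sf₂ f).2 (Or.inr ⟨al₁ ▸ h', Div₂ ▸ hd, fun _ => divExt_congr Div₁ ▸ h.2, ?_⟩)
        obtain ⟨s, hs, hst⟩ := exists_stable_of_not_mem_Div (L := L₁) (hTr _ _ r₁ ▸ h.1) (Div₂ ▸ hd)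
        exact ⟨fun a ha => ha.2.1.elim, s, hs, hst, fun a ha => ha.2.1.elim⟩)
    (fun f h h' => ⟨hTr _ _ r₁₂ ▸ mem_Tr_of_mem_Sf h, h'⟩)
    (fun f h => by
      rw [Sf₂, or_iff_left fun h' => h (divExt_congr Div₁ ▸ h'.2.2.1 not_false), Sf₁ f h])
  rw [Tr_inter_divExt] at h5
  exact ⟨K, h1, h2, h3.trans (hDiv _ _ r₁₂).symm, h4.trans Inf₂, h5⟩

/-- Adding the infinite words that have only divergent prefixes from some point on. -/
theorem Admissible.exists_infinite_of_eventually (hr : Admissible r) (hInf : ¬ Preserves r Inf)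
    {L : LTS.{u, v} Act} (hL : L.Saturated) :
    ∃ L' : LTS.{u, v} Act, r L L' ∧ L'.Div = L.Div ∧ L'.Sf = L.Sf ∧
      L'.Inf = L.Inf ∪ {ξ | ∃ n, ∀ i ≥ n, pre ξ i ∈ L.Div} := by
  obtain ⟨M, M', ν, hM, hν, hν'⟩ := hr.exists_of_not_preserves hInf
  obtain ⟨L', h1, h2, h3, h4, h5⟩ := hr.exists_infinite hM hν hν' (fun _ => False)
    (fun _ h => h.elim) hL
  refine ⟨L', h1, h3, h4, Set.ext fun ξ => ?_⟩
  rw [h5]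
  refine or_congr_right ⟨?_, ?_⟩
  · rintro ⟨-, n, h | h⟩
    · exact (h 0).elim fun _ h => h.2.elim
    · exact ⟨n, h⟩
  · rintro ⟨n, h⟩
    exact ⟨fun k => ⟨max n k, le_max_right _ _, h _ (le_max_left _ _)⟩, n, Or.inr h⟩

/-- Adding the infinite words that have infinitely many divergent prefixes. -/
theorem Admissible.exists_infinite_of_frequently (hr : Admissible r) (hDiv : Preserves r Div)
    (haenI : ¬ Preserves r aenI) {L : LTS.{u, v} Act} (hL : L.Saturated) :
    ∃ L' : LTS.{u, v} Act, r L L' ∧ L'.Div = L.Div ∧ L'.Sf = L.Sf ∧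
      L'.Inf = L.Inf ∪ {ξ | ∀ n, ∃ i ≥ n, pre ξ i ∈ L.Div} := by
  obtain ⟨M, M', ν, hM, ⟨hν, hν₁⟩, hν'⟩ := hr.exists_of_not_preserves haenI
  have hDM := hDiv _ _ hM
  obtain ⟨L', h1, h2, h3, h4, h5⟩ := hr.exists_infinite hM hν
    (fun h => hν' ⟨h, hDM ▸ hν₁⟩) (fun j => pre ν j ∉ M.Div) (fun _ h => ⟨h, hDM ▸ h⟩) hL
  refine ⟨L', h1, h3, h4, Set.ext fun ξ => ?_⟩
  rw [h5]
  exact or_congr_right ⟨fun h => h.1, fun h => ⟨h, 0, Or.inl hν₁⟩⟩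

theorem anI_union_eventually : L.Inf ∪ {ξ | ∃ n, ∀ i ≥ n, pre ξ i ∈ L.Tr ∩ L.divExt} =
    L.anI ∪ {ξ | ∃ n, ∀ i ≥ n, pre ξ i ∈ L.Tr ∩ L.extT} := by
  rw [Tr_inter_divExt]
  ext ξ
  refine ⟨?_, Or.imp_left fun h => h.1⟩
  rintro (h | h)
  · by_cases hξ : ξ ∈ L.extI
    · obtain ⟨-, n, hn⟩ := mem_extI_iff.1 hξ
      exact Or.inr ⟨n, fun i hi => ⟨pre_mem_Tr_of_mem_Inf h i,
        (mem_extT_iff_of_mem_Tr (pre_mem_Tr_of_mem_Inf h i)).2 (pre_mem_divExt_of_le hi hn)⟩⟩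
    · exact Or.inl ⟨h, hξ⟩
  · exact Or.inr h

theorem aenI_union_eventually : L.Inf ∪ {ξ | ∃ n, ∀ i ≥ n, pre ξ i ∈ L.Div} =
    L.aenI ∪ {ξ | ∃ n, ∀ i ≥ n, pre ξ i ∈ L.Div} := by
  ext ξ
  refine ⟨?_, Or.imp_left fun h => h.1⟩
  rintro (h | h)
  · by_cases hξ : ∃ n, ∀ i ≥ n, pre ξ i ∈ L.Div
    · exact Or.inr hξ
    · push Not at hξ
      exact Or.inl ⟨h, hξ⟩
  · exact Or.inr h

theorem eanI_union_frequently : L.Inf ∪ {ξ | ∀ n, ∃ i ≥ n, pre ξ i ∈ L.Div} =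
    L.eanI ∪ {ξ | ∀ n, ∃ i ≥ n, pre ξ i ∈ L.Div} := by
  ext ξ
  refine ⟨?_, Or.imp_left fun h => h.1⟩
  rintro (h | h)
  · by_cases hξ : ∀ n, ∃ i ≥ n, pre ξ i ∈ L.Div
    · exact Or.inr hξ
    · push Not at hξ
      exact Or.inl ⟨h, hξ⟩
  · exact Or.inr h

end NormalForms

/-! ### The classification -/

section Classification

variable {r : LTS.{u, v} Act → LTS.{u, v} Act → Prop}

theorem Admissible.iff_sanF_minD_anI (hr : Admissible r) (hlock : r livelock bothlock)
    (hsan : Preserves r sanF) (hmin : Preserves r minD) (hTr : ¬ Preserves r Tr)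
    (hanF : ¬ Preserves r anF) (L L' : LTS.{u, v} Act) :
    r L L' ↔ L.alphabet = L'.alphabet ∧ L.sanF = L'.sanF ∧ L.minD = L'.minD ∧
      L.anI = L'.anI := by
  refine ⟨fun h => ⟨hr.alphabet _ _ h, hsan _ _ h, hmin _ _ h, hr.preserves_anI hmin _ _ h⟩, ?_⟩
  rintro ⟨al, san, min, an⟩
  obtain ⟨K, h1, h2, h3, h4, h5⟩ := hr.exists_normal_form_chaotic hlock hmin hTr hanF L
  obtain ⟨K', h1', h2', h3', h4', h5'⟩ := hr.exists_normal_form_chaotic hlock hmin hTr hanF L'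
  have hext := extT_congr al min
  refine hr.of_normal_forms h1 h1' (by rw [h2, h2', al]) ?_ (by rw [h3, h3', hext])
    (by rw [h4, h4', an, extI_congr al min])
  rw [h5, h5', failureForm_congr al min san hext]

theorem Admissible.iff_Tr_sanF_minD_anI (hr : Admissible r) (hlock : r livelock bothlock)
    (hTr : Preserves r Tr) (hsan : Preserves r sanF) (hmin : Preserves r minD)
    (hanF : ¬ Preserves r anF) (hDiv : ¬ Preserves r Div) (hInf : ¬ Preserves r Inf)
    (L L' : LTS.{u, v} Act) :
    r L L' ↔ L.alphabet = L'.alphabet ∧ L.Tr = L'.Tr ∧ L.sanF = L'.sanF ∧ L.minD = L'.minD ∧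
      L.anI = L'.anI := by
  have normal : ∀ L : LTS.{u, v} Act, ∃ K : LTS.{u, v} Act, r L K ∧ K.alphabet = L.alphabet ∧
      K.Div = L.Tr ∩ L.extT ∧ K.Inf = L.anI ∪ {ξ | ∃ n, ∀ i ≥ n, pre ξ i ∈ L.Tr ∩ L.extT} ∧
      K.Sf = L.failureForm (L.Tr ∩ L.extT) := by
    intro L
    obtain ⟨L₁, r₁, Div₁, Inf₁, sat₁, Sf₁⟩ := hr.exists_divExt_saturated hlock hTr hDiv L
    obtain ⟨L₂, r₂, Div₂, Sf₂, Inf₂⟩ := hr.exists_infinite_of_eventually hInf sat₁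
    obtain ⟨K, h1, h2, h3, h4, h5⟩ := hr.exists_normal_form_divExt hmin hTr hanF
      (hr.trans r₁ r₂) (Div₂.trans Div₁)
      (fun f h h' => Sf₂ ▸ sat₁ f (Div₂ ▸ h) (hr.alphabet _ _ r₂ ▸ h'))
      (fun f h => Sf₂ ▸ Sf₁ f h)
    exact ⟨K, h1, h2, h3, by rw [h4, Inf₂, Inf₁, Div₁, anI_union_eventually], h5⟩
  refine ⟨fun h => ⟨hr.alphabet _ _ h, hTr _ _ h, hsan _ _ h, hmin _ _ h,
    hr.preserves_anI hmin _ _ h⟩, ?_⟩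
  rintro ⟨al, tr, san, min, an⟩
  obtain ⟨K, h1, h2, h3, h4, h5⟩ := normal L
  obtain ⟨K', h1', h2', h3', h4', h5'⟩ := normal L'
  have hext := extT_congr al min
  refine hr.of_normal_forms h1 h1' (by rw [h2, h2', al]) ?_ (by rw [h3, h3', hext, tr])
    (by rw [h4, h4', an, tr, hext])
  rw [h5, h5', failureForm_congr al min san (by rw [tr, hext])]

theorem Admissible.iff_Tr_sanF_minD_Inf (hr : Admissible r) (hlock : r livelock bothlock)
    (hsan : Preserves r sanF) (hmin : Preserves r minD) (hInf : Preserves r Inf)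
    (hanF : ¬ Preserves r anF) (hDiv : ¬ Preserves r Div) (L L' : LTS.{u, v} Act) :
    r L L' ↔ L.alphabet = L'.alphabet ∧ L.Tr = L'.Tr ∧ L.sanF = L'.sanF ∧ L.minD = L'.minD ∧
      L.Inf = L'.Inf := by
  have hTr := hr.preserves_Tr_of_Inf hInf
  have normal : ∀ L : LTS.{u, v} Act, ∃ K : LTS.{u, v} Act, r L K ∧ K.alphabet = L.alphabet ∧
      K.Div = L.Tr ∩ L.extT ∧ K.Sf = L.failureForm (L.Tr ∩ L.extT) := by
    intro L
    obtain ⟨L₁, r₁, Div₁, -, sat₁, Sf₁⟩ := hr.exists_divExt_saturated hlock hTr hDiv L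
    obtain ⟨K, h1, h2, h3, -, h5⟩ := hr.exists_normal_form_divExt hmin hTr hanF r₁ Div₁ sat₁ Sf₁
    exact ⟨K, h1, h2, h3, h5⟩
  refine ⟨fun h => ⟨hr.alphabet _ _ h, hTr _ _ h, hsan _ _ h, hmin _ _ h, hInf _ _ h⟩, ?_⟩
  rintro ⟨al, tr, san, min, inf⟩
  obtain ⟨K, h1, h2, h3, h4⟩ := normal L
  obtain ⟨K', h1', h2', h3', h4'⟩ := normal L'
  have hext := extT_congr al min
  refine hr.of_normal_forms h1 h1' (by rw [h2, h2', al]) ?_ (by rw [h3, h3', hext, tr])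
    (by rw [← hInf _ _ h1, ← hInf _ _ h1', inf])
  rw [h4, h4', failureForm_congr al min san (by rw [tr, hext])]

/-- The common part of the cases in which divergence traces are preserved: `I` is the kind of
infinite traces that is preserved, and it determines the infinite traces of a suitable saturated
LTS. -/
theorem Admissible.iff_of_preserves_Div (hr : Admissible r) (hsan : Preserves r sanF)
    (hDiv : Preserves r Div) (hanF : ¬ Preserves r anF) (hsnF : ¬ Preserves r snF)
    {I : LTS.{u, v} Act → Set (ℕ → Act)} (hI : Preserves r I)
    {G : Set (List Act) → Set (ℕ → Act)}
    (hG : ∀ L : LTS.{u, v} Act, L.Saturated → ∃ L' : LTS.{u, v} Act, r L L' ∧ L'.Sf = L.Sf ∧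
      L'.Inf = I L ∪ G L.Div)
    (hlock : r livelock bothlock) (L L' : LTS.{u, v} Act) :
    r L L' ↔ L.alphabet = L'.alphabet ∧ L.Tr = L'.Tr ∧ L.sanF = L'.sanF ∧ L.Div = L'.Div ∧
      I L = I L' := by
  have normal : ∀ L : LTS.{u, v} Act, ∃ K : LTS.{u, v} Act, r L K ∧ K.alphabet = L.alphabet ∧
      K.Div = L.Div ∧ K.Inf = I L ∪ G L.Div ∧ K.Sf = L.failureForm (L.Tr ∩ L.extT) := by
    intro L
    obtain ⟨L₁, r₁, al₁, Div₁, Inf₁, Sf₁⟩ := hr.exists_saturated hlock L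
    have sat₁ : L₁.Saturated := fun f h h' => (Sf₁ f).2 (Or.inr ⟨Div₁ ▸ h, al₁ ▸ h'⟩)
    obtain ⟨L₂, r₂, Sf₂, Inf₂⟩ := hG L₁ sat₁
    obtain ⟨K, h1, h2, h3, h4, h5⟩ := hr.exists_normal_form_Div hDiv hanF hsnF (hr.trans r₁ r₂)
      (fun f h h' => Sf₂ ▸ sat₁ f (hDiv _ _ r₂ ▸ h) (hr.alphabet _ _ r₂ ▸ h'))
      (fun f h => by rw [Sf₂, Sf₁, or_iff_left fun h' => h (Div_subset_divExt h'.1)])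
    exact ⟨K, h1, h2, h3, by rw [h4, Inf₂, Div₁, hI _ _ r₁], h5⟩
  refine ⟨fun h => ⟨hr.alphabet _ _ h, hr.preserves_Tr_of_Div hDiv _ _ h, hsan _ _ h, hDiv _ _ h,
    hI _ _ h⟩, ?_⟩
  rintro ⟨al, tr, san, div, inf⟩
  obtain ⟨K, h1, h2, h3, h4, h5⟩ := normal L
  obtain ⟨K', h1', h2', h3', h4', h5'⟩ := normal L'
  refine hr.of_normal_forms h1 h1' (by rw [h2, h2', al]) ?_ (by rw [h3, h3', div])
    (by rw [h4, h4', inf, div])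
  rw [h5, h5', failureForm_congr al (minD_congr div) san (by rw [tr, extT_congr al (minD_congr div)])]

end Classification

end LTS

theorem mainTheorem11 {Act : Type v} (hAct : ¬ Small.{u} Act)
    (r : LTS.{u, v} Act → LTS.{u, v} Act → Prop) (hr : LTS.IsCongruence r)
    (hCFFD : ∀ L L' : LTS.{u, v} Act, LTS.CFFDEquiv L L' → r L L')
    (hlock : r LTS.livelock LTS.bothlock) :
    (LTS.Preserves r LTS.sanF → LTS.Preserves r LTS.minD →
      ¬ LTS.Preserves r LTS.Tr → ¬ LTS.Preserves r LTS.anF →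
      ∀ L L', r L L' ↔ (L.alphabet = L'.alphabet ∧ L.sanF = L'.sanF ∧ L.minD = L'.minD ∧
        L.anI = L'.anI)) ∧
    (LTS.Preserves r LTS.Tr → LTS.Preserves r LTS.sanF → LTS.Preserves r LTS.minD →
      ¬ LTS.Preserves r LTS.anF → ¬ LTS.Preserves r LTS.Div → ¬ LTS.Preserves r LTS.Inf →
      ∀ L L', r L L' ↔ (L.alphabet = L'.alphabet ∧ L.Tr = L'.Tr ∧ L.sanF = L'.sanF ∧
        L.minD = L'.minD ∧ L.anI = L'.anI)) ∧
    (LTS.Preserves r LTS.sanF → LTS.Preserves r LTS.minD → LTS.Preserves r LTS.Inf →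
      ¬ LTS.Preserves r LTS.anF → ¬ LTS.Preserves r LTS.Div →
      ∀ L L', r L L' ↔ (L.alphabet = L'.alphabet ∧ L.Tr = L'.Tr ∧ L.sanF = L'.sanF ∧
        L.minD = L'.minD ∧ L.Inf = L'.Inf)) ∧
    (LTS.Preserves r LTS.sanF → LTS.Preserves r LTS.Div →
      ¬ LTS.Preserves r LTS.anF → ¬ LTS.Preserves r LTS.snF → ¬ LTS.Preserves r LTS.aenI →
      ∀ L L', r L L' ↔ (L.alphabet = L'.alphabet ∧ L.Tr = L'.Tr ∧ L.sanF = L'.sanF ∧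
        L.Div = L'.Div ∧ L.eanI = L'.eanI)) ∧
    (LTS.Preserves r LTS.sanF → LTS.Preserves r LTS.Div → LTS.Preserves r LTS.aenI →
      ¬ LTS.Preserves r LTS.anF → ¬ LTS.Preserves r LTS.snF → ¬ LTS.Preserves r LTS.Inf →
      ∀ L L', r L L' ↔ (L.alphabet = L'.alphabet ∧ L.Tr = L'.Tr ∧ L.sanF = L'.sanF ∧
        L.Div = L'.Div ∧ L.aenI = L'.aenI)) ∧
    (LTS.Preserves r LTS.sanF → LTS.Preserves r LTS.Div → LTS.Preserves r LTS.Inf →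
      ¬ LTS.Preserves r LTS.anF → ¬ LTS.Preserves r LTS.snF →
      ∀ L L', r L L' ↔ (L.alphabet = L'.alphabet ∧ L.Tr = L'.Tr ∧ L.sanF = L'.sanF ∧
        L.Div = L'.Div ∧ L.Inf = L'.Inf)) := by
  have hsan_of : LTS.Preserves r LTS.sanF → LTS.Admissible r := fun h =>
    ⟨hAct, hr, hCFFD, LTS.alphabet_eq_of_preserves_sanF hAct hr h⟩
  refine ⟨fun hsan hmin hTr hanF => (hsan_of hsan).iff_sanF_minD_anI hlock hsan hmin hTr hanF,
    fun hTr hsan hmin hanF hDiv hInf =>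
      (hsan_of hsan).iff_Tr_sanF_minD_anI hlock hTr hsan hmin hanF hDiv hInf,
    fun hsan hmin hInf hanF hDiv =>
      (hsan_of hsan).iff_Tr_sanF_minD_Inf hlock hsan hmin hInf hanF hDiv,
    fun hsan hDiv hanF hsnF haenI => ?_, fun hsan hDiv haenI hanF hsnF hInf => ?_,
    fun hsan hDiv hInf hanF hsnF => ?_⟩
  · have hadm := hsan_of hsan
    refine hadm.iff_of_preserves_Div hsan hDiv hanF hsnF (hadm.preserves_eanI hDiv)
      (G := fun X => {ξ | ∀ n, ∃ i ≥ n, LTS.pre ξ i ∈ X}) (fun L hL => ?_) hlock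
    obtain ⟨L', h1, -, h3, h4⟩ := hadm.exists_infinite_of_frequently hDiv haenI hL
    exact ⟨L', h1, h3, h4.trans LTS.eanI_union_frequently⟩
  · have hadm := hsan_of hsan
    refine hadm.iff_of_preserves_Div hsan hDiv hanF hsnF haenI
      (G := fun X => {ξ | ∃ n, ∀ i ≥ n, LTS.pre ξ i ∈ X}) (fun L hL => ?_) hlock
    obtain ⟨L', h1, -, h3, h4⟩ := hadm.exists_infinite_of_eventually hInf hL
    exact ⟨L', h1, h3, h4.trans LTS.aenI_union_eventually⟩
  · exact (hsan_of hsan).iff_of_preserves_Div hsan hDiv hanF hsnF hInf (G := fun _ => ∅)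
      (fun L _ => ⟨L, hr.equivalence.refl L, rfl, (Set.union_empty _).symm⟩) hlock
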